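/- **Setting.** Let $3\le K\le M$ be integers, $\rho>0$, $s>\frac12$, $0\le\nu<\frac12$, $0<\gamma\le1$, and let $\tau>0$, $\epsilon>0$, $t_n=n\tau$. Put $\omega_l=\sqrt{l^2+\rho}$, $\sigma_l=\max(|l|,1)^{2s}$, and $e(0)=2$, $e(l)=|l|$ for $0<|l|<K$, $e(l)=K$ for $|l|\ge K$. Indices $j\in\{-M,\dots,M-1\}$ are understood modulo $2M$ (so that the index $M$ is identified with $-M$), and $|j|$ refers to the representative in $\{-M,\dots,M-1\}$. For $\mathbf k=(k_0,\dots,k_M)\in\mathbb Z^{M+1}$ let $\mathbf k\cdot\boldsymbol\omega=\sum_{l=0}^M k_l\omega_l$ and $\mu(\mathbf k)=\sum_{l=0}^M|k_l|e(l)$, and let $\langle j\rangle$ be the $|j|$-th unit vector of $\mathbb Z^{M+1}$. Let $\mathcal K$ be the set of all $(j,\mathbf k)$ with $\max(|j|,\mu(\mathbf k))<2K$ and $k_l=0$ for all $l\ge K$, together with all $(j,\pm\langle (j-r)\bmod 2M\rangle+\mathbf k)$ with $|(j-r)\bmod 2M|\ge K$, $|r|<K$, $\mu(\mathbf k)<K$;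 let $\mathcal K_j=\{\mathbf k:(j,\mathbf k)\in\mathcal K\}$. The numerical solution $\mathbf u^n=(u_j^n)_{j=-M}^{M-1}$ with velocity approximation $\dot{\mathbf u}^n$ is computed from $\mathbf u^0,\dot{\mathbf u}^0$ by \[ \mathbf u^{n+1}-2\cos(\tau\boldsymbol\Omega)\mathbf u^n+\mathbf u^{n-1}=\tau^2\boldsymbol\Psi\bigl((\boldsymbol\Phi\mathbf u^n)\ast(\boldsymbol\Phi\mathbf u^n)\bigr),\qquad 2\tau\,\mathrm{sinc}(\tau\boldsymbol\Omega)\dot{\mathbf u}^n=\mathbf u^{n+1}-\mathbf u^{n-1}\qquad(n\ge1), \] \[ \mathbf u^1=\cos(\tau\boldsymbol\Omega)\mathbf u^0+\tau\,\mathrm{sinc}(\tau\boldsymbol\Omega)\dot{\mathbf u}^0+\tfrac12\tau^2\boldsymbol\Psi\bigl((\boldsymbol\Phi\mathbf u^0)\ast(\boldsymbol\Phi\mathbf u^0)\bigr), \] where $\boldsymbol\Omega=\mathrm{diag}(\omega_j)$, $(\mathbf u\ast\mathbf v)_j=\sum_{j_1+j_2\equiv j\bmod 2M}u_{j_1}v_{j_2}$,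 $\boldsymbol\Psi=\psi(\tau\boldsymbol\Omega)$, $\boldsymbol\Phi=\phi(\tau\boldsymbol\Omega)$ with real-valued even filter functions satisfying $|\psi|,|\phi|\le B$, $\psi(0)=\phi(0)=1$ and $\psi(\xi)=\mathrm{sinc}(\xi)\phi(\xi)$. The initial values are real at the collocation points, i.e. $u^0_{-j}=\overline{u^0_j}$ and $\dot u^0_{-j}=\overline{\dot u^0_j}$. Let $E_l^0=\frac12|\omega_lu_l^0|^2+\frac12|\dot u_l^0|^2$ and \[ \|\mathbf v\|=\Bigl(\sum_{j=-M}^{M-1}\sigma_j\epsilon^{-2e(j)\nu}|v_j|^2\Bigr)^{1/2}. \] **Non-resonance condition.** \[ \bigl|\sin\bigl(\tfrac12\tau(\omega_j\pm\mathbf k\cdot\boldsymbol\omega)\bigr)\bigr|\ge\gamma\tau\epsilon^{\nu/2}\quad\text{for all }(j,\mathbf k)\in\mathcal K,\ \mathbf k\ne\mp\langle j\rangle, \] \[ \bigl|\sin\bigl(\tfrac12\tau(\omega_j\pm\mathbf k\cdot\boldsymbol\omega)\bigr)\bigr|\ge\gamma\tau\quad\text{for all }(j,\mathbf k)\in\mathcal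 K,\ \mathbf k\ne\langle j\rangle,\ \mathbf k\ne-\langle j\rangle,\ |j|\le K. \] **Theorem.** Given $K,\nu,s,\rho,\gamma,C_0,B$ as above, there are $\epsilon_0>0$ and $C>0$, depending only on these quantities (and hence not on $\epsilon$, $\tau$, $M$), such that the following holds for all $M\ge K$, $\tau>0$ and $0<\epsilon\le\epsilon_0$ that satisfy the non-resonance condition, for all filter functions as above and all initial values as above with \[ \sum_{l=0}^M\sigma_l\epsilon^{-e(l)}E_l^0\le C_0 . \] There are polynomials $z_j^{\mathbf k}$, $(j,\mathbf k)\in\mathcal K$, with $z_{-j}^{-\mathbf k}=\overline{z_j^{\mathbf k}}$, such that for $0\le t_n=n\tau\le1$ \[ u_j^n=\sum_{\mathbf k\in\mathcal K_j}z_j^{\mathbf k}(\epsilon^{\nu/2}t_n)e^{i(\mathbf k\cdot\boldsymbol\omega)t_n}+r_j^n, \] \[ \dot u_j^n=\frac1{2\tau\,\mathrm{sinc}(\tau\omega_j)}\sum_{\mathbf k\in\mathcal K_j}\Bigl(z_j^{\mathbf k}(\epsilon^{\nu/2}t_{n+1})e^{i(\mathbf k\cdot\boldsymbol\omega)\tau}-z_j^{\mathbf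 k}(\epsilon^{\nu/2}t_{n-1})e^{-i(\mathbf k\cdot\boldsymbol\omega)\tau}\Bigr)e^{i(\mathbf k\cdot\boldsymbol\omega)t_n}+\dot r_j^n, \] \[ \|\boldsymbol\Omega\mathbf r^n\|+\|\dot{\mathbf r}^n\|\le C\epsilon^{K(1-2\nu)} . \] Moreover, there are functions $d_j^{\mathbf k}$ such that the modulation equations \[ e^{i(\mathbf k\cdot\boldsymbol\omega)\tau}z_j^{\mathbf k}(\epsilon^{\nu/2}(t+\tau))-2\cos(\tau\omega_j)z_j^{\mathbf k}(\epsilon^{\nu/2}t)+e^{-i(\mathbf k\cdot\boldsymbol\omega)\tau}z_j^{\mathbf k}(\epsilon^{\nu/2}(t-\tau)) \] \[ =-\tau^2\psi(\tau\omega_j)\nabla_{-j}^{-\mathbf k}\mathcal U\bigl(\boldsymbol\Phi\mathbf z(\epsilon^{\nu/2}t)\bigr)+\tau^2\psi(\tau\omega_j)d_j^{\mathbf k}(\epsilon^{\nu/2}t),\qquad(j,\mathbf k)\in\mathcal K,\ t\in\mathbb R, \] hold, where $\boldsymbol\Phi\mathbf z=(\phi(\tau\omega_j)z_j^{\mathbf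 k})$, $\nabla_{-j}^{-\mathbf k}$ is the partial derivative with respect to $z_{-j}^{-\mathbf k}$, and \[ \mathcal U(\mathbf z)=-\frac13\sum_{j_1+j_2+j_3\equiv0\bmod 2M}\ \sum_{\mathbf k^1+\mathbf k^2+\mathbf k^3=\mathbf 0,\ \mathbf k^i\in\mathcal K_{j_i}}z_{j_1}^{\mathbf k^1}z_{j_2}^{\mathbf k^2}z_{j_3}^{\mathbf k^3}, \] and the vector $\mathbf d(t)$ with entries $d_j(t)=\sum_{\mathbf k\in\mathcal K_j}|d_j^{\mathbf k}(\epsilon^{\nu/2}t)|$ satisfies $\|\mathbf d(t)\|\le C\epsilon^{K(1-2\nu)}$ for $0\le t\le1$. -/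

import Mathlib

open scoped BigOperators

/-
Spatial Fourier indices. The indices `j = -M, …, M-1` are only used modulo `2M`, so they are modelled
as elements of `ZMod (2 * M)`. The negative of the class of `-M` is itself, which is
the convention `u_M = u_{-M}`, `z_M = z_{-M}`. All weights depend on `j` only through the
absolute value `|j|` of its representative in `{-M, …, M-1}`.
-/

/-- The absolute value `|j|` of the representative of `j` in `{-M, …, M-1}`; it lies in
`{0, …, M}`. -/
def absIdx {M : ℕ} (j : ZMod (2 * M)) : ℕ := j.valMinAbs.natAbs

/-- The frequency `ω_l = √(l² + ρ)`. -/
noncomputable def freq (ρ : ℝ) (l : ℕ) : ℝ := Real.sqrt ((l : ℝ) ^ 2 + ρ)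

/-- The weight `σ_l = max(l, 1)^{2s}`. -/
noncomputable def sobWeight (s : ℝ) (l : ℕ) : ℝ := (max (l : ℝ) 1) ^ (2 * s)

/-- The energy profile: `e(0) = 2`, `e(l) = l` for `0 < l < K`, `e(l) = K` for `l ≥ K`. -/
def profile (K l : ℕ) : ℕ := if l = 0 then 2 else if l < K then l else K

/-- `μ(k) = ∑_{l=0}^M |k_l| e(l)`. -/
def mu (K : ℕ) {M : ℕ} (k : Fin (M + 1) → ℤ) : ℕ :=
  ∑ l : Fin (M + 1), (k l).natAbs * profile K l

/-- `k · ω = ∑_{l=0}^M k_l ω_l`. -/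
noncomputable def dotFreq (ρ : ℝ) {M : ℕ} (k : Fin (M + 1) → ℤ) : ℝ :=
  ∑ l : Fin (M + 1), (k l : ℝ) * freq ρ l

/-- `⟨j⟩`, the `|j|`-th unit vector of `ℤ^{M+1}`. -/
def unitVec {M : ℕ} (j : ZMod (2 * M)) : Fin (M + 1) → ℤ :=
  fun l => if (l : ℕ) = absIdx j then 1 else 0

/-- The set `𝒦_j = {k : (j, k) ∈ 𝒦}`. -/
def modSet (K : ℕ) {M : ℕ} (j : ZMod (2 * M)) : Set (Fin (M + 1) → ℤ) :=
  {k | (max (absIdx j) (mu K k) < 2 * K ∧ ∀ l : Fin (M + 1), K ≤ (l : ℕ) → k l = 0) ∨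
    ∃ (r : ℤ) (k' : Fin (M + 1) → ℤ), K ≤ absIdx (j - (r : ZMod (2 * M))) ∧ |r| < (K : ℤ) ∧
      mu K k' < K ∧
      (k = unitVec (j - (r : ZMod (2 * M))) + k' ∨ k = -unitVec (j - (r : ZMod (2 * M))) + k')}

theorem natAbs_le_mu {K M : ℕ} (hK : 0 < K) (k : Fin (M + 1) → ℤ) (l : Fin (M + 1)) :
    (k l).natAbs ≤ mu K k := by
  have h1 : 1 ≤ profile K l := by
    unfold profile
    split_ifs <;> omega
  calc (k l).natAbs ≤ (k l).natAbs * profile K l := Nat.le_mul_of_pos_right _ h1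
    _ ≤ mu K k := Finset.single_le_sum (f := fun l : Fin (M + 1) => (k l).natAbs * profile K l)
        (fun _ _ => Nat.zero_le _) (Finset.mem_univ l)

theorem modSet_finite (K : ℕ) {M : ℕ} (j : ZMod (2 * M)) : (modSet K j).Finite := by
  refine (Set.Finite.pi' (fun _ : Fin (M + 1) =>
    Set.finite_Icc (-(2 * K + 1 : ℤ)) (2 * K + 1))).subset ?_
  rintro k (⟨h, -⟩ | ⟨r, k', -, -, h, hk⟩) l
  · have h2 := (max_lt_iff.1 h).2
    have := natAbs_le_mu (K := K) (by omega) k l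
    simp only [Set.mem_Icc]
    omega
  · have := natAbs_le_mu (K := K) (by omega) k' l
    have hu : unitVec (j - (r : ZMod (2 * M))) l = 0 ∨ unitVec (j - (r : ZMod (2 * M))) l = 1 := by
      unfold unitVec
      split_ifs <;> simp
    simp only [Set.mem_Icc]
    rcases hk with rfl | rfl <;> simp only [Pi.add_apply, Pi.neg_apply] <;> omega

/-- The finite set `𝒦_j` as a `Finset`, for summation. -/
noncomputable def modFinset (K : ℕ) {M : ℕ} (j : ZMod (2 * M)) : Finset (Fin (M + 1) → ℤ) :=
  (modSet_finite K j).toFinset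

/-- The numerical non-resonance condition with constant `γ`: the weak part for all `(j, k) ∈ 𝒦`
and the strong part for `|j| ≤ K`. -/
structure NonResonant (K M : ℕ) (ρ τ ε ν γ : ℝ) : Prop where
  weak_add : ∀ (j : ZMod (2 * M)), ∀ k ∈ modSet K j, k ≠ -unitVec j →
    γ * τ * ε ^ (ν / 2) ≤ |Real.sin (1 / 2 * τ * (freq ρ (absIdx j) + dotFreq ρ k))|
  weak_sub : ∀ (j : ZMod (2 * M)), ∀ k ∈ modSet K j, k ≠ unitVec j →
    γ * τ * ε ^ (ν / 2) ≤ |Real.sin (1 / 2 * τ * (freq ρ (absIdx j) - dotFreq ρ k))|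
  strong_add : ∀ (j : ZMod (2 * M)), ∀ k ∈ modSet K j, k ≠ unitVec j → k ≠ -unitVec j →
    absIdx j ≤ K →
    γ * τ ≤ |Real.sin (1 / 2 * τ * (freq ρ (absIdx j) + dotFreq ρ k))|
  strong_sub : ∀ (j : ZMod (2 * M)), ∀ k ∈ modSet K j, k ≠ unitVec j → k ≠ -unitVec j →
    absIdx j ≤ K →
    γ * τ ≤ |Real.sin (1 / 2 * τ * (freq ρ (absIdx j) - dotFreq ρ k))|

/-- Admissible filter functions of a symplectic trigonometric integrator: even, bounded (by `B`),
with value `1` at `0`, and `ψ = sinc · φ`. -/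
structure IsSymplecticFilter (B : ℝ) (ψ φ : ℝ → ℝ) : Prop where
  bound_φ : ∀ ξ, |φ ξ| ≤ B
  bound_ψ : ∀ ξ, |ψ ξ| ≤ B
  even_φ : ∀ ξ, φ (-ξ) = φ ξ
  even_ψ : ∀ ξ, ψ (-ξ) = ψ ξ
  φ_zero : φ 0 = 1
  ψ_zero : ψ 0 = 1
  symplectic : ∀ ξ, ψ ξ = Real.sinc ξ * φ ξ

/-- Multiplication of a vector of Fourier coefficients by the diagonal matrix `f(Ω)`. -/
noncomputable def diagMul (ρ : ℝ) {M : ℕ} (f : ℝ → ℝ) (v : ZMod (2 * M) → ℂ) :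
    ZMod (2 * M) → ℂ :=
  fun j => (f (freq ρ (absIdx j)) : ℂ) * v j

/-- The discrete convolution `(u ∗ v)_j = ∑_{j₁ + j₂ ≡ j mod 2M} u_{j₁} v_{j₂}`. -/
noncomputable def discConv {M : ℕ} [NeZero M] (u v : ZMod (2 * M) → ℂ) : ZMod (2 * M) → ℂ :=
  fun j => ∑ j₁ : ZMod (2 * M), u j₁ * v (j - j₁)

/-- The nonlinear term `Ψ((Φu) ∗ (Φu))` with `Ψ = ψ(τΩ)`, `Φ = φ(τΩ)`. -/
noncomputable def nonlinTerm (ρ τ : ℝ) (ψ φ : ℝ → ℝ) {M : ℕ} [NeZero M]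
    (u : ZMod (2 * M) → ℂ) : ZMod (2 * M) → ℂ :=
  diagMul ρ (fun w => ψ (τ * w))
    (discConv (diagMul ρ (fun w => φ (τ * w)) u) (diagMul ρ (fun w => φ (τ * w)) u))

/-- `u n` and `v n` are the numerical solution `uⁿ` and its velocity approximation `u̇ⁿ`,
computed by the trigonometric integrator from the initial values `u 0`, `v 0`. -/
structure IsTrigIntegrator (ρ τ : ℝ) (ψ φ : ℝ → ℝ) {M : ℕ} [NeZero M]
    (u v : ℕ → ZMod (2 * M) → ℂ) : Prop where
  start : ∀ j, u 1 j = (Real.cos (τ * freq ρ (absIdx j)) : ℂ) * u 0 j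
    + (τ : ℂ) * (Real.sinc (τ * freq ρ (absIdx j)) : ℂ) * v 0 j
    + 1 / 2 * (τ : ℂ) ^ 2 * nonlinTerm ρ τ ψ φ (u 0) j
  step : ∀ n j, u (n + 2) j - 2 * (Real.cos (τ * freq ρ (absIdx j)) : ℂ) * u (n + 1) j + u n j
    = (τ : ℂ) ^ 2 * nonlinTerm ρ τ ψ φ (u (n + 1)) j
  velocity : ∀ n j, 2 * (τ : ℂ) * (Real.sinc (τ * freq ρ (absIdx j)) : ℂ) * v (n + 1) j
    = u (n + 2) j - u n j

/-- The trigonometric polynomial with Fourier coefficients `v` is real at the collocation points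
`πk/M`: `v_{-j}` is the complex conjugate of `v_j` (indices modulo `2M`). -/
def IsRealData {M : ℕ} (v : ZMod (2 * M) → ℂ) : Prop :=
  ∀ j, v (-j) = starRingEnd ℂ (v j)

/-- The mode energy `E_j = ½ |ω_j u_j|² + ½ |u̇_j|²`. -/
noncomputable def modeEnergy (ρ : ℝ) {M : ℕ} (u v : ZMod (2 * M) → ℂ) (j : ZMod (2 * M)) : ℝ :=
  1 / 2 * ‖(freq ρ (absIdx j) : ℂ) * u j‖ ^ 2 + 1 / 2 * ‖v j‖ ^ 2

/-- The weighted norm `‖v‖ = (∑_j σ_j ε^{-2e(j)ν} |v_j|²)^{1/2}`. -/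
noncomputable def wnorm (K : ℕ) (s ν ε : ℝ) {M : ℕ} [NeZero M] (v : ZMod (2 * M) → ℂ) : ℝ :=
  Real.sqrt (∑ j : ZMod (2 * M),
    sobWeight s (absIdx j) * ε ^ (-2 * (profile K (absIdx j) : ℝ) * ν) * ‖v j‖ ^ 2)

/-- `e^{i (k·ω) t}`. -/
noncomputable def phase (ρ : ℝ) {M : ℕ} (k : Fin (M + 1) → ℤ) (t : ℝ) : ℂ :=
  Complex.exp (Complex.I * (dotFreq ρ k : ℂ) * (t : ℂ))

/-- The modulation function in slow time, `z_j^k(ε^{ν/2} t)`. -/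
noncomputable def slowEval (ε ν : ℝ) (p : Polynomial ℂ) (t : ℝ) : ℂ :=
  p.eval ((ε ^ (ν / 2) * t : ℝ) : ℂ)

/-- The modulated Fourier expansion `∑_{k ∈ 𝒦_j} z_j^k(ε^{ν/2} t) e^{i(k·ω)t}`. -/
noncomputable def mfe (K : ℕ) (ρ ε ν : ℝ) {M : ℕ}
    (z : ZMod (2 * M) → (Fin (M + 1) → ℤ) → Polynomial ℂ) (t : ℝ) : ZMod (2 * M) → ℂ :=
  fun j => ∑ k ∈ modFinset K j, slowEval ε ν (z j k) t * phase ρ k t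

/-- The modulated Fourier expansion of the velocity approximation,
`(2τ sinc(τω_j))⁻¹ ∑_{k ∈ 𝒦_j} (z_j^k(ε^{ν/2}(t+τ)) e^{i(k·ω)τ}
  - z_j^k(ε^{ν/2}(t-τ)) e^{-i(k·ω)τ}) e^{i(k·ω)t}`. -/
noncomputable def mfeVel (K : ℕ) (ρ τ ε ν : ℝ) {M : ℕ}
    (z : ZMod (2 * M) → (Fin (M + 1) → ℤ) → Polynomial ℂ) (t : ℝ) : ZMod (2 * M) → ℂ :=
  fun j => (2 * (τ : ℂ) * (Real.sinc (τ * freq ρ (absIdx j)) : ℂ))⁻¹ *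
    ∑ k ∈ modFinset K j,
      (slowEval ε ν (z j k) (t + τ) * phase ρ k τ
        - slowEval ε ν (z j k) (t - τ) * phase ρ k (-τ)) * phase ρ k t

/-- The extended potential
`𝒰(z) = -⅓ ∑_{j₁+j₂+j₃≡0} ∑_{k¹+k²+k³=0} z_{j₁}^{k¹} z_{j₂}^{k²} z_{j₃}^{k³}`, where
`k^i ∈ 𝒦_{j_i}`. -/
noncomputable def extPotential (K : ℕ) {M : ℕ} [NeZero M]
    (z : ZMod (2 * M) → (Fin (M + 1) → ℤ) → ℂ) : ℂ :=
  -(1 / 3) * ∑ j₁ : ZMod (2 * M), ∑ j₂ : ZMod (2 * M), ∑ j₃ : ZMod (2 * M),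
    ∑ k₁ ∈ modFinset K j₁, ∑ k₂ ∈ modFinset K j₂, ∑ k₃ ∈ modFinset K j₃,
      if j₁ + j₂ + j₃ = 0 ∧ k₁ + k₂ + k₃ = 0 then z j₁ k₁ * z j₂ k₂ * z j₃ k₃ else 0

/-- The partial derivative of `𝒰` at `z` with respect to the variable `z_j^k`. -/
noncomputable def gradPotential (K : ℕ) {M : ℕ} [NeZero M]
    (j : ZMod (2 * M)) (k : Fin (M + 1) → ℤ)
    (z : ZMod (2 * M) → (Fin (M + 1) → ℤ) → ℂ) : ℂ :=
  deriv (fun w : ℂ => extPotential K (Function.update z j (Function.update (z j) k w))) (z j k)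

/-- The modulation equations, for all `t`, with defect `d_j^k` (a function of slow time). -/
def SatisfiesModSystem (K : ℕ) (ρ τ ε ν : ℝ) (ψ φ : ℝ → ℝ) {M : ℕ} [NeZero M]
    (z : ZMod (2 * M) → (Fin (M + 1) → ℤ) → Polynomial ℂ)
    (d : ZMod (2 * M) → (Fin (M + 1) → ℤ) → ℝ → ℂ) : Prop :=
  ∀ (j : ZMod (2 * M)), ∀ k ∈ modSet K j, ∀ t : ℝ,
    phase ρ k τ * slowEval ε ν (z j k) (t + τ)
      - 2 * (Real.cos (τ * freq ρ (absIdx j)) : ℂ) * slowEval ε ν (z j k) t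
      + phase ρ k (-τ) * slowEval ε ν (z j k) (t - τ)
    = -((τ : ℂ) ^ 2 * (ψ (τ * freq ρ (absIdx j)) : ℂ) *
        gradPotential K (-j) (-k)
          (fun j' k' => (φ (τ * freq ρ (absIdx j')) : ℂ) * slowEval ε ν (z j' k') t))
      + (τ : ℂ) ^ 2 * (ψ (τ * freq ρ (absIdx j)) : ℂ) * d j k (ε ^ (ν / 2) * t)

/-! The proof builds a modulated Fourier expansion. Inserting the ansatz into the two-step scheme
and comparing coefficients of `e^{i(k·ω)t}` gives, for each `(j,k)`, an equation `modOp θ α h z =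
τ²ψ(α) g` on polynomials in slow time, with `θ = τ k·ω`, `α = τω_j`, `h = ε^{ν/2}τ` and `g`
quadratic in `z`.

Linear part. Taylor expansion gives `modOp p = (2cos θ - 2cos α) p + 2i h sin θ p' + O(h²)`, where
the `O(h²)` remainder lowers the degree by two. If `k ≠ ±⟨j⟩`, the leading coefficient is a product
of two half-angle sines, bounded below by non-resonance. If `k = ±⟨j⟩`, it vanishes, and the
derivative term is inverted by an antiderivative that leaves a constant free. The two free constants
of mode `j` are fixed by the initial position and velocity. What is left after inverting the
dominant term has lower degree, so the correction terminates (`exists_solution_of_approx`). The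
symplectic relation `ψ = sinc · φ` gives `τ|ψ(α)| ≲ |sin α|`, which cancels the division by `sin α`.
The net cost is a factor `ε^{-ν}`, or `1` for `|j| ≤ K` off the diagonal (`exists_single_solution`,
`exists_mode_solution`, `exists_linear_solution`).

Sizes. A subadditive integer `idxSize` counts the order at which `(j,k)` is generated from the
initial modes, and `𝒦` is exactly the set `idxSize < 2K`. The entry `z_j^k` is expected to be of
order `ε^{w}` with `w = n/2 - ν(n-K)₊`, `n = idxSize`. The central inequality
`sizeExp_add_lossExp_le` says that in a product the exponents of the factors pay for the exponent of
the result plus the non-resonance loss. Products leaving `𝒦` have order at least `ε^{K-Kν}`.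

Iteration. The quadratic system is not solved exactly. Finitely many Picard steps stay bounded in
the weighted norm, because losses are absorbed and the Sobolev space with `s > 1/2` is an algebra
uniformly in `M` (`exists_snorm_rconv_le`). In the unweighted norm consecutive iterates approach
each other by a factor `ε^{1/2-ν}` per step. After `m ≥ K/(1/2-ν)` steps the defect is `O(ε^{K-Kν})`
(`exists_modIterate`, `exists_expansion`).

Stability. The expansion satisfies the integrator with this small defect and the same initial
values. In the variables `(ω_j u_j, v_j)` one step is a rotation plus `O(τ)` times a quadratic term,
so a discrete Gronwall argument on `nτ ≤ 1` bounds the error by the defect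
(`exists_stability_bound`). Passing to the norm with weights `ε^{-2e(j)ν}` costs at most `ε^{-Kν}`,
which leaves `ε^{K(1-2ν)}`. -/

open Polynomial

/-! ### The `ℓ¹` norm of the coefficients of a polynomial -/

/-- The sum of the absolute values of the coefficients. -/
noncomputable def pnorm (p : ℂ[X]) : ℝ := ∑ i ∈ p.support, ‖p.coeff i‖

theorem pnorm_eq_sum {p : ℂ[X]} {s : Finset ℕ} (h : p.support ⊆ s) :
    pnorm p = ∑ i ∈ s, ‖p.coeff i‖ :=
  Finset.sum_subset h (fun i _ hi => by simp [Polynomial.notMem_support_iff.1 hi])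

theorem pnorm_nonneg (p : ℂ[X]) : 0 ≤ pnorm p := Finset.sum_nonneg fun _ _ => norm_nonneg _

@[simp] theorem pnorm_zero : pnorm 0 = 0 := by simp [pnorm]

theorem pnorm_add_le (p q : ℂ[X]) : pnorm (p + q) ≤ pnorm p + pnorm q := by
  classical
  rw [pnorm_eq_sum (Polynomial.support_add (p := p) (q := q)),
    pnorm_eq_sum (Finset.subset_union_left (s₁ := p.support) (s₂ := q.support)),
    pnorm_eq_sum (Finset.subset_union_right (s₁ := p.support) (s₂ := q.support)),
    ← Finset.sum_add_distrib]
  exact Finset.sum_le_sum fun i _ => by simpa using norm_add_le _ _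

theorem pnorm_neg (p : ℂ[X]) : pnorm (-p) = pnorm p := by simp [pnorm]

theorem pnorm_sub_le (p q : ℂ[X]) : pnorm (p - q) ≤ pnorm p + pnorm q := by
  rw [sub_eq_add_neg, ← pnorm_neg q]; exact pnorm_add_le _ _

theorem pnorm_sum_le {ι : Type*} (s : Finset ι) (f : ι → ℂ[X]) :
    pnorm (∑ i ∈ s, f i) ≤ ∑ i ∈ s, pnorm (f i) := by
  classical
  induction s using Finset.induction_on with
  | empty => simp
  | insert a s ha ih =>
    rw [Finset.sum_insert ha, Finset.sum_insert ha]
    exact (pnorm_add_le _ _).trans (by gcongr)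

theorem pnorm_smul (a : ℂ) (p : ℂ[X]) : pnorm (a • p) = ‖a‖ * pnorm p := by
  rw [pnorm_eq_sum (Polynomial.support_smul a p), pnorm, Finset.mul_sum]
  simp

theorem pnorm_C_mul (a : ℂ) (p : ℂ[X]) : pnorm (C a * p) = ‖a‖ * pnorm p := by
  rw [← Polynomial.smul_eq_C_mul, pnorm_smul]

theorem pnorm_C (a : ℂ) : pnorm (C a) = ‖a‖ := by
  rw [pnorm_eq_sum (Polynomial.support_C_subset a)]; simp

theorem pnorm_X_mul (p : ℂ[X]) : pnorm (X * p) = pnorm p := by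
  by_cases hp : p = 0
  · simp [hp]
  have h : (X * p).support ⊆ Finset.range (p.natDegree + 1 + 1) := by
    refine Polynomial.supp_subset_range ?_
    rw [Polynomial.natDegree_X_mul hp]; omega
  rw [pnorm_eq_sum h, Finset.sum_range_succ',
    pnorm_eq_sum (Polynomial.supp_subset_range (Nat.lt_succ_self p.natDegree))]
  simp [Polynomial.coeff_X_mul]

theorem pnorm_X_pow_mul (n : ℕ) (p : ℂ[X]) : pnorm (X ^ n * p) = pnorm p := by
  induction n with
  | zero => simp
  | succ n ih => rw [pow_succ', mul_assoc, pnorm_X_mul, ih]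

theorem pnorm_X_pow (n : ℕ) : pnorm (X ^ n) = 1 := by
  have := pnorm_X_pow_mul n (C 1)
  rw [pnorm_C] at this
  simpa using this

theorem pnorm_eq_range {p : ℂ[X]} {n : ℕ} (hp : p ∈ degreeLT ℂ n) :
    pnorm p = ∑ i ∈ Finset.range n, ‖p.coeff i‖ := by
  refine pnorm_eq_sum fun i hi => ?_
  rw [Finset.mem_range]
  by_contra h
  rw [Polynomial.mem_degreeLT] at hp
  exact Polynomial.mem_support_iff.1 hi
    (Polynomial.coeff_eq_zero_of_degree_lt (hp.trans_le (by exact_mod_cast not_lt.1 h)))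

theorem eq_sum_of_mem_degreeLT {p : ℂ[X]} {n : ℕ} (hp : p ∈ degreeLT ℂ n) :
    p = ∑ i ∈ Finset.range n, p.coeff i • X ^ i := by
  ext m
  simp only [Polynomial.finsetSum_coeff, Polynomial.coeff_smul, Polynomial.coeff_X_pow, smul_eq_mul,
    mul_ite, mul_one, mul_zero, Finset.sum_ite_eq, Finset.mem_range]
  split_ifs with h
  · rfl
  · rw [Polynomial.mem_degreeLT] at hp
    exact Polynomial.coeff_eq_zero_of_degree_lt (hp.trans_le (by exact_mod_cast not_lt.1 h))

theorem exists_mem_degreeLT (p : ℂ[X]) : p ∈ degreeLT ℂ (p.natDegree + 1) :=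
  Polynomial.mem_degreeLT.2 (Polynomial.degree_lt_iff_coeff_zero _ _ |>.2 fun m hm =>
    Polynomial.coeff_eq_zero_of_natDegree_lt (by omega))

/-- Multiplication by `X ^ i` only shifts coefficients and so preserves the norm; expanding `p` in
monomials then gives submultiplicativity, which the quadratic nonlinearity needs. -/
theorem pnorm_mul_le (p q : ℂ[X]) : pnorm (p * q) ≤ pnorm p * pnorm q := by
  have hp := exists_mem_degreeLT p
  calc pnorm (p * q)
      = pnorm (∑ i ∈ Finset.range (p.natDegree + 1), p.coeff i • (X ^ i * q)) := by
        conv_lhs => rw [eq_sum_of_mem_degreeLT hp, Finset.sum_mul]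
        simp only [smul_mul_assoc]
    _ ≤ ∑ i ∈ Finset.range (p.natDegree + 1), pnorm (p.coeff i • (X ^ i * q)) := pnorm_sum_le _ _
    _ = pnorm p * pnorm q := by
        rw [pnorm_eq_range hp, Finset.sum_mul]
        simp only [pnorm_smul, pnorm_X_pow_mul]

theorem pnorm_map_conj (p : ℂ[X]) : pnorm (p.map (starRingEnd ℂ)) = pnorm p := by
  rw [pnorm_eq_sum (Polynomial.support_map_subset (starRingEnd ℂ) p), pnorm]
  simp

theorem norm_coeff_le_pnorm (p : ℂ[X]) (i : ℕ) : ‖p.coeff i‖ ≤ pnorm p := by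
  by_cases h : i ∈ p.support
  · exact Finset.single_le_sum (f := fun i => ‖p.coeff i‖) (fun _ _ => norm_nonneg _) h
  · rw [Polynomial.notMem_support_iff.1 h, norm_zero]; exact pnorm_nonneg p

/-- The unit disc suffices: for `0 ≤ t ≤ 1` and `ε ≤ 1` the slow time `ε^{ν/2} t` stays in it. -/
theorem norm_eval_le_pnorm (p : ℂ[X]) {x : ℂ} (hx : ‖x‖ ≤ 1) : ‖p.eval x‖ ≤ pnorm p := by
  rw [Polynomial.eval_eq_sum, Polynomial.sum, pnorm]
  refine (norm_sum_le _ _).trans (Finset.sum_le_sum fun i _ => ?_)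
  rw [norm_mul, norm_pow]
  exact mul_le_of_le_one_right (norm_nonneg _) (pow_le_one₀ (norm_nonneg _) hx)

theorem norm_eval_sub_coeff_zero_le {p : ℂ[X]} {n : ℕ} (hp : p ∈ degreeLT ℂ n) {x : ℂ} {H : ℝ}
    (hH : 1 ≤ H) (hx : ‖x‖ ≤ H) : ‖p.eval x - p.coeff 0‖ ≤ ‖x‖ * H ^ n * pnorm p := by
  have h1 : p.eval x - p.coeff 0 = ∑ i ∈ Finset.range n, p.coeff i * (x ^ i - 0 ^ i) := by
    rw [Polynomial.coeff_zero_eq_eval_zero]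
    conv_lhs => rw [eq_sum_of_mem_degreeLT hp]
    simp [Polynomial.eval_finsetSum, mul_sub, Finset.sum_sub_distrib]
  rw [h1, pnorm_eq_range hp, Finset.mul_sum]
  refine (norm_sum_le _ _).trans (Finset.sum_le_sum fun i hi => ?_)
  rw [norm_mul, mul_comm]
  refine mul_le_mul_of_nonneg_right ?_ (norm_nonneg _)
  rw [Finset.mem_range] at hi
  cases i with
  | zero => simp; positivity
  | succ i =>
    rw [zero_pow (Nat.succ_ne_zero i), sub_zero, norm_pow, pow_succ']
    refine mul_le_mul_of_nonneg_left ?_ (norm_nonneg _)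
    exact (pow_le_pow_left₀ (norm_nonneg _) hx i).trans (pow_le_pow_right₀ hH (by omega))

theorem degreeLT_mono' {m n : ℕ} (h : m ≤ n) {p : ℂ[X]} (hp : p ∈ degreeLT ℂ m) :
    p ∈ degreeLT ℂ n := Polynomial.degreeLT_mono h hp

theorem mul_mem_degreeLT {m n : ℕ} {p q : ℂ[X]} (hp : p ∈ degreeLT ℂ m) (hq : q ∈ degreeLT ℂ n) :
    p * q ∈ degreeLT ℂ (m + n) := by
  rw [Polynomial.mem_degreeLT] at *
  by_cases h : p = 0
  · subst h; simp
  by_cases h' : q = 0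
  · subst h'; simp
  rw [Polynomial.degree_mul, Polynomial.degree_eq_natDegree h, Polynomial.degree_eq_natDegree h'] at *
  have h1 : p.natDegree < m := by exact_mod_cast hp
  have h2 : q.natDegree < n := by exact_mod_cast hq
  have : p.natDegree + q.natDegree < m + n := by omega
  exact_mod_cast this

theorem C_mem_degreeLT (a : ℂ) {n : ℕ} : C a ∈ degreeLT ℂ (n + 1) := by
  rw [Polynomial.mem_degreeLT]
  exact (Polynomial.degree_C_le).trans_lt (by exact_mod_cast Nat.succ_pos n)

theorem X_pow_mem_degreeLT {i n : ℕ} (h : i < n) : (X ^ i : ℂ[X]) ∈ degreeLT ℂ n := by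
  rw [Polynomial.mem_degreeLT, Polynomial.degree_X_pow]; exact_mod_cast h

theorem map_conj_mem_degreeLT {n : ℕ} {p : ℂ[X]} (hp : p ∈ degreeLT ℂ n) :
    p.map (starRingEnd ℂ) ∈ degreeLT ℂ n := by
  rw [Polynomial.mem_degreeLT] at *
  exact Polynomial.degree_map_le.trans_lt hp

/-- For an `ℓ¹` norm, the operator norm is the largest norm of the image of a basis vector, so
monomials suffice. -/
theorem pnorm_linearMap_le {T : ℂ[X] →ₗ[ℂ] ℂ[X]} {n : ℕ} {c : ℝ}
    (hT : ∀ i < n, pnorm (T (X ^ i)) ≤ c) {p : ℂ[X]} (hp : p ∈ degreeLT ℂ n) :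
    pnorm (T p) ≤ c * pnorm p := by
  conv_lhs => rw [eq_sum_of_mem_degreeLT hp]
  rw [map_sum, pnorm_eq_range hp, Finset.mul_sum]
  refine (pnorm_sum_le _ _).trans (Finset.sum_le_sum fun i hi => ?_)
  rw [map_smul, pnorm_smul, mul_comm]
  exact mul_le_mul_of_nonneg_right (hT i (Finset.mem_range.1 hi)) (norm_nonneg _)

theorem linearMap_mem_degreeLT {T : ℂ[X] →ₗ[ℂ] ℂ[X]} {n m : ℕ}
    (hT : ∀ i < n, T (X ^ i) ∈ degreeLT ℂ m) {p : ℂ[X]} (hp : p ∈ degreeLT ℂ n) :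
    T p ∈ degreeLT ℂ m := by
  rw [eq_sum_of_mem_degreeLT hp, map_sum]
  refine Submodule.sum_mem _ fun i hi => ?_
  rw [map_smul]
  exact Submodule.smul_mem _ _ (hT i (Finset.mem_range.1 hi))

/-! ### Taylor remainders -/

/-- The second order Taylor remainder `p(· + h) - p - h p'`. -/
noncomputable def taylorRem (h : ℂ) : ℂ[X] →ₗ[ℂ] ℂ[X] :=
  taylor h - LinearMap.id - h • derivative

theorem taylorRem_apply (h : ℂ) (p : ℂ[X]) :
    taylorRem h p = taylor h p - p - h • derivative p := rfl

/-- Constants for `pnorm_taylorRem_X_pow_le`. -/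
noncomputable def remConst (H : ℝ) : ℕ → ℝ
  | 0 => 0
  | i + 1 => i + (1 + H) * remConst H i

theorem remConst_nonneg {H : ℝ} (hH : 0 ≤ H) (i : ℕ) : 0 ≤ remConst H i := by
  induction i with
  | zero => simp [remConst]
  | succ i ih => rw [remConst]; positivity

theorem remConst_mono {H : ℝ} (hH : 0 ≤ H) : Monotone (remConst H) := by
  refine monotone_nat_of_le_succ fun i => ?_
  rw [remConst]
  have := mul_nonneg hH (remConst_nonneg hH i)
  have : (0 : ℝ) ≤ i := by positivity
  linarith

/-- This recursion drives both inductions below: it exhibits the factor `h ^ 2` in the size and the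
loss of two degrees. -/
theorem taylorRem_X_pow_succ (h : ℂ) (i : ℕ) :
    taylorRem h (X ^ (i + 1)) =
      (X + C h) * taylorRem h (X ^ i) + ((i : ℂ) * h ^ 2) • X ^ (i - 1) := by
  simp only [taylorRem_apply, Polynomial.taylor_X_pow, Polynomial.derivative_X_pow,
    Polynomial.smul_eq_C_mul]
  cases i with
  | zero => simp
  | succ i =>
    simp only [Nat.add_sub_cancel, map_mul, map_pow, Nat.cast_add, Nat.cast_one, map_add, map_one]
    ring

theorem pnorm_taylorRem_X_pow_le {H : ℝ} (hH : 0 ≤ H) {h : ℂ} (hh : ‖h‖ ≤ H) (i : ℕ) :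
    pnorm (taylorRem h (X ^ i)) ≤ ‖h‖ ^ 2 * remConst H i := by
  induction i with
  | zero => simp [taylorRem_apply, remConst]
  | succ i ih =>
    rw [taylorRem_X_pow_succ, remConst]
    refine (pnorm_add_le _ _).trans ?_
    rw [pnorm_smul, pnorm_X_pow, add_mul]
    have h1 : pnorm (X * taylorRem h (X ^ i) + C h * taylorRem h (X ^ i)) ≤
        (1 + H) * (‖h‖ ^ 2 * remConst H i) := by
      refine (pnorm_add_le _ _).trans ?_
      rw [pnorm_X_mul, pnorm_C_mul, add_mul, one_mul]
      have := pnorm_nonneg (taylorRem h (X ^ i))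
      gcongr
    simp only [norm_mul, norm_pow, Complex.norm_natCast]
    linarith

theorem taylorRem_X_pow_mem (h : ℂ) (i : ℕ) : taylorRem h (X ^ (i + 1)) ∈ degreeLT ℂ i := by
  induction i with
  | zero => simp [taylorRem_apply, Polynomial.smul_eq_C_mul]
  | succ i ih =>
    rw [taylorRem_X_pow_succ]
    refine Submodule.add_mem _ ?_ (Submodule.smul_mem _ _ (X_pow_mem_degreeLT (by omega)))
    have h2 : (X + C h : ℂ[X]) ∈ degreeLT ℂ 2 := by
      rw [Polynomial.mem_degreeLT, Polynomial.degree_X_add_C]; norm_num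
    by_cases h0 : taylorRem h (X ^ (i + 1)) = 0
    · rw [h0, mul_zero]; exact Submodule.zero_mem _
    rw [Polynomial.mem_degreeLT] at ih ⊢
    rw [Polynomial.degree_mul, Polynomial.degree_X_add_C]
    rw [Polynomial.degree_eq_natDegree h0] at ih ⊢
    have h1 : (taylorRem h (X ^ (i + 1))).natDegree < i := by exact_mod_cast ih
    have : 1 + (taylorRem h (X ^ (i + 1))).natDegree < i + 1 := by omega
    exact_mod_cast this

theorem taylorRem_mem {h : ℂ} {n : ℕ} {p : ℂ[X]} (hp : p ∈ degreeLT ℂ (n + 2)) :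
    taylorRem h p ∈ degreeLT ℂ n := by
  refine linearMap_mem_degreeLT (fun i hi => ?_) hp
  cases i with
  | zero => simp [taylorRem_apply]
  | succ i => exact degreeLT_mono' (by omega) (taylorRem_X_pow_mem h i)

theorem pnorm_taylorRem_le {H : ℝ} (hH : 0 ≤ H) {h : ℂ} (hh : ‖h‖ ≤ H) {n : ℕ} {p : ℂ[X]}
    (hp : p ∈ degreeLT ℂ n) : pnorm (taylorRem h p) ≤ ‖h‖ ^ 2 * remConst H n * pnorm p := by
  refine pnorm_linearMap_le (fun i hi => (pnorm_taylorRem_X_pow_le hH hh i).trans ?_) hp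
  exact mul_le_mul_of_nonneg_left (remConst_mono hH hi.le) (by positivity)

theorem pnorm_derivative_le {n : ℕ} {p : ℂ[X]} (hp : p ∈ degreeLT ℂ n) :
    pnorm (derivative p) ≤ n * pnorm p := by
  refine pnorm_linearMap_le (T := derivative) (fun i hi => ?_) hp
  rw [Polynomial.derivative_X_pow, pnorm_C_mul, pnorm_X_pow]
  simp; exact_mod_cast hi.le

theorem derivative_mem_degreeLT {n : ℕ} {p : ℂ[X]} (hp : p ∈ degreeLT ℂ (n + 1)) :
    derivative p ∈ degreeLT ℂ n := by
  refine linearMap_mem_degreeLT (T := derivative) (fun i hi => ?_) hp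
  rw [Polynomial.derivative_X_pow]
  cases i with
  | zero => simp
  | succ i =>
    rw [← Polynomial.smul_eq_C_mul]
    exact Submodule.smul_mem _ _ (X_pow_mem_degreeLT (by omega))

/-! ### Inverting the modulation operator on polynomials -/

/-- A terminating Neumann series: an approximate inverse whose residual has lower degree is applied
again to the residual, and after at most `n` rounds nothing remains. No smallness of `c` is needed.
`κ` is the number of degrees gained by the inverse (0 off the diagonal, 1 for integration), and `P`
carries a linear side condition on the solution. -/
theorem exists_solution_of_approx {L : ℂ[X] →ₗ[ℂ] ℂ[X]} {b c : ℝ} (hb : 0 ≤ b) (hc : 0 ≤ c)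
    {κ N : ℕ} (P : Submodule ℂ ℂ[X])
    (H : ∀ n < N, ∀ g ∈ degreeLT ℂ (n + 1), ∃ p ∈ degreeLT ℂ (n + 1 + κ), p ∈ P ∧
      L p - g ∈ degreeLT ℂ n ∧ pnorm (L p - g) ≤ c * pnorm g ∧ pnorm p ≤ b * pnorm g) :
    ∀ n ≤ N, ∀ g ∈ degreeLT ℂ n, ∃ p ∈ degreeLT ℂ (n + κ), p ∈ P ∧ L p = g ∧
      pnorm p ≤ b * (1 + c) ^ n * pnorm g := by
  intro n
  induction n with
  | zero =>
    intro _ g hg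
    have : g = 0 := by simpa using eq_sum_of_mem_degreeLT hg
    subst this
    exact ⟨0, Submodule.zero_mem _, P.zero_mem, by simp, by simp⟩
  | succ n ih =>
    intro hn g hg
    obtain ⟨p₀, hp₀, hP, hL, h1, h2⟩ := H n (by omega) g hg
    obtain ⟨p₁, hp₁, hP₁, hL₁, h3⟩ := ih (by omega) _ hL
    refine ⟨p₀ - p₁, Submodule.sub_mem _ hp₀ (degreeLT_mono' (by omega) hp₁), P.sub_mem hP hP₁,
      by rw [map_sub, hL₁]; abel, (pnorm_sub_le _ _).trans ?_⟩
    have h4 : 1 ≤ (1 + c) ^ n := one_le_pow₀ (by linarith)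
    have h5 := pnorm_nonneg g
    calc pnorm p₀ + pnorm p₁ ≤ b * pnorm g + b * (1 + c) ^ n * (c * pnorm g) := by
          refine add_le_add h2 (h3.trans ?_)
          gcongr
      _ ≤ b * (1 + c) ^ n * pnorm g + b * (1 + c) ^ n * (c * pnorm g) := by
          gcongr; nlinarith
      _ = _ := by rw [pow_succ]; ring

/-- The operator `p ↦ e^{iθ} p(· + h) - 2 cos α p + e^{-iθ} p(· - h)`. -/
noncomputable def modOp (θ α h : ℝ) : ℂ[X] →ₗ[ℂ] ℂ[X] :=
  Complex.exp (θ * Complex.I) • taylor (h : ℂ) - (2 * (Real.cos α : ℂ)) • LinearMap.id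
    + Complex.exp (-θ * Complex.I) • taylor (-h : ℂ)

theorem modOp_apply (θ α h : ℝ) (p : ℂ[X]) :
    modOp θ α h p = Complex.exp (θ * Complex.I) • taylor (h : ℂ) p - (2 * (Real.cos α : ℂ)) • p
      + Complex.exp (-θ * Complex.I) • taylor (-h : ℂ) p := rfl

/-- Separates the multiplier `2cos θ - 2cos α` from the first-order term; either one is the dominant
part, depending on whether `k = ±⟨j⟩`. -/
theorem modOp_eq (θ α h : ℝ) (p : ℂ[X]) :
    modOp θ α h p = ((2 * Real.cos θ - 2 * Real.cos α : ℝ) : ℂ) • p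
      + (2 * Real.sin θ * h * Complex.I) • derivative p
      + (Complex.exp (θ * Complex.I) • taylorRem h p
        + Complex.exp (-θ * Complex.I) • taylorRem (-h) p) := by
  have h1 : Complex.exp (θ * Complex.I) = Real.cos θ + Real.sin θ * Complex.I := by
    rw [Complex.exp_mul_I]; simp
  have h2 : Complex.exp (-θ * Complex.I) = Real.cos θ - Real.sin θ * Complex.I := by
    rw [Complex.exp_mul_I]; simp [sub_eq_add_neg]
  rw [modOp_apply, taylorRem_apply, taylorRem_apply, h1, h2]
  push_cast
  module

theorem norm_exp_ofReal_mul_I' (θ : ℝ) : ‖Complex.exp (-θ * Complex.I)‖ = 1 := by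
  rw [← Complex.ofReal_neg, Complex.norm_exp_ofReal_mul_I]

theorem pnorm_taylorRem_pair_le {H h θ : ℝ} (hH : 0 ≤ H) (hh : |h| ≤ H) {n : ℕ} {p : ℂ[X]}
    (hp : p ∈ degreeLT ℂ n) :
    pnorm (Complex.exp (θ * Complex.I) • taylorRem h p
        + Complex.exp (-θ * Complex.I) • taylorRem (-h) p)
      ≤ 2 * h ^ 2 * remConst H n * pnorm p := by
  refine (pnorm_add_le _ _).trans ?_
  rw [pnorm_smul, pnorm_smul, Complex.norm_exp_ofReal_mul_I, norm_exp_ofReal_mul_I']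
  have h1 := pnorm_taylorRem_le hH (h := (h : ℂ)) (by simpa using hh) hp
  have h2 := pnorm_taylorRem_le hH (h := (-h : ℂ)) (by simpa using hh) hp
  rw [norm_neg] at h2
  rw [Complex.norm_real, Real.norm_eq_abs, sq_abs] at h1 h2
  linarith

/-- Off-diagonal case: the leading coefficient `2 cos θ - 2 cos α` does not vanish. -/
theorem exists_modOp_eq (H c : ℝ) (hH : 0 ≤ H) (hc : 0 ≤ c) (N : ℕ) :
    ∃ C : ℝ, 0 ≤ C ∧ ∀ θ α h : ℝ, |h| ≤ H → 2 * Real.cos θ - 2 * Real.cos α ≠ 0 →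
      |Real.sin θ * h| ≤ c * |2 * Real.cos θ - 2 * Real.cos α| →
      h ^ 2 ≤ c * |2 * Real.cos θ - 2 * Real.cos α| →
      ∀ g ∈ degreeLT ℂ N, ∃ p ∈ degreeLT ℂ N, modOp θ α h p = g ∧
        pnorm p ≤ C * |2 * Real.cos θ - 2 * Real.cos α|⁻¹ * pnorm g := by
  have hR := remConst_nonneg hH N
  -- Residual relative to the leading coefficient: the first summand comes from the derivative term,
  -- the second from the two Taylor remainders.
  set c' : ℝ := 2 * c * N + 2 * c * remConst H N
  have hc' : 0 ≤ c' := by positivity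
  refine ⟨(1 + c') ^ N, by positivity, ?_⟩
  intro θ α h hh hne h1 h2 g hg
  set l : ℝ := 2 * Real.cos θ - 2 * Real.cos α with hl
  have hl0 : 0 < |l| := abs_pos.2 hne
  obtain ⟨p, hp, -, hLp, hpn⟩ := exists_solution_of_approx (L := modOp θ α h) (b := |l|⁻¹) (c := c')
    (by positivity) hc' (κ := 0) (N := N) ⊤ (by
      intro n hn g hg
      have hlC : (l : ℂ) ≠ 0 := by exact_mod_cast hne
      have hnorm : pnorm ((l : ℂ)⁻¹ • g) = |l|⁻¹ * pnorm g := by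
        rw [pnorm_smul, norm_inv, Complex.norm_real, Real.norm_eq_abs]
      have hpg : (l : ℂ)⁻¹ • g ∈ degreeLT ℂ (n + 1) := Submodule.smul_mem _ _ hg
      set p := (l : ℂ)⁻¹ • g with hpdef
      have hdiff : modOp θ α h p - g = (2 * Real.sin θ * h * Complex.I) • derivative p
          + (Complex.exp (θ * Complex.I) • taylorRem h p
            + Complex.exp (-θ * Complex.I) • taylorRem (-h) p) := by
        have : g = (l : ℂ) • p := by rw [hpdef, smul_smul, mul_inv_cancel₀ hlC, one_smul]
        rw [modOp_eq, ← hl]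
        conv_lhs => rw [this]
        abel
      refine ⟨p, hpg, trivial, ?_, ?_, hnorm.le⟩
      · rw [hdiff]
        refine Submodule.add_mem _ (Submodule.smul_mem _ _ (derivative_mem_degreeLT hpg))
          (Submodule.add_mem _ (Submodule.smul_mem _ _ ?_) (Submodule.smul_mem _ _ ?_)) <;>
        exact taylorRem_mem (degreeLT_mono' (by omega) hpg)
      · rw [hdiff]
        have hpN : p ∈ degreeLT ℂ N := degreeLT_mono' (by omega) hpg
        refine (pnorm_add_le _ _).trans ?_
        have e1 := pnorm_taylorRem_pair_le (θ := θ) hH hh hpN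
        have e2 : pnorm ((2 * Real.sin θ * h * Complex.I) • derivative p)
            ≤ 2 * |Real.sin θ * h| * (N * pnorm p) := by
          rw [pnorm_smul]
          have : ‖(2 * Real.sin θ * h * Complex.I : ℂ)‖ = 2 * |Real.sin θ * h| := by
            rw [abs_mul]; simp [-Complex.ofReal_sin]; ring
          rw [this]
          exact mul_le_mul_of_nonneg_left (pnorm_derivative_le hpN) (by positivity)
        have hp0 := pnorm_nonneg p
        calc _ ≤ 2 * (c * |l|) * (N * pnorm p) + 2 * (c * |l|) * remConst H N * pnorm p := by
              refine add_le_add (e2.trans ?_) (e1.trans ?_) <;> gcongr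
          _ = c' * (|l| * pnorm p) := by ring
          _ = c' * pnorm g := by rw [hnorm, mul_inv_cancel_left₀ hl0.ne']) N le_rfl g hg
  exact ⟨p, hp, hLp, by rw [mul_comm ((1 + c') ^ N)]; exact hpn⟩

theorem exists_antiderivative {n : ℕ} {g : ℂ[X]} (hg : g ∈ degreeLT ℂ n) :
    ∃ p ∈ degreeLT ℂ (n + 1), p.coeff 0 = 0 ∧ derivative p = g ∧ pnorm p ≤ pnorm g := by
  refine ⟨∑ i ∈ Finset.range n, (g.coeff i / (i + 1)) • X ^ (i + 1), ?_, ?_, ?_, ?_⟩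
  · exact Submodule.sum_mem _ fun i hi => Submodule.smul_mem _ _
      (X_pow_mem_degreeLT (by have := Finset.mem_range.1 hi; omega))
  · rw [Polynomial.finsetSum_coeff]
    exact Finset.sum_eq_zero fun i _ => by simp [Polynomial.coeff_X_pow]
  · conv_rhs => rw [eq_sum_of_mem_degreeLT hg]
    rw [map_sum]
    refine Finset.sum_congr rfl fun i _ => ?_
    have : (i + 1 : ℂ) ≠ 0 := by exact_mod_cast Nat.succ_ne_zero i
    rw [map_smul, Polynomial.derivative_X_pow, Nat.add_sub_cancel, ← Polynomial.smul_eq_C_mul,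
      smul_smul]
    congr 1
    push_cast
    field_simp
  · refine (pnorm_sum_le _ _).trans ?_
    rw [pnorm_eq_range hg]
    refine Finset.sum_le_sum fun i _ => ?_
    rw [pnorm_smul, pnorm_X_pow, mul_one, norm_div]
    refine div_le_self (norm_nonneg _) ?_
    have : ‖(i + 1 : ℂ)‖ = i + 1 := by
      have := Complex.norm_natCast (i + 1)
      push_cast at this
      exact this
    rw [this]
    have : (0 : ℝ) ≤ i := by positivity
    linarith

/-- Diagonal case: the operator is inverted up to constants. -/
theorem exists_modOp_diag_eq (H c : ℝ) (hH : 0 ≤ H) (hc : 0 ≤ c) (N : ℕ) :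
    ∃ C : ℝ, 0 ≤ C ∧ ∀ θ α h : ℝ, |h| ≤ H → h ≠ 0 → Real.sin θ ≠ 0 →
      Real.cos θ = Real.cos α → |h| ≤ c * |Real.sin θ| →
      ∀ g ∈ degreeLT ℂ N, ∃ p ∈ degreeLT ℂ (N + 1), p.coeff 0 = 0 ∧ modOp θ α h p = g ∧
        pnorm p ≤ C * |Real.sin θ * h|⁻¹ * pnorm g := by
  have hR := remConst_nonneg hH (N + 1)
  set c' : ℝ := c * remConst H (N + 1)
  have hc' : 0 ≤ c' := by positivity
  refine ⟨(1 + c') ^ N, by positivity, ?_⟩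
  intro θ α h hh hh0 hs hcos h1 g hg
  have hl0 : 0 < |Real.sin θ * h| := abs_pos.2 (mul_ne_zero hs hh0)
  set l : ℝ := |Real.sin θ * h| with hl
  -- Polynomials without constant term. The constants are in the kernel of the operator here and are
  -- reserved for the initial conditions.
  let P : Submodule ℂ ℂ[X] := LinearMap.ker (Polynomial.lcoeff ℂ 0)
  obtain ⟨p, hp, hpP, hLp, hpn⟩ := exists_solution_of_approx (L := modOp θ α h) (b := l⁻¹)
    (c := c') (by positivity) hc' (κ := 1) (N := N) P (by
      intro n hn g hg
      set m : ℂ := 2 * Real.sin θ * h * Complex.I with hm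
      have hmn : ‖m‖ = 2 * l := by
        rw [hl, abs_mul]; simp [hm, -Complex.ofReal_sin]; ring
      have hm0 : m ≠ 0 := by rw [← norm_pos_iff, hmn]; positivity
      obtain ⟨p, hp, hp0, hpd, hpn⟩ := exists_antiderivative
        (Submodule.smul_mem (degreeLT ℂ (n + 1)) m⁻¹ hg)
      rw [pnorm_smul, norm_inv, hmn] at hpn
      have hdiff : modOp θ α h p - g = (Complex.exp (θ * Complex.I) • taylorRem h p
            + Complex.exp (-θ * Complex.I) • taylorRem (-h) p) := by
        rw [modOp_eq, hcos, sub_self, Complex.ofReal_zero, zero_smul, hpd, smul_smul, ← hm,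
          mul_inv_cancel₀ hm0, one_smul]
        abel
      have hg0 := pnorm_nonneg g
      have hp0' := pnorm_nonneg p
      have hpb : pnorm p ≤ (2 * l)⁻¹ * pnorm g := hpn
      refine ⟨p, hp, hp0, ?_, ?_, hpb.trans ?_⟩
      · rw [hdiff]
        refine (Submodule.add_mem _ (Submodule.smul_mem _ _ ?_) (Submodule.smul_mem _ _ ?_)) <;>
        exact taylorRem_mem hp
      · rw [hdiff]
        refine (pnorm_taylorRem_pair_le (θ := θ) hH hh
          (degreeLT_mono' (show _ ≤ N + 1 by omega) hp)).trans ?_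
        have h2 : h ^ 2 ≤ c * l := by
          rw [hl, abs_mul, ← sq_abs, pow_two, ← mul_assoc]
          exact mul_le_mul_of_nonneg_right h1 (abs_nonneg _)
        calc 2 * h ^ 2 * remConst H (N + 1) * pnorm p
            ≤ 2 * (c * l) * remConst H (N + 1) * ((2 * l)⁻¹ * pnorm g) := by gcongr
          _ = c' * pnorm g := by
            show _ = c * remConst H (N + 1) * _
            field_simp
      · gcongr; linarith) N le_rfl g hg
  exact ⟨p, hp, hpP, hLp, by rw [mul_comm ((1 + c') ^ N)]; exact hpn⟩

/-! ### Sizes of the modulation indices -/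

section Indices
variable {K M : ℕ}

theorem absIdx_add_le (i j : ZMod (2 * M)) : absIdx (i + j) ≤ absIdx i + absIdx j :=
  (ZMod.natAbs_valMinAbs_add_le i j).trans (Int.natAbs_add_le _ _)

theorem absIdx_neg (j : ZMod (2 * M)) : absIdx (-j) = absIdx j := ZMod.natAbs_valMinAbs_neg j

theorem absIdx_le [NeZero M] (j : ZMod (2 * M)) : absIdx j ≤ M := by
  have := ZMod.natAbs_valMinAbs_le j
  unfold absIdx; omega

theorem absIdx_eq_zero {j : ZMod (2 * M)} : absIdx j = 0 ↔ j = 0 := by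
  simp [absIdx]

theorem one_le_profile (hK : 3 ≤ K) (l : ℕ) : 1 ≤ profile K l := by
  unfold profile; split_ifs <;> omega

theorem profile_le (hK : 3 ≤ K) (l : ℕ) : profile K l ≤ K := by
  unfold profile; split_ifs <;> omega

theorem mu_add_le (k k' : Fin (M + 1) → ℤ) : mu K (k + k') ≤ mu K k + mu K k' := by
  unfold mu
  rw [← Finset.sum_add_distrib]
  refine Finset.sum_le_sum fun l _ => ?_
  rw [← add_mul]
  exact Nat.mul_le_mul_right _ (Int.natAbs_add_le _ _)

theorem mu_neg (k : Fin (M + 1) → ℤ) : mu K (-k) = mu K k := by simp [mu]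

theorem mu_unitVec [NeZero M] (j : ZMod (2 * M)) : mu K (unitVec j) = profile K (absIdx j) := by
  unfold mu unitVec
  rw [Finset.sum_eq_single (⟨absIdx j, Nat.lt_succ_of_le (absIdx_le j)⟩ : Fin (M + 1))]
  · simp
  · intro b _ hb
    have : (b : ℕ) ≠ absIdx j := fun h => hb (Fin.ext h)
    simp [this]
  · simp

theorem unitVec_ne_zero [NeZero M] (j : ZMod (2 * M)) : unitVec j ≠ 0 := by
  intro h
  have := congrFun h (⟨absIdx j, Nat.lt_succ_of_le (absIdx_le j)⟩ : Fin (M + 1))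
  simp [unitVec] at this

theorem unitVec_ne_neg [NeZero M] (j : ZMod (2 * M)) : unitVec j ≠ -unitVec j := by
  intro h
  have := congrFun h (⟨absIdx j, Nat.lt_succ_of_le (absIdx_le j)⟩ : Fin (M + 1))
  simp [unitVec] at this

theorem unitVec_neg (j : ZMod (2 * M)) : unitVec (-j) = unitVec j := by
  unfold unitVec; rw [absIdx_neg]

/-- A single nonzero component with `l ≥ K` already contributes `e(l) = K` to `μ`. -/
theorem low_of_mu_lt {k : Fin (M + 1) → ℤ} (h : mu K k < K) (l : Fin (M + 1)) (hl : K ≤ (l : ℕ)) :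
    k l = 0 := by
  by_contra hne
  have h1 : 1 ≤ (k l).natAbs := Int.natAbs_pos.2 hne
  have h2 : (k l).natAbs * profile K l ≤ mu K k :=
    Finset.single_le_sum (f := fun l : Fin (M + 1) => (k l).natAbs * profile K l)
      (fun _ _ => Nat.zero_le _) (Finset.mem_univ l)
  have h3 : profile K l = K := by
    unfold profile; split_ifs <;> omega
  rw [h3] at h2
  have := Nat.mul_le_mul_right K h1
  omega

/-- `|j|` with the value `2` in place of `0`. -/
def modeSize (j : ZMod (2 * M)) : ℕ := if absIdx j = 0 then 2 else absIdx j

/-- The index `(j, k)` can be reached from the initial modes with total energy exponent at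
most `n`. Every index satisfies this for `n ≥ 2K`. -/
def SizeLE (K : ℕ) (j : ZMod (2 * M)) (k : Fin (M + 1) → ℤ) (n : ℕ) : Prop :=
  ((∀ l : Fin (M + 1), K ≤ (l : ℕ) → k l = 0) ∧ modeSize j ≤ n ∧ mu K k ≤ n) ∨
  (∃ (r : ℤ) (k' : Fin (M + 1) → ℤ), K ≤ absIdx (j - (r : ZMod (2 * M))) ∧ r.natAbs + K ≤ n ∧
    mu K k' + K ≤ n ∧ (∀ l : Fin (M + 1), K ≤ (l : ℕ) → k' l = 0) ∧
    (k = unitVec (j - (r : ZMod (2 * M))) + k' ∨ k = -unitVec (j - (r : ZMod (2 * M))) + k')) ∨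
  2 * K ≤ n

/-- The smallest admissible exponent in `SizeLE`. -/
noncomputable def idxSize (K : ℕ) (j : ZMod (2 * M)) (k : Fin (M + 1) → ℤ) : ℕ :=
  sInf {n | SizeLE K j k n}

theorem sizeLE_idxSize (j : ZMod (2 * M)) (k : Fin (M + 1) → ℤ) : SizeLE K j k (idxSize K j k) :=
  Nat.sInf_mem (s := {n | SizeLE K j k n}) ⟨2 * K, Or.inr (Or.inr le_rfl)⟩

theorem idxSize_le {j : ZMod (2 * M)} {k : Fin (M + 1) → ℤ} {n : ℕ} (h : SizeLE K j k n) :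
    idxSize K j k ≤ n := Nat.sInf_le h

theorem absIdx_le_modeSize (j : ZMod (2 * M)) : absIdx j ≤ modeSize j := by
  unfold modeSize; split_ifs <;> omega

theorem one_le_modeSize (j : ZMod (2 * M)) : 1 ≤ modeSize j := by
  unfold modeSize; split_ifs <;> omega

theorem profile_le_modeSize (j : ZMod (2 * M)) : profile K (absIdx j) ≤ modeSize j := by
  unfold modeSize profile; split_ifs <;> omega

/-- A low index multiplied onto a high one keeps the high frequency and is absorbed into the shifts
`r` and `k'`. -/
theorem SizeLE.low_add_high {j₁ j₂ : ZMod (2 * M)} {k₁ k₂ : Fin (M + 1) → ℤ} {n₁ n₂ : ℕ}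
    (h0 : ∀ l : Fin (M + 1), K ≤ (l : ℕ) → k₁ l = 0) (hj : modeSize j₁ ≤ n₁) (hk : mu K k₁ ≤ n₁)
    (h : ∃ (r : ℤ) (k' : Fin (M + 1) → ℤ), K ≤ absIdx (j₂ - (r : ZMod (2 * M))) ∧
      r.natAbs + K ≤ n₂ ∧ mu K k' + K ≤ n₂ ∧ (∀ l : Fin (M + 1), K ≤ (l : ℕ) → k' l = 0) ∧
      (k₂ = unitVec (j₂ - (r : ZMod (2 * M))) + k' ∨
        k₂ = -unitVec (j₂ - (r : ZMod (2 * M))) + k')) :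
    SizeLE K (j₁ + j₂) (k₁ + k₂) (n₁ + n₂) := by
  obtain ⟨r, k', hr, hrn, hkn, hl, hu⟩ := h
  -- Shifting `r` by the representative of `j₁` leaves the high wave number unchanged.
  have e : j₁ + j₂ - ((r + j₁.valMinAbs : ℤ) : ZMod (2 * M)) = j₂ - (r : ZMod (2 * M)) := by
    push_cast [ZMod.coe_valMinAbs]; ring
  have := absIdx_le_modeSize j₁
  have h1 : (r + j₁.valMinAbs).natAbs ≤ r.natAbs + absIdx j₁ := Int.natAbs_add_le _ _
  have h2 := mu_add_le (K := K) k₁ k'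
  refine Or.inr (Or.inl ⟨r + j₁.valMinAbs, k₁ + k', by rwa [e], by omega, by omega,
    fun l hl' => by simp [h0 l hl', hl l hl'], ?_⟩)
  rw [e]
  rcases hu with rfl | rfl
  · left; abel
  · right; abel

/-- Sizes add under products, the property that makes `ε ^ size` compatible with convolution. Two
high indices have sizes at least `K` each, so they fall into the default clause `2 * K ≤ n`. The
value `2` for the zero mode is harmless, since two sizes of at least `1` sum to at least `2`. -/
theorem SizeLE.add {j₁ j₂ : ZMod (2 * M)} {k₁ k₂ : Fin (M + 1) → ℤ} {n₁ n₂ : ℕ}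
    (h₁ : SizeLE K j₁ k₁ n₁) (h₂ : SizeLE K j₂ k₂ n₂) :
    SizeLE K (j₁ + j₂) (k₁ + k₂) (n₁ + n₂) := by
  rcases h₁ with ⟨a1, a2, a3⟩ | h₁ | h₁
  · rcases h₂ with ⟨b1, b2, b3⟩ | h₂ | h₂
    · refine Or.inl ⟨fun l hl => by simp [a1 l hl, b1 l hl], ?_, ?_⟩
      · have := absIdx_add_le j₁ j₂
        have := absIdx_le_modeSize j₁
        have := absIdx_le_modeSize j₂
        have := one_le_modeSize j₁
        have := one_le_modeSize j₂
        unfold modeSize at *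
        split_ifs at * <;> omega
      · exact (mu_add_le _ _).trans (by omega)
    · exact SizeLE.low_add_high a1 a2 a3 h₂
    · exact Or.inr (Or.inr (by omega))
  · rcases h₂ with ⟨b1, b2, b3⟩ | h₂ | h₂
    · rw [add_comm j₁, add_comm k₁, add_comm n₁]
      exact SizeLE.low_add_high b1 b2 b3 h₁
    · obtain ⟨r, k', -, hr, -⟩ := h₁
      obtain ⟨r', k'', -, hr', -⟩ := h₂
      exact Or.inr (Or.inr (by omega))
    · exact Or.inr (Or.inr (by omega))
  · exact Or.inr (Or.inr (by omega))

theorem idxSize_add_le (j₁ j₂ : ZMod (2 * M)) (k₁ k₂ : Fin (M + 1) → ℤ) :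
    idxSize K (j₁ + j₂) (k₁ + k₂) ≤ idxSize K j₁ k₁ + idxSize K j₂ k₂ :=
  idxSize_le ((sizeLE_idxSize j₁ k₁).add (sizeLE_idxSize j₂ k₂))

/-- Turns the two-clause definition of `𝒦` into a sublevel set, so that leaving `𝒦` means having
order at least `2K`. Counting the zero mode as `2` does not matter because `2 < 2K`. -/
theorem mem_modSet_iff (hK : 3 ≤ K) {j : ZMod (2 * M)} {k : Fin (M + 1) → ℤ} :
    k ∈ modSet K j ↔ idxSize K j k < 2 * K := by
  constructor
  · rintro (⟨h, h0⟩ | ⟨r, k', h1, h2, h3, h4⟩)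
    · refine (idxSize_le (n := max (modeSize j) (mu K k)) (Or.inl ⟨h0, le_max_left _ _,
        le_max_right _ _⟩)).trans_lt ?_
      rw [max_lt_iff] at h ⊢
      refine ⟨?_, h.2⟩
      unfold modeSize; split_ifs <;> omega
    · refine (idxSize_le (n := K + max r.natAbs (mu K k')) (Or.inr (Or.inl ⟨r, k', h1, ?_, ?_,
        low_of_mu_lt h3, h4⟩))).trans_lt ?_
      · have := le_max_left r.natAbs (mu K k'); omega
      · have := le_max_right r.natAbs (mu K k'); omega
      · have : max r.natAbs (mu K k') < K :=
          max_lt_iff.2 ⟨by rw [Int.abs_eq_natAbs] at h2; omega, h3⟩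
        omega
  · intro h
    rcases sizeLE_idxSize (K := K) j k with ⟨h0, h1, h2⟩ | ⟨r, k', h1, h2, h3, -, h4⟩ | h'
    · have := absIdx_le_modeSize j
      exact Or.inl ⟨max_lt_iff.2 ⟨by omega, by omega⟩, h0⟩
    · exact Or.inr ⟨r, k', h1, by rw [Int.abs_eq_natAbs]; omega, by omega, h4⟩
    · omega

theorem profile_le_idxSize (hK : 3 ≤ K) (j : ZMod (2 * M)) (k : Fin (M + 1) → ℤ) :
    profile K (absIdx j) ≤ idxSize K j k := by
  have h1 := profile_le_modeSize (K := K) j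
  have h2 := profile_le hK (absIdx j)
  rcases sizeLE_idxSize (K := K) j k with ⟨-, h, -⟩ | ⟨r, k', -, h, -⟩ | h <;> omega

theorem one_le_idxSize (hK : 3 ≤ K) (j : ZMod (2 * M)) (k : Fin (M + 1) → ℤ) :
    1 ≤ idxSize K j k :=
  (one_le_profile hK _).trans (profile_le_idxSize hK j k)

theorem mu_le_idxSize [NeZero M] (hK : 3 ≤ K) {j : ZMod (2 * M)} {k : Fin (M + 1) → ℤ}
    (hk : k ∈ modSet K j) : mu K k ≤ idxSize K j k := by
  rw [mem_modSet_iff hK] at hk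
  rcases sizeLE_idxSize (K := K) j k with ⟨-, -, h⟩ | ⟨r, k', -, -, h, -, h'⟩ | h
  · exact h
  · have h1 := profile_le hK (absIdx (j - (r : ZMod (2 * M))))
    rcases h' with h' | h'
    · have := mu_add_le (K := K) (unitVec (j - (r : ZMod (2 * M)))) k'
      rw [← h', mu_unitVec] at this
      omega
    · have := mu_add_le (K := K) (-unitVec (j - (r : ZMod (2 * M)))) k'
      rw [← h', mu_neg, mu_unitVec] at this
      omega
  · omega

theorem idxSize_diag_le [NeZero M] (hK : 3 ≤ K) (j : ZMod (2 * M)) {k : Fin (M + 1) → ℤ}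
    (hk : k = unitVec j ∨ k = -unitVec j) : idxSize K j k ≤ profile K (absIdx j) := by
  by_cases h : absIdx j < K
  · have hmu : mu K k = profile K (absIdx j) := by
      rcases hk with rfl | rfl
      · exact mu_unitVec j
      · rw [mu_neg, mu_unitVec]
    refine idxSize_le (Or.inl ⟨fun l hl => ?_, ?_, hmu.le⟩)
    · have : (l : ℕ) ≠ absIdx j := by omega
      rcases hk with rfl | rfl <;> simp [unitVec, this]
    · unfold modeSize profile; split_ifs <;> omega
  · have : profile K (absIdx j) = K := by unfold profile; split_ifs <;> omega
    rw [this]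
    refine idxSize_le (Or.inr (Or.inl ⟨0, 0, by simpa using h, by simp, by simp [mu], by simp, ?_⟩))
    simpa using hk

/-- On the diagonal the size is the energy profile itself, so the weight there matches the
hypothesis on the initial energies. -/
theorem idxSize_diag [NeZero M] (hK : 3 ≤ K) (j : ZMod (2 * M)) {k : Fin (M + 1) → ℤ}
    (hk : k = unitVec j ∨ k = -unitVec j) : idxSize K j k = profile K (absIdx j) :=
  le_antisymm (idxSize_diag_le hK j hk) (profile_le_idxSize hK j k)

theorem unitVec_mem_modSet [NeZero M] (hK : 3 ≤ K) (j : ZMod (2 * M)) : unitVec j ∈ modSet K j := by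
  rw [mem_modSet_iff hK, idxSize_diag hK j (Or.inl rfl)]
  have := profile_le hK (absIdx j)
  omega

theorem neg_unitVec_mem_modSet [NeZero M] (hK : 3 ≤ K) (j : ZMod (2 * M)) :
    -unitVec j ∈ modSet K j := by
  rw [mem_modSet_iff hK, idxSize_diag hK j (Or.inr rfl)]
  have := profile_le hK (absIdx j)
  omega

theorem SizeLE.neg {j : ZMod (2 * M)} {k : Fin (M + 1) → ℤ} {n : ℕ} (h : SizeLE K j k n) :
    SizeLE K (-j) (-k) n := by
  rcases h with ⟨h0, h1, h2⟩ | ⟨r, k', h1, h2, h3, h4, h5⟩ | h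
  · exact Or.inl ⟨fun l hl => by simp [h0 l hl], by rwa [modeSize, absIdx_neg], by rwa [mu_neg]⟩
  · have e : -j - ((-r : ℤ) : ZMod (2 * M)) = -(j - (r : ZMod (2 * M))) := by push_cast; ring
    refine Or.inr (Or.inl ⟨-r, -k', by rwa [e, absIdx_neg], by simpa using h2, by rwa [mu_neg],
      fun l hl => by simp [h4 l hl], ?_⟩)
    rw [e, unitVec_neg]
    rcases h5 with rfl | rfl
    · right; abel
    · left; abel
  · exact Or.inr (Or.inr h)

theorem neg_mem_modSet (hK : 3 ≤ K) {j : ZMod (2 * M)} {k : Fin (M + 1) → ℤ}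
    (h : k ∈ modSet K j) : -k ∈ modSet K (-j) := by
  rw [mem_modSet_iff hK] at *
  exact (idxSize_le (sizeLE_idxSize j k).neg).trans_lt h

theorem idxSize_neg (j : ZMod (2 * M)) (k : Fin (M + 1) → ℤ) :
    idxSize K (-j) (-k) = idxSize K j k := by
  refine le_antisymm (idxSize_le (sizeLE_idxSize j k).neg) (idxSize_le ?_)
  have := (sizeLE_idxSize (K := K) (-j) (-k)).neg
  rwa [neg_neg, neg_neg] at this

/-- If both factors are low, their sizes dominate `|j₁|` and `|j₂|`, whose sum exceeds `K`. If one
is high, it already has size at least `K` and the other adds at least `1`. -/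
theorem succ_le_idxSize_add_of_lt_absIdx (hK : 3 ≤ K) {j₁ j₂ : ZMod (2 * M)}
    (k₁ k₂ : Fin (M + 1) → ℤ) (h : K < absIdx (j₁ + j₂)) :
    K + 1 ≤ idxSize K j₁ k₁ + idxSize K j₂ k₂ := by
  have h1 := one_le_idxSize hK j₁ k₁
  have h2 := one_le_idxSize hK j₂ k₂
  have h3 := absIdx_add_le j₁ j₂
  have h4 := absIdx_le_modeSize j₁
  have h5 := absIdx_le_modeSize j₂
  rcases sizeLE_idxSize (K := K) j₁ k₁ with ⟨-, a, -⟩ | ⟨r, k', -, a, -⟩ | a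
  · rcases sizeLE_idxSize (K := K) j₂ k₂ with ⟨-, b, -⟩ | ⟨r, k', -, b, -⟩ | b <;> omega
  · omega
  · omega

/-- A diagonal index cannot be generated at exactly its own order. Equality would force `μ(k₁ + k₂)
= μ(k₁) + μ(k₂)`, hence no cancellation between `k₁` and `k₂`; as the sum is a signed unit vector,
one of them is `0`. That factor contributes nothing to `μ` but at least `1` to the sizes. -/
theorem succ_profile_le_idxSize_add [NeZero M] (hK : 3 ≤ K) {j j₁ j₂ : ZMod (2 * M)}
    {k₁ k₂ : Fin (M + 1) → ℤ} (h₁ : k₁ ∈ modSet K j₁) (h₂ : k₂ ∈ modSet K j₂)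
    (h : k₁ + k₂ = unitVec j ∨ k₁ + k₂ = -unitVec j) :
    profile K (absIdx j) + 1 ≤ idxSize K j₁ k₁ + idxSize K j₂ k₂ := by
  by_contra hlt
  have a1 := mu_le_idxSize hK h₁
  have a2 := mu_le_idxSize hK h₂
  have b1 := one_le_idxSize hK j₁ k₁
  have b2 := one_le_idxSize hK j₂ k₂
  have c := mu_add_le (K := K) k₁ k₂
  have hmu : mu K (k₁ + k₂) = profile K (absIdx j) := by
    rcases h with h | h
    · rw [h, mu_unitVec]
    · rw [h, mu_neg, mu_unitVec]
  have heq : mu K (k₁ + k₂) = mu K k₁ + mu K k₂ := by omega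
  -- Equality of the sums of termwise inequalities forces equality in each component, the weights
  -- `e(l)` being positive.
  have hcomp : ∀ l : Fin (M + 1), ((k₁ + k₂) l).natAbs = (k₁ l).natAbs + (k₂ l).natAbs := by
    unfold mu at heq
    rw [← Finset.sum_add_distrib, Finset.sum_eq_sum_iff_of_le] at heq
    · intro l
      have := heq l (Finset.mem_univ l)
      rw [← add_mul] at this
      exact Nat.eq_of_mul_eq_mul_right (one_le_profile hK l) this
    · intro l _
      rw [← add_mul]
      exact Nat.mul_le_mul_right _ (Int.natAbs_add_le _ _)
  have hval : ∀ l : Fin (M + 1), ((k₁ + k₂) l).natAbs = if (l : ℕ) = absIdx j then 1 else 0 := by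
    intro l
    rcases h with h | h <;> rw [h] <;> simp only [unitVec, Pi.neg_apply] <;> split_ifs <;> rfl
  have hz : k₁ = 0 ∨ k₂ = 0 := by
    set l₀ : Fin (M + 1) := ⟨absIdx j, Nat.lt_succ_of_le (absIdx_le j)⟩ with hl₀
    have h0 := hcomp l₀
    rw [hval, if_pos rfl] at h0
    have hoff : ∀ l, l ≠ l₀ → k₁ l = 0 ∧ k₂ l = 0 := by
      intro l hl
      have := hcomp l
      rw [hval, if_neg (fun h => hl (Fin.ext h))] at this
      omega
    rcases Nat.eq_zero_or_pos (k₁ l₀).natAbs with h1 | h1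
    · left
      funext l
      by_cases hl : l = l₀
      · subst hl; simpa using h1
      · exact (hoff l hl).1
    · right
      funext l
      by_cases hl : l = l₀
      · subst hl; show k₂ _ = 0; omega
      · exact (hoff l hl).2
  have hmu0 : mu K (0 : Fin (M + 1) → ℤ) = 0 := by simp [mu]
  rcases hz with rfl | rfl <;> omega

/-! ### Exponents of `ε` for products of modulation functions -/

/-- The exponent `½ n - ν (n - K)₊` of `ε` in the bound for indices of size `n`. -/
noncomputable def sizeExp (K : ℕ) (ν : ℝ) (n : ℕ) : ℝ := (n : ℝ) / 2 - ν * ((n - K : ℕ) : ℝ)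

/-- The slope is `1/2` below `K` and `1/2 - ν > 0` above. -/
theorem sizeExp_mono {ν : ℝ} (_hν0 : 0 ≤ ν) (hν : ν < 1 / 2) : Monotone (sizeExp K ν) := by
  refine monotone_nat_of_le_succ fun n => ?_
  unfold sizeExp
  rcases le_or_gt K n with h | h
  · rw [show n + 1 - K = (n - K) + 1 by omega]; push_cast; linarith
  · rw [show n + 1 - K = 0 by omega, show n - K = 0 by omega]; push_cast; linarith

theorem sizeExp_add_le {ν : ℝ} (hν0 : 0 ≤ ν) (m n : ℕ) :
    sizeExp K ν (m + n) ≤ sizeExp K ν m + sizeExp K ν n := by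
  unfold sizeExp
  have h : (m - K) + (n - K) ≤ m + n - K := by omega
  have h' : ((m - K : ℕ) : ℝ) + ((n - K : ℕ) : ℝ) ≤ ((m + n - K : ℕ) : ℝ) := by exact_mod_cast h
  have := mul_le_mul_of_nonneg_left h' hν0
  push_cast at *
  linarith

/-- Strict superadditivity of `(n - K)₊`: once `m + n` passes the kink at `K`, the positive part of
the sum exceeds the sum of positive parts by at least one, which releases `ν`. -/
theorem sizeExp_add_loss_le {ν : ℝ} (hν0 : 0 ≤ ν) {m n : ℕ} (hm : 1 ≤ m) (hn : 1 ≤ n)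
    (hK0 : 1 ≤ K) (hK : K + 1 ≤ m + n) :
    sizeExp K ν (m + n) + ν ≤ sizeExp K ν m + sizeExp K ν n := by
  unfold sizeExp
  have h : (m - K) + (n - K) + 1 ≤ m + n - K := by omega
  have h' : ((m - K : ℕ) : ℝ) + ((n - K : ℕ) : ℝ) + 1 ≤ ((m + n - K : ℕ) : ℝ) := by exact_mod_cast h
  have := mul_le_mul_of_nonneg_left h' hν0
  push_cast at *
  linarith

/-- If the result has size at most `m + n - 1`, half a power of `ε` is left over; this exceeds the
loss `ν`. -/
theorem sizeExp_add_half_le {ν : ℝ} (hν0 : 0 ≤ ν) (hK : 1 ≤ K) {m n : ℕ} (hm : 1 ≤ m)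
    (hn : 1 ≤ n) : sizeExp K ν (m + n - 1) + 1 / 2 ≤ sizeExp K ν m + sizeExp K ν n := by
  unfold sizeExp
  have h : (m - K) + (n - K) ≤ m + n - 1 - K := by omega
  have h' : ((m - K : ℕ) : ℝ) + ((n - K : ℕ) : ℝ) ≤ ((m + n - 1 - K : ℕ) : ℝ) := by exact_mod_cast h
  have := mul_le_mul_of_nonneg_left h' hν0
  have e : ((m + n - 1 : ℕ) : ℝ) = (m : ℝ) + n - 1 := by
    rw [Nat.cast_sub (by omega)]; push_cast; ring
  rw [e]
  linarith

/-- The exponent of `ε` lost by the non-resonance condition. -/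
noncomputable def lossExp (K : ℕ) (ν : ℝ) (j : ZMod (2 * M)) (k : Fin (M + 1) → ℤ) : ℝ :=
  open Classical in
  if absIdx j ≤ K ∧ k ≠ unitVec j ∧ k ≠ -unitVec j then 0 else ν

theorem lossExp_le {ν : ℝ} (hν0 : 0 ≤ ν) (j : ZMod (2 * M)) (k : Fin (M + 1) → ℤ) :
    lossExp K ν j k ≤ ν := by
  unfold lossExp; split_ifs <;> simp [hν0]

theorem lossExp_nonneg {ν : ℝ} (hν0 : 0 ≤ ν) (j : ZMod (2 * M)) (k : Fin (M + 1) → ℤ) :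
    0 ≤ lossExp K ν j k := by
  unfold lossExp; split_ifs <;> simp [hν0]

/-- The balance that closes the iteration. Without loss, subadditivity is enough. A loss `ν` on the
diagonal is paid by the missing unit of size there; a loss for `|j| > K` is paid by the kink of the
exponent at `K`. -/
theorem sizeExp_add_lossExp_le [NeZero M] (hK : 3 ≤ K) {ν : ℝ} (hν0 : 0 ≤ ν) (hν : ν < 1 / 2)
    {j₁ j₂ : ZMod (2 * M)} {k₁ k₂ : Fin (M + 1) → ℤ} (h₁ : k₁ ∈ modSet K j₁)
    (h₂ : k₂ ∈ modSet K j₂) :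
    sizeExp K ν (idxSize K (j₁ + j₂) (k₁ + k₂)) + lossExp K ν (j₁ + j₂) (k₁ + k₂)
      ≤ sizeExp K ν (idxSize K j₁ k₁) + sizeExp K ν (idxSize K j₂ k₂) := by
  have hadd := idxSize_add_le (K := K) j₁ j₂ k₁ k₂
  have b1 := one_le_idxSize hK j₁ k₁
  have b2 := one_le_idxSize hK j₂ k₂
  unfold lossExp
  split_ifs with h
  · rw [add_zero]
    exact (sizeExp_mono hν0 hν hadd).trans (sizeExp_add_le hν0 _ _)
  · by_cases hd : k₁ + k₂ = unitVec (j₁ + j₂) ∨ k₁ + k₂ = -unitVec (j₁ + j₂)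
    · have h3 := succ_profile_le_idxSize_add hK h₁ h₂ hd
      have h4 := sizeExp_add_half_le (K := K) hν0 (by omega) b1 b2
      rw [idxSize_diag hK _ hd]
      have h5 : sizeExp K ν (profile K (absIdx (j₁ + j₂)))
          ≤ sizeExp K ν (idxSize K j₁ k₁ + idxSize K j₂ k₂ - 1) :=
        sizeExp_mono hν0 hν (by omega)
      linarith
    · have h3 : K < absIdx (j₁ + j₂) := by
        by_contra hle
        push Not at hd hle
        exact h ⟨hle, hd⟩
      have h4 := succ_le_idxSize_add_of_lt_absIdx hK k₁ k₂ h3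
      have h5 := sizeExp_add_loss_le (K := K) hν0 b1 b2 (by omega) h4
      have h6 := sizeExp_mono (K := K) hν0 hν hadd
      linarith

/-- A discarded product has total size at least `2K`, and the exponent at `2K` is `K - Kν`; this
fixes the final accuracy. -/
theorem le_sizeExp_add_of_notMem (hK : 3 ≤ K) {ν : ℝ} (hν0 : 0 ≤ ν) (hν : ν < 1 / 2)
    {j₁ j₂ : ZMod (2 * M)} {k₁ k₂ : Fin (M + 1) → ℤ} (h : k₁ + k₂ ∉ modSet K (j₁ + j₂)) :
    K - K * ν ≤ sizeExp K ν (idxSize K j₁ k₁) + sizeExp K ν (idxSize K j₂ k₂) := by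
  rw [mem_modSet_iff hK, not_lt] at h
  have h1 := sizeExp_mono (K := K) hν0 hν (h.trans (idxSize_add_le (K := K) j₁ j₂ k₁ k₂))
  have h2 := sizeExp_add_le (K := K) hν0 (idxSize K j₁ k₁) (idxSize K j₂ k₂)
  have h3 : sizeExp K ν (2 * K) = K - K * ν := by
    unfold sizeExp
    rw [show 2 * K - K = K by omega]; push_cast; ring
  linarith

theorem half_le_sizeExp (hK : 3 ≤ K) {ν : ℝ} (hν0 : 0 ≤ ν) (hν : ν < 1 / 2)
    (j : ZMod (2 * M)) (k : Fin (M + 1) → ℤ) : 1 / 2 ≤ sizeExp K ν (idxSize K j k) := by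
  have h := sizeExp_mono (K := K) hν0 hν (one_le_idxSize hK j k)
  have : sizeExp K ν 1 = 1 / 2 := by
    unfold sizeExp; rw [show 1 - K = 0 by omega]; simp
  linarith

theorem sizeExp_diag [NeZero M] (hK : 3 ≤ K) {ν : ℝ} (j : ZMod (2 * M)) {k : Fin (M + 1) → ℤ}
    (hk : k = unitVec j ∨ k = -unitVec j) :
    sizeExp K ν (idxSize K j k) = (profile K (absIdx j) : ℝ) / 2 := by
  have := profile_le hK (absIdx j)
  rw [idxSize_diag hK j hk, sizeExp, Nat.sub_eq_zero_of_le this]; simp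

end Indices

/-! ### The Sobolev norm and its algebra property -/

section Sobolev

theorem sobWeight_pos (s : ℝ) (l : ℕ) : 0 < sobWeight s l :=
  Real.rpow_pos_of_pos (lt_of_lt_of_le one_pos (le_max_right _ _)) _

theorem sobWeight_le_add {s : ℝ} (hs : 0 ≤ s) {l m n : ℕ} (h : l ≤ m + n) :
    sobWeight s l ≤ 2 ^ (2 * s) * (sobWeight s m + sobWeight s n) := by
  have key : ∀ m n : ℕ, l ≤ m + n → (n : ℝ) ≤ m →
      sobWeight s l ≤ 2 ^ (2 * s) * sobWeight s m := by
    intro m n h hnm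
    have h' : (l : ℝ) ≤ m + n := by exact_mod_cast h
    unfold sobWeight
    rw [← Real.mul_rpow (by norm_num) (le_trans zero_le_one (le_max_right _ _))]
    refine Real.rpow_le_rpow (le_trans zero_le_one (le_max_right _ _)) ?_ (by linarith)
    have := le_max_left (m : ℝ) 1
    have := le_max_right (m : ℝ) 1
    exact max_le (by linarith) (by linarith)
  have h2 : (0 : ℝ) < 2 ^ (2 * s) := by positivity
  rcases le_total (n : ℝ) m with hnm | hnm
  · refine (key m n h hnm).trans (mul_le_mul_of_nonneg_left ?_ h2.le)
    linarith [sobWeight_pos s n]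
  · refine (key n m (by omega) hnm).trans (mul_le_mul_of_nonneg_left ?_ h2.le)
    linarith [sobWeight_pos s m]

theorem exists_sum_inv_sobWeight_le {s : ℝ} (hs : 1 / 2 < s) :
    ∃ A : ℝ, 0 < A ∧ ∀ (M : ℕ) [NeZero M],
      ∑ j : ZMod (2 * M), (sobWeight s (absIdx j))⁻¹ ≤ A := by
  have hsum := Real.summable_abs_int_rpow (b := 2 * s) (by linarith)
  have hnn : ∀ n : ℤ, 0 ≤ |(n : ℝ)| ^ (-(2 * s)) := fun n => by positivity
  refine ⟨(∑' n : ℤ, |(n : ℝ)| ^ (-(2 * s))) + 1,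
    add_pos_of_nonneg_of_pos (tsum_nonneg hnn) one_pos, ?_⟩
  intro M _
  -- The extra `1` pays for `j = 0`, whose weight is `1`; only nonnegativity of the real power is
  -- used there. All other terms are distinct terms of a series convergent for `2s > 1`, hence the
  -- uniformity in `M`.
  have h1 : ∀ j : ZMod (2 * M), (sobWeight s (absIdx j))⁻¹ ≤
      |((j.valMinAbs : ℤ) : ℝ)| ^ (-(2 * s)) + if j = 0 then 1 else 0 := by
    intro j
    have habs : ((absIdx j : ℕ) : ℝ) = |((j.valMinAbs : ℤ) : ℝ)| := by
      unfold absIdx; rw [Nat.cast_natAbs, Int.cast_abs]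
    by_cases hj : j = 0
    · subst hj
      have : absIdx (0 : ZMod (2 * M)) = 0 := absIdx_eq_zero.2 rfl
      rw [this]
      have := hnn (0 : ZMod (2 * M)).valMinAbs
      simp only [sobWeight, Nat.cast_zero, if_true]
      rw [max_eq_right zero_le_one, Real.one_rpow, inv_one]
      linarith
    · have h0 : absIdx j ≠ 0 := fun h => hj (absIdx_eq_zero.1 h)
      have h1 : (1 : ℝ) ≤ absIdx j := by exact_mod_cast Nat.one_le_iff_ne_zero.2 h0
      rw [if_neg hj, add_zero, ← habs, sobWeight, max_eq_left h1, Real.rpow_neg (by positivity)]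
  refine (Finset.sum_le_sum fun j _ => h1 j).trans ?_
  rw [Finset.sum_add_distrib, Finset.sum_ite_eq']
  simp only [Finset.mem_univ, if_true]
  have hinj : Function.Injective (fun j : ZMod (2 * M) => j.valMinAbs) :=
    ZMod.injective_valMinAbs
  have h3 : ∑ j : ZMod (2 * M), |((j.valMinAbs : ℤ) : ℝ)| ^ (-(2 * s))
      = ∑ n ∈ Finset.univ.map ⟨_, hinj⟩, |(n : ℝ)| ^ (-(2 * s)) := by
    rw [Finset.sum_map]; rfl
  rw [h3]
  exact add_le_add_left (hsum.sum_le_tsum _ fun n _ => hnn n) 1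

variable {M : ℕ} [NeZero M]

/-- The weighted `ℓ²` norm `(∑_j σ_j |v_j|²)^{1/2}`. -/
noncomputable def snorm (s : ℝ) (v : ZMod (2 * M) → ℝ) : ℝ :=
  Real.sqrt (∑ j, sobWeight s (absIdx j) * v j ^ 2)

theorem snorm_nonneg (s : ℝ) (v : ZMod (2 * M) → ℝ) : 0 ≤ snorm s v := Real.sqrt_nonneg _

theorem snorm_sq (s : ℝ) (v : ZMod (2 * M) → ℝ) :
    snorm s v ^ 2 = ∑ j, sobWeight s (absIdx j) * v j ^ 2 :=
  Real.sq_sqrt (Finset.sum_nonneg fun _ _ => mul_nonneg (sobWeight_pos _ _).le (sq_nonneg _))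

theorem snorm_mono {s : ℝ} {v w : ZMod (2 * M) → ℝ} (h : ∀ j, |v j| ≤ w j) :
    snorm s v ≤ snorm s w := by
  refine Real.sqrt_le_sqrt (Finset.sum_le_sum fun j _ => ?_)
  refine mul_le_mul_of_nonneg_left ?_ (sobWeight_pos _ _).le
  exact sq_le_sq.2 ((h j).trans (le_abs_self _))

theorem snorm_mono' {s : ℝ} {v w : ZMod (2 * M) → ℝ} (h0 : ∀ j, 0 ≤ v j) (h : ∀ j, v j ≤ w j) :
    snorm s v ≤ snorm s w := snorm_mono fun j => by rw [abs_of_nonneg (h0 j)]; exact h j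

theorem snorm_eq_norm (s : ℝ) (v : ZMod (2 * M) → ℝ) :
    snorm s v = ‖(WithLp.toLp 2 fun j => Real.sqrt (sobWeight s (absIdx j)) * v j :
      EuclideanSpace ℝ (ZMod (2 * M)))‖ := by
  rw [EuclideanSpace.norm_eq, snorm]
  congr 1
  refine Finset.sum_congr rfl fun j _ => ?_
  rw [Real.norm_eq_abs, sq_abs, mul_pow, Real.sq_sqrt (sobWeight_pos _ _).le]

theorem snorm_add_le (s : ℝ) (v w : ZMod (2 * M) → ℝ) :
    snorm s (fun j => v j + w j) ≤ snorm s v + snorm s w := by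
  rw [snorm_eq_norm, snorm_eq_norm, snorm_eq_norm]
  refine le_trans (le_of_eq ?_) (norm_add_le _ _)
  congr 1
  ext j
  simp [mul_add]

theorem snorm_mul_left (s c : ℝ) (v : ZMod (2 * M) → ℝ) :
    snorm s (fun j => c * v j) = |c| * snorm s v := by
  unfold snorm
  rw [← Real.sqrt_sq_eq_abs, ← Real.sqrt_mul (sq_nonneg _), Finset.mul_sum]
  congr 1
  exact Finset.sum_congr rfl fun j _ => by ring

/-- The discrete convolution of real vectors. -/
noncomputable def rconv (a b : ZMod (2 * M) → ℝ) : ZMod (2 * M) → ℝ :=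
  fun j => ∑ j₁, a j₁ * b (j - j₁)

/-- Cauchy–Schwarz with weights `σ_{j₁} σ_{j-j₁}`; since `σ_j` is at most a constant times `σ_{j₁} +
σ_{j-j₁}`, the remaining weight sum reduces to two copies of the uniformly bounded sum of `σ⁻¹`. -/
theorem exists_snorm_rconv_le {s : ℝ} (hs : 1 / 2 < s) :
    ∃ A : ℝ, 0 < A ∧ ∀ (M : ℕ) [NeZero M] (a b : ZMod (2 * M) → ℝ),
      snorm s (rconv a b) ≤ A * snorm s a * snorm s b := by
  obtain ⟨A, hA, hsum⟩ := exists_sum_inv_sobWeight_le hs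
  refine ⟨Real.sqrt (2 ^ (2 * s) * (2 * A)), by positivity, fun M _ a b => ?_⟩
  set σ : ZMod (2 * M) → ℝ := fun j => sobWeight s (absIdx j) with hσ
  have hσ0 : ∀ j, 0 < σ j := fun j => sobWeight_pos _ _
  have hsq : snorm s (rconv a b) ^ 2 ≤ (2 ^ (2 * s) * (2 * A)) * snorm s a ^ 2 * snorm s b ^ 2 := by
    rw [snorm_sq, snorm_sq, snorm_sq]
    have h1 : ∀ j, σ j * rconv a b j ^ 2 ≤ (2 ^ (2 * s) * (2 * A)) *
        ∑ j₁, (σ j₁ * a j₁ ^ 2) * (σ (j - j₁) * b (j - j₁) ^ 2) := by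
      intro j
      have hcs : rconv a b j ^ 2 ≤ (∑ j₁, (σ j₁ * σ (j - j₁))⁻¹) *
          ∑ j₁, (σ j₁ * a j₁ ^ 2) * (σ (j - j₁) * b (j - j₁) ^ 2) := by
        refine Finset.sum_sq_le_sum_mul_sum_of_sq_le_mul _ (fun i _ => ?_) (fun i _ => ?_)
          (fun i _ => ?_)
        · exact inv_nonneg.2 (mul_pos (hσ0 _) (hσ0 _)).le
        · have := hσ0 i; have := hσ0 (j - i); positivity
        · have := (hσ0 i).ne'; have := (hσ0 (j - i)).ne'
          refine le_of_eq ?_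
          field_simp
      have hw : σ j * (∑ j₁, (σ j₁ * σ (j - j₁))⁻¹) ≤ 2 ^ (2 * s) * (2 * A) := by
        rw [Finset.mul_sum]
        have : ∀ j₁ ∈ Finset.univ, σ j * (σ j₁ * σ (j - j₁))⁻¹ ≤
            2 ^ (2 * s) * ((σ (j - j₁))⁻¹ + (σ j₁)⁻¹) := by
          intro j₁ _
          have h3 : σ j ≤ 2 ^ (2 * s) * (σ j₁ + σ (j - j₁)) :=
            sobWeight_le_add (by linarith) (by
              have := absIdx_add_le j₁ (j - j₁)
              rwa [add_sub_cancel] at this)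
          have p1 := hσ0 j₁
          have p2 := hσ0 (j - j₁)
          calc σ j * (σ j₁ * σ (j - j₁))⁻¹
              ≤ 2 ^ (2 * s) * (σ j₁ + σ (j - j₁)) * (σ j₁ * σ (j - j₁))⁻¹ := by gcongr
            _ = _ := by field_simp
        refine (Finset.sum_le_sum this).trans ?_
        rw [← Finset.mul_sum, Finset.sum_add_distrib]
        have e : ∑ j₁, (σ (j - j₁))⁻¹ = ∑ j₁, (σ j₁)⁻¹ :=
          Equiv.sum_comp (Equiv.subLeft j) fun i => (σ i)⁻¹
        rw [e]
        have := hsum M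
        have h2 : (0 : ℝ) < 2 ^ (2 * s) := by positivity
        refine mul_le_mul_of_nonneg_left ?_ h2.le
        simp only [hσ]; linarith
      calc σ j * rconv a b j ^ 2 ≤ σ j * ((∑ j₁, (σ j₁ * σ (j - j₁))⁻¹) *
          ∑ j₁, (σ j₁ * a j₁ ^ 2) * (σ (j - j₁) * b (j - j₁) ^ 2)) :=
            mul_le_mul_of_nonneg_left hcs (hσ0 j).le
        _ ≤ _ := by
          rw [← mul_assoc]
          refine mul_le_mul_of_nonneg_right hw (Finset.sum_nonneg fun i _ => ?_)
          have := hσ0 i; have := hσ0 (j - i); positivity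
    refine (Finset.sum_le_sum fun j _ => h1 j).trans (le_of_eq ?_)
    rw [← Finset.mul_sum, Finset.sum_comm, mul_assoc (2 ^ (2 * s) * (2 * A))]
    congr 1
    rw [Finset.sum_mul]
    refine Finset.sum_congr rfl fun j₁ _ => ?_
    rw [← Finset.mul_sum]
    congr 1
    exact Equiv.sum_comp (Equiv.subRight j₁) fun i => σ i * b i ^ 2
  have h0 : 0 ≤ Real.sqrt (2 ^ (2 * s) * (2 * A)) * snorm s a * snorm s b :=
    mul_nonneg (mul_nonneg (Real.sqrt_nonneg _) (snorm_nonneg _ _)) (snorm_nonneg _ _)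
  refine (sq_le_sq₀ (snorm_nonneg _ _) h0).1 ?_
  rw [mul_pow, mul_pow, Real.sq_sqrt (by positivity)]
  exact hsq

end Sobolev

/-! ### The linear modulation system -/

/-- The standing assumptions on the parameters of the integrator. -/
structure NumSetup (K M : ℕ) (ρ τ ε ν γ B : ℝ) (ψ φ : ℝ → ℝ) : Prop where
  hK : 3 ≤ K
  hν0 : 0 ≤ ν
  hν : ν < 1 / 2
  hρ : 0 < ρ
  hγ : 0 < γ
  hτ : 0 < τ
  hε : 0 < ε
  hε1 : ε ≤ 1
  nonres : NonResonant K M ρ τ ε ν γ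
  filter : IsSymplecticFilter B ψ φ

theorem sqrt_le_freq {ρ : ℝ} (l : ℕ) : Real.sqrt ρ ≤ freq ρ l :=
  Real.sqrt_le_sqrt (by nlinarith [sq_nonneg (l : ℝ)])

theorem freq_pos {ρ : ℝ} (hρ : 0 < ρ) (l : ℕ) : 0 < freq ρ l :=
  (Real.sqrt_pos.2 hρ).trans_le (sqrt_le_freq l)

theorem dotFreq_unitVec {M : ℕ} [NeZero M] (ρ : ℝ) (j : ZMod (2 * M)) :
    dotFreq ρ (unitVec j) = freq ρ (absIdx j) := by
  unfold dotFreq unitVec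
  rw [Finset.sum_eq_single (⟨absIdx j, Nat.lt_succ_of_le (absIdx_le j)⟩ : Fin (M + 1))]
  · simp
  · intro b _ hb
    have : (b : ℕ) ≠ absIdx j := fun h => hb (Fin.ext h)
    simp [this]
  · simp

theorem dotFreq_neg {M : ℕ} (ρ : ℝ) (k : Fin (M + 1) → ℤ) : dotFreq ρ (-k) = -dotFreq ρ k := by
  simp [dotFreq]

theorem dotFreq_add {M : ℕ} (ρ : ℝ) (k k' : Fin (M + 1) → ℤ) :
    dotFreq ρ (k + k') = dotFreq ρ k + dotFreq ρ k' := by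
  simp [dotFreq, add_mul, Finset.sum_add_distrib]

/-- The factor `ε^{-ℓ(j,k)}` lost by the non-resonance condition. -/
noncomputable def lossFactor (K : ℕ) {M : ℕ} (ε ν : ℝ) (j : ZMod (2 * M))
    (k : Fin (M + 1) → ℤ) : ℝ := ε ^ (-lossExp K ν j k)

/-- The boundary term `e^{iθ} p(h) - e^{-iθ} p(-h)`. -/
noncomputable def velTerm (θ h : ℝ) (p : ℂ[X]) : ℂ :=
  Complex.exp (θ * Complex.I) * p.eval (h : ℂ) - Complex.exp (-θ * Complex.I) * p.eval (-h : ℂ)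

/-- The constant coefficient enters with a factor `sin θ` and everything else with a factor `h`.
Both become multiples of `|sin α|` later, so the velocity condition can be divided by `sin α`. -/
theorem velTerm_eq (θ h : ℝ) (p : ℂ[X]) :
    velTerm θ h p = 2 * Real.sin θ * Complex.I * p.coeff 0
      + (Complex.exp (θ * Complex.I) * (p.eval (h : ℂ) - p.coeff 0)
        - Complex.exp (-θ * Complex.I) * (p.eval (-h : ℂ) - p.coeff 0)) := by
  have h1 : Complex.exp (θ * Complex.I) = Real.cos θ + Real.sin θ * Complex.I := by
    rw [Complex.exp_mul_I]; simp
  have h2 : Complex.exp (-θ * Complex.I) = Real.cos θ - Real.sin θ * Complex.I := by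
    rw [Complex.exp_mul_I]; simp [sub_eq_add_neg]
  rw [velTerm, h1, h2]
  ring

theorem velTerm_add (θ h : ℝ) (p q : ℂ[X]) :
    velTerm θ h (p + q) = velTerm θ h p + velTerm θ h q := by
  simp only [velTerm, Polynomial.eval_add]; ring

theorem velTerm_C (θ h : ℝ) (c : ℂ) : velTerm θ h (C c) = 2 * Real.sin θ * Complex.I * c := by
  rw [velTerm_eq]; simp

theorem norm_velTerm_le {N : ℕ} {p : ℂ[X]} (hp : p ∈ degreeLT ℂ N) {H θ h : ℝ} (hH : 1 ≤ H)
    (hh : |h| ≤ H) :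
    ‖velTerm θ h p‖ ≤ 2 * (|Real.sin θ| * ‖p.coeff 0‖) + 2 * (|h| * H ^ N * pnorm p) := by
  rw [velTerm_eq]
  have e1 := norm_eval_sub_coeff_zero_le hp hH (x := (h : ℂ)) (by simpa using hh)
  have e2 := norm_eval_sub_coeff_zero_le hp hH (x := (-h : ℂ)) (by simpa using hh)
  rw [norm_neg] at e2
  rw [Complex.norm_real, Real.norm_eq_abs] at e1 e2
  refine (norm_add_le _ _).trans (add_le_add (le_of_eq ?_) ((norm_sub_le _ _).trans ?_))
  · simp [-Complex.ofReal_sin]; ring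
  · rw [norm_mul, norm_mul, Complex.norm_exp_ofReal_mul_I, norm_exp_ofReal_mul_I']
    linarith

theorem modOp_C_eq_zero {θ α : ℝ} (h : ℝ) (hcos : Real.cos θ = Real.cos α) (c : ℂ) :
    modOp θ α h (C c) = 0 := by
  rw [modOp_eq, hcos]; simp [taylorRem_apply]

/-! ### Consequences of non-resonance and of the filter relation -/

namespace NumSetup

variable {K M : ℕ} {ρ τ ε ν γ B : ℝ} {ψ φ : ℝ → ℝ}

theorem q_pos (S : NumSetup K M ρ τ ε ν γ B ψ φ) : 0 < ε ^ (ν / 2) := Real.rpow_pos_of_pos S.hε _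

theorem q_le_one (S : NumSetup K M ρ τ ε ν γ B ψ φ) : ε ^ (ν / 2) ≤ 1 :=
  Real.rpow_le_one S.hε.le S.hε1 (by linarith [S.hν0])

theorem B_nonneg (S : NumSetup K M ρ τ ε ν γ B ψ φ) : 0 ≤ B :=
  (abs_nonneg _).trans (S.filter.bound_φ 0)

theorem lossFactor_pos (S : NumSetup K M ρ τ ε ν γ B ψ φ) (j : ZMod (2 * M))
    (k : Fin (M + 1) → ℤ) : 0 < lossFactor K ε ν j k := Real.rpow_pos_of_pos S.hε _

theorem one_le_lossFactor (S : NumSetup K M ρ τ ε ν γ B ψ φ) (j : ZMod (2 * M))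
    (k : Fin (M + 1) → ℤ) : 1 ≤ lossFactor K ε ν j k :=
  Real.one_le_rpow_of_pos_of_le_one_of_nonpos S.hε S.hε1
    (neg_nonpos.2 (lossExp_nonneg S.hν0 j k))

/-- The strong condition at `(j, k) = (0, 0)` bounds the step size, since a sine is at most `1`.
This keeps `h` bounded in the Taylor estimates. -/
theorem mul_tau_le_one [NeZero M] (S : NumSetup K M ρ τ ε ν γ B ψ φ) : γ * τ ≤ 1 := by
  have h0 : (0 : Fin (M + 1) → ℤ) ∈ modSet K (0 : ZMod (2 * M)) := by
    refine Or.inl ⟨?_, fun _ _ => rfl⟩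
    have : absIdx (0 : ZMod (2 * M)) = 0 := absIdx_eq_zero.2 rfl
    have := S.hK
    simp [mu, *]
    omega
  have hne := unitVec_ne_zero (0 : ZMod (2 * M))
  have h1 := S.nonres.strong_add 0 0 h0 hne.symm (neg_ne_zero.2 hne).symm (by
    rw [absIdx_eq_zero.2 rfl]; omega)
  exact h1.trans (Real.abs_sin_le_one _)

theorem h_le [NeZero M] (S : NumSetup K M ρ τ ε ν γ B ψ φ) : |ε ^ (ν / 2) * τ| ≤ max 1 γ⁻¹ := by
  have h1 := S.mul_tau_le_one
  have h2 : τ ≤ γ⁻¹ := by rw [← one_div, le_div_iff₀ S.hγ]; linarith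
  rw [abs_of_pos (mul_pos S.q_pos S.hτ)]
  exact (mul_le_of_le_one_left S.hτ.le S.q_le_one).trans (h2.trans (le_max_right _ _))

/-- The weak condition with `k = ⟨j⟩` and the plus sign, where the half-angle argument is `τ ω_j`.
-/
theorem le_abs_sin [NeZero M] (S : NumSetup K M ρ τ ε ν γ B ψ φ) (j : ZMod (2 * M)) :
    γ * (ε ^ (ν / 2) * τ) ≤ |Real.sin (τ * freq ρ (absIdx j))| := by
  have h := S.nonres.weak_add j (unitVec j) (unitVec_mem_modSet S.hK j) (unitVec_ne_neg j)
  rw [dotFreq_unitVec, show 1 / 2 * τ * (freq ρ (absIdx j) + freq ρ (absIdx j))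
    = τ * freq ρ (absIdx j) by ring] at h
  linarith

theorem sin_ne_zero [NeZero M] (S : NumSetup K M ρ τ ε ν γ B ψ φ) (j : ZMod (2 * M)) :
    Real.sin (τ * freq ρ (absIdx j)) ≠ 0 :=
  abs_pos.1 ((mul_pos S.hγ (mul_pos S.q_pos S.hτ)).trans_le (S.le_abs_sin j))

theorem alpha_pos (S : NumSetup K M ρ τ ε ν γ B ψ φ) (j : ZMod (2 * M)) :
    0 < τ * freq ρ (absIdx j) := mul_pos S.hτ (freq_pos S.hρ _)

/-- The symplectic relation makes `τ ψ(τω_j) = sin(τω_j) φ(τω_j) / ω_j`, so the filter compensates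
small divisors `sin(τω_j)`. -/
theorem abs_psi (S : NumSetup K M ρ τ ε ν γ B ψ φ) (j : ZMod (2 * M)) :
    τ * |ψ (τ * freq ρ (absIdx j))| ≤
      B / Real.sqrt ρ * |Real.sin (τ * freq ρ (absIdx j))| := by
  have hα := S.alpha_pos j
  have hω := sqrt_le_freq (ρ := ρ) (absIdx j)
  have hs := Real.sqrt_pos.2 S.hρ
  have hω0 := freq_pos S.hρ (absIdx j)
  rw [S.filter.symplectic, Real.sinc_of_ne_zero hα.ne', abs_mul, abs_div, abs_of_pos hα]
  have hφ := S.filter.bound_φ (τ * freq ρ (absIdx j))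
  have hB := S.B_nonneg
  have hτ := S.hτ
  calc τ * (|Real.sin (τ * freq ρ (absIdx j))| / (τ * freq ρ (absIdx j))
        * |φ (τ * freq ρ (absIdx j))|)
      = |φ (τ * freq ρ (absIdx j))| / freq ρ (absIdx j)
        * |Real.sin (τ * freq ρ (absIdx j))| := by field_simp
    _ ≤ B / Real.sqrt ρ * |Real.sin (τ * freq ρ (absIdx j))| := by gcongr

/-- Treats strong and weak conditions at once: `e` is the loss per sine factor (`1` or `ε^{-ν/2}`).
The two factors together lose `e²`, while `e ε^{ν/2} ≤ 1` says that one step of slow time makes up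
for the loss of one factor. -/
theorem offdiag_le_abs_sin (S : NumSetup K M ρ τ ε ν γ B ψ φ) {j : ZMod (2 * M)}
    {k : Fin (M + 1) → ℤ} (hk : k ∈ modSet K j) (h1 : k ≠ unitVec j) (h2 : k ≠ -unitVec j) :
    ∃ e : ℝ, 1 ≤ e ∧ e * e = lossFactor K ε ν j k ∧ e * ε ^ (ν / 2) ≤ 1 ∧
      γ * τ ≤ e * |Real.sin (1 / 2 * τ * (freq ρ (absIdx j) + dotFreq ρ k))| ∧
      γ * τ ≤ e * |Real.sin (1 / 2 * τ * (freq ρ (absIdx j) - dotFreq ρ k))| := by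
  by_cases hj : absIdx j ≤ K
  · refine ⟨1, le_rfl, ?_, by simpa using S.q_le_one, ?_, ?_⟩
    · rw [lossFactor, lossExp, if_pos ⟨hj, h1, h2⟩]; simp
    · simpa using S.nonres.strong_add j k hk h1 h2 hj
    · simpa using S.nonres.strong_sub j k hk h1 h2 hj
  · have hq := S.q_pos
    have e1 : ε ^ (-(ν / 2)) * ε ^ (ν / 2) = 1 := by
      rw [← Real.rpow_add S.hε]; simp
    refine ⟨ε ^ (-(ν / 2)), Real.one_le_rpow_of_pos_of_le_one_of_nonpos S.hε S.hε1
      (by linarith [S.hν0]), ?_, e1.le, ?_, ?_⟩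
    · rw [lossFactor, lossExp, if_neg (fun h => hj h.1), ← Real.rpow_add S.hε]
      congr 1; ring
    · have := S.nonres.weak_add j k hk h2
      calc γ * τ = ε ^ (-(ν / 2)) * (γ * τ * ε ^ (ν / 2)) := by linear_combination -γ * τ * e1
        _ ≤ _ := mul_le_mul_of_nonneg_left this (Real.rpow_nonneg S.hε.le _)
    · have := S.nonres.weak_sub j k hk h1
      calc γ * τ = ε ^ (-(ν / 2)) * (γ * τ * ε ^ (ν / 2)) := by linear_combination -γ * τ * e1
        _ ≤ _ := mul_le_mul_of_nonneg_left this (Real.rpow_nonneg S.hε.le _)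

end NumSetup

theorem two_cos_sub_two_cos (x y : ℝ) :
    2 * Real.cos (x) - 2 * Real.cos y
      = 4 * Real.sin (1 / 2 * (y + x)) * Real.sin (1 / 2 * (y - x)) := by
  have := Real.cos_sub_cos x y
  rw [show (x + y) / 2 = 1 / 2 * (y + x) by ring,
    show (x - y) / 2 = -(1 / 2 * (y - x)) by ring, Real.sin_neg] at this
  linarith

theorem abs_sin_le_add (x y : ℝ) :
    |Real.sin x| ≤ |Real.sin (1 / 2 * (y + x))| + |Real.sin (1 / 2 * (y - x))| := by
  have : Real.sin x = Real.sin (1 / 2 * (y + x)) * Real.cos (1 / 2 * (y - x))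
      - Real.cos (1 / 2 * (y + x)) * Real.sin (1 / 2 * (y - x)) := by
    rw [← Real.sin_sub]; congr 1; ring
  rw [this]
  refine (abs_sub _ _).trans (add_le_add ?_ ?_)
  · rw [abs_mul]; exact mul_le_of_le_one_right (abs_nonneg _) (Real.abs_cos_le_one _)
  · rw [abs_mul]; exact mul_le_of_le_one_left (abs_nonneg _) (Real.abs_cos_le_one _)

set_option maxHeartbeats 1000000 in
/-- Solution of a single modulation equation. -/
theorem exists_single_solution (K : ℕ) (ρ ν γ B : ℝ) (N : ℕ) :
    ∃ A : ℝ, 0 ≤ A ∧ ∀ (M : ℕ) [NeZero M] (τ ε : ℝ) (ψ φ : ℝ → ℝ),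
      NumSetup K M ρ τ ε ν γ B ψ φ → ∀ (j : ZMod (2 * M)), ∀ k ∈ modSet K j,
      ∀ g ∈ degreeLT ℂ N, ∃ p ∈ degreeLT ℂ (N + 1),
        modOp (τ * dotFreq ρ k) (τ * freq ρ (absIdx j)) (ε ^ (ν / 2) * τ) p
          = ((τ ^ 2 * ψ (τ * freq ρ (absIdx j)) : ℝ) : ℂ) • g ∧
        pnorm p ≤ A * lossFactor K ε ν j k * pnorm g ∧
        ‖velTerm (τ * dotFreq ρ k) (ε ^ (ν / 2) * τ) p‖ ≤
          A * lossFactor K ε ν j k * |Real.sin (τ * freq ρ (absIdx j))| * pnorm g := by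
  set H : ℝ := max 1 γ⁻¹ with hH
  have hH1 : 1 ≤ H := le_max_left _ _
  by_cases hγ : 0 < γ
  swap
  · exact ⟨0, le_rfl, fun M _ τ ε ψ φ S => absurd S.hγ hγ⟩
  -- Large enough for the two smallness conditions of `exists_modOp_eq` and the one of
  -- `exists_modOp_diag_eq`.
  set c : ℝ := max γ⁻¹ (γ⁻¹ ^ 2) with hc
  have hc0 : 0 ≤ c := (inv_nonneg.2 hγ.le).trans (le_max_left _ _)
  obtain ⟨C₁, hC₁, H₁⟩ := exists_modOp_eq H c (by linarith) hc0 N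
  obtain ⟨C₂, hC₂, H₂⟩ := exists_modOp_diag_eq H c (by linarith) hc0 N
  set A₁ : ℝ := max (C₁ * |B| * γ⁻¹ ^ 2) (C₂ * (|B| / Real.sqrt ρ)) with hA₁
  have hA₁0 : 0 ≤ A₁ := le_trans (by positivity) (le_max_left _ _)
  set A₂ : ℝ := C₁ * (|B| / Real.sqrt ρ) * γ⁻¹ with hA₂
  have hA₂0 : 0 ≤ A₂ := by positivity
  refine ⟨A₁ + (2 * A₂ + 2 * γ⁻¹ * H ^ (N + 1) * A₁), by positivity, ?_⟩
  intro M _ τ ε ψ φ S j k hk g hg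
  have hB : |B| = B := abs_of_nonneg S.B_nonneg
  set α := τ * freq ρ (absIdx j) with hα
  set θ := τ * dotFreq ρ k with hθ
  set h := ε ^ (ν / 2) * τ with hh
  set E := lossFactor K ε ν j k with hE
  have hE1 : 1 ≤ E := S.one_le_lossFactor j k
  have hh0 : 0 < h := mul_pos S.q_pos S.hτ
  have hhH : |h| ≤ H := S.h_le
  have hsα : γ * h ≤ |Real.sin α| := S.le_abs_sin j
  have hsα0 : 0 < |Real.sin α| := lt_of_lt_of_le (mul_pos hγ hh0) hsα
  have hsα' : h ≤ γ⁻¹ * |Real.sin α| := by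
    rw [inv_mul_eq_div, le_div_iff₀ hγ]; linarith
  have hτ := S.hτ
  have hψ := S.abs_psi j
  have hψB := S.filter.bound_ψ α
  have hρs := Real.sqrt_pos.2 S.hρ
  have hgn := pnorm_nonneg g
  -- The boundary term follows from the constant coefficient alone, the rest being controlled by `h
  -- ≤ γ⁻¹ |sin α|`.
  suffices hmain : ∃ p ∈ degreeLT ℂ (N + 1), modOp θ α h p = ((τ ^ 2 * ψ α : ℝ) : ℂ) • g ∧
      pnorm p ≤ A₁ * E * pnorm g ∧
      |Real.sin θ| * ‖p.coeff 0‖ ≤ A₂ * E * |Real.sin α| * pnorm g by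
    obtain ⟨p, hp, hL, hp1, hp2⟩ := hmain
    set D : ℝ := 2 * A₂ + 2 * γ⁻¹ * H ^ (N + 1) * A₁ with hD
    have hD0 : 0 ≤ D := by positivity
    have hA₁D : A₁ ≤ A₁ + D := by linarith
    have hDA₁ : D ≤ A₁ + D := by linarith
    refine ⟨p, hp, hL, hp1.trans ?_, (norm_velTerm_le hp hH1 hhH).trans ?_⟩
    · gcongr
    · rw [abs_of_pos hh0]
      have hpn := pnorm_nonneg p
      calc _ ≤ 2 * (A₂ * E * |Real.sin α| * pnorm g)
            + 2 * (γ⁻¹ * |Real.sin α| * H ^ (N + 1) * (A₁ * E * pnorm g)) := by gcongr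
        _ = D * E * |Real.sin α| * pnorm g := by rw [hD]; ring
        _ ≤ _ := by gcongr
  have hgn' : pnorm (((τ ^ 2 * ψ α : ℝ) : ℂ) • g) = τ ^ 2 * |ψ α| * pnorm g := by
    rw [pnorm_smul, Complex.norm_real, Real.norm_eq_abs, abs_mul, abs_of_pos (by positivity)]
  by_cases hd : k = unitVec j ∨ k = -unitVec j
  · have hθα : θ = α ∨ θ = -α := by
      rcases hd with rfl | rfl
      · left; rw [hθ, dotFreq_unitVec]
      · right; rw [hθ, dotFreq_neg, dotFreq_unitVec]; ring
    have hcos : Real.cos θ = Real.cos α := by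
      rcases hθα with h' | h' <;> rw [h']; rw [Real.cos_neg]
    have hsin : |Real.sin θ| = |Real.sin α| := by
      rcases hθα with h' | h' <;> rw [h']; rw [Real.sin_neg, abs_neg]
    obtain ⟨p, hp, hp0, hL, hpn⟩ := H₂ θ α h hhH hh0.ne' (abs_pos.1 (hsin ▸ hsα0)) hcos
      (by
        rw [abs_of_pos hh0, hsin]
        exact hsα'.trans (mul_le_mul_of_nonneg_right (le_max_left _ _) (abs_nonneg _)))
      _ (Submodule.smul_mem _ ((τ ^ 2 * ψ α : ℝ) : ℂ) hg)
    refine ⟨p, hp, hL, hpn.trans ?_, ?_⟩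
    · rw [hgn', abs_mul, hsin, abs_of_pos hh0]
      -- On the diagonal `τ / h = ε^{-ν/2}` is the only loss, and it is at most the allotted `E =
      -- ε^{-ν}`.
      have hEq : 1 ≤ E * ε ^ (ν / 2) := by
        have : E = ε ^ (-ν) := by
          rw [hE, lossFactor, lossExp, if_neg]
          rintro ⟨-, h1, h2⟩
          exact hd.elim h1 h2
        rw [this, ← Real.rpow_add S.hε]
        exact Real.one_le_rpow_of_pos_of_le_one_of_nonpos S.hε S.hε1 (by linarith [S.hν0])
      have hq := S.q_pos
      calc C₂ * (|Real.sin α| * h)⁻¹ * (τ ^ 2 * |ψ α| * pnorm g)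
          = C₂ * (|Real.sin α| * h)⁻¹ * (τ * (τ * |ψ α|) * pnorm g) := by ring
        _ ≤ C₂ * (|Real.sin α| * h)⁻¹ * (τ * (B / Real.sqrt ρ * |Real.sin α|) * pnorm g) := by
            gcongr
        _ = C₂ * (B / Real.sqrt ρ) * (ε ^ (ν / 2))⁻¹ * pnorm g := by
            rw [hh]; field_simp
        _ ≤ C₂ * (B / Real.sqrt ρ) * E * pnorm g := by
            have : (ε ^ (ν / 2))⁻¹ ≤ E := by
              rw [inv_le_iff_one_le_mul₀ hq]; exact hEq
            have hB0 := S.B_nonneg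
            gcongr
        _ ≤ A₁ * E * pnorm g := by
            have : C₂ * (B / Real.sqrt ρ) ≤ A₁ := by rw [hA₁, hB]; exact le_max_right _ _
            gcongr
    · rw [hp0]; simp; positivity
  · push Not at hd
    obtain ⟨e, he1, heE, heq, hp, hm⟩ := S.offdiag_le_abs_sin hk hd.1 hd.2
    rw [show 1 / 2 * τ * (freq ρ (absIdx j) + dotFreq ρ k) = 1 / 2 * (α + θ) by
      rw [hα, hθ]; ring] at hp
    rw [show 1 / 2 * τ * (freq ρ (absIdx j) - dotFreq ρ k) = 1 / 2 * (α - θ) by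
      rw [hα, hθ]; ring] at hm
    have hl := two_cos_sub_two_cos θ α
    have hsθ := abs_sin_le_add θ α
    set a := |Real.sin (1 / 2 * (α + θ))| with ha
    set b := |Real.sin (1 / 2 * (α - θ))| with hb
    set l := 2 * Real.cos θ - 2 * Real.cos α with hldef
    have hlab : |l| = 4 * a * b := by rw [hl, abs_mul, abs_mul, abs_of_pos (by norm_num : (0 : ℝ) < 4)]
    have he0 : 0 < e := by linarith
    have ha0 : 0 < a := by
      have := mul_pos hγ hτ
      by_contra h'
      have := mul_nonpos_of_nonneg_of_nonpos he0.le (not_lt.1 h')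
      linarith
    have hb0 : 0 < b := by
      have := mul_pos hγ hτ
      by_contra h'
      have := mul_nonpos_of_nonneg_of_nonpos he0.le (not_lt.1 h')
      linarith
    have hl0 : 0 < |l| := by rw [hlab]; positivity
    have ta : τ ≤ γ⁻¹ * (e * a) := by rw [inv_mul_eq_div, le_div_iff₀ hγ]; linarith
    have tb : τ ≤ γ⁻¹ * (e * b) := by rw [inv_mul_eq_div, le_div_iff₀ hγ]; linarith
    have hq := S.q_pos
    -- The factor `ε^{ν/2}` in `h` cancels `e`. Hence the terms `h sin θ p'` and `h²` are dominated
    -- by the leading coefficient with no power of `ε`, even under the weak condition.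
    have ha' : h ≤ γ⁻¹ * a := by
      calc h ≤ ε ^ (ν / 2) * (γ⁻¹ * (e * a)) := by rw [hh]; gcongr
        _ = (e * ε ^ (ν / 2)) * (γ⁻¹ * a) := by ring
        _ ≤ 1 * (γ⁻¹ * a) := by gcongr
        _ = _ := one_mul _
    have hb' : h ≤ γ⁻¹ * b := by
      calc h ≤ ε ^ (ν / 2) * (γ⁻¹ * (e * b)) := by rw [hh]; gcongr
        _ = (e * ε ^ (ν / 2)) * (γ⁻¹ * b) := by ring
        _ ≤ 1 * (γ⁻¹ * b) := by gcongr
        _ = _ := one_mul _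
    -- One power of `τ` is charged to each of the two sine factors; `e² = E` is the resulting loss.
    have hτ2 : τ ^ 2 ≤ γ⁻¹ ^ 2 * (E * |l|) := by
      calc τ ^ 2 = τ * τ := sq τ
        _ ≤ (γ⁻¹ * (e * a)) * (γ⁻¹ * (e * b)) := by gcongr
        _ = γ⁻¹ ^ 2 * ((e * e) * (a * b)) := by ring
        _ ≤ γ⁻¹ ^ 2 * (E * |l|) := by
            rw [heE, hlab]
            have := mul_pos ha0 hb0
            gcongr
            nlinarith
    -- `|sin θ| ≤ a + b`, and in each summand `τ` is charged to the opposite sine factor, so that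
    -- the product `a b` reappears.
    have hτs : τ * |Real.sin θ| ≤ γ⁻¹ * (E * |l|) := by
      calc τ * |Real.sin θ| ≤ τ * (a + b) := by gcongr
        _ = τ * a + τ * b := by ring
        _ ≤ (γ⁻¹ * (e * b)) * a + (γ⁻¹ * (e * a)) * b := by gcongr
        _ = γ⁻¹ * (e * (2 * a * b)) := by ring
        _ ≤ γ⁻¹ * (E * |l|) := by
            rw [hlab]
            have h1 : e ≤ E := by rw [hE, ← heE]; nlinarith
            have := mul_pos ha0 hb0
            gcongr
            norm_num
    obtain ⟨p, hpd, hL, hpn⟩ := H₁ θ α h hhH (abs_pos.1 hl0)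
      (by
        rw [abs_mul, abs_of_pos hh0]
        calc |Real.sin θ| * h ≤ (a + b) * h := by gcongr
          _ = a * h + b * h := by ring
          _ ≤ a * (γ⁻¹ * b) + b * (γ⁻¹ * a) := by gcongr
          _ = γ⁻¹ * (2 * a * b) := by ring
          _ ≤ c * |l| := by
            rw [hlab]
            have := mul_pos ha0 hb0
            gcongr
            · exact le_max_left _ _
            · norm_num)
      (by
        calc h ^ 2 = h * h := sq h
          _ ≤ (γ⁻¹ * a) * (γ⁻¹ * b) := by gcongr
          _ = γ⁻¹ ^ 2 * (a * b) := by ring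
          _ ≤ c * |l| := by
            rw [hlab]
            have := mul_pos ha0 hb0
            gcongr
            · exact le_max_right _ _
            · nlinarith)
      _ (Submodule.smul_mem _ ((τ ^ 2 * ψ α : ℝ) : ℂ) hg)
    rw [hgn'] at hpn
    refine ⟨p, degreeLT_mono' (Nat.le_succ N) hpd, hL, hpn.trans ?_, ?_⟩
    · have hB0 := S.B_nonneg
      calc C₁ * |l|⁻¹ * (τ ^ 2 * |ψ α| * pnorm g)
          ≤ C₁ * |l|⁻¹ * (γ⁻¹ ^ 2 * (E * |l|) * B * pnorm g) := by gcongr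
        _ = C₁ * B * γ⁻¹ ^ 2 * E * pnorm g := by field_simp
        _ ≤ A₁ * E * pnorm g := by
            have : C₁ * B * γ⁻¹ ^ 2 ≤ A₁ := by rw [hA₁, hB]; exact le_max_left _ _
            gcongr
    · have hB0 := S.B_nonneg
      calc |Real.sin θ| * ‖p.coeff 0‖ ≤ |Real.sin θ| * pnorm p := by
            gcongr; exact norm_coeff_le_pnorm p 0
        _ ≤ |Real.sin θ| * (C₁ * |l|⁻¹ * (τ ^ 2 * |ψ α| * pnorm g)) := by gcongr
        _ = C₁ * |l|⁻¹ * (τ * |Real.sin θ|) * (τ * |ψ α|) * pnorm g := by ring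
        _ ≤ C₁ * |l|⁻¹ * (γ⁻¹ * (E * |l|)) * (B / Real.sqrt ρ * |Real.sin α|) * pnorm g := by
            gcongr
        _ = A₂ * E * |Real.sin α| * pnorm g := by rw [hA₂, hB]; field_simp

theorem mem_modFinset {K M : ℕ} {j : ZMod (2 * M)} {k : Fin (M + 1) → ℤ} :
    k ∈ modFinset K j ↔ k ∈ modSet K j := (modSet_finite K j).mem_toFinset

theorem sum_modFinset_neg {K M : ℕ} (hK : 3 ≤ K) (j : ZMod (2 * M)) {R : Type*}
    [AddCommMonoid R] (f : (Fin (M + 1) → ℤ) → R) :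
    ∑ k ∈ modFinset K (-j), f k = ∑ k ∈ modFinset K j, f (-k) := by
  refine Finset.sum_nbij' (fun k => -k) (fun k => -k) ?_ ?_ ?_ ?_ ?_
  · intro k hk
    rw [mem_modFinset] at *
    have := neg_mem_modSet hK hk
    rwa [neg_neg] at this
  · intro k hk
    rw [mem_modFinset] at *
    exact neg_mem_modSet hK hk
  · simp
  · simp
  · simp

/-- Solution of the modulation equations and of the initial conditions for a single mode `j`. -/
theorem exists_mode_solution (K : ℕ) (ρ ν γ B : ℝ) (N : ℕ) :
    ∃ A : ℝ, 0 ≤ A ∧ ∀ (M : ℕ) [NeZero M] (τ ε : ℝ) (ψ φ : ℝ → ℝ),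
      NumSetup K M ρ τ ε ν γ B ψ φ → ∀ (j : ZMod (2 * M)) (g : (Fin (M + 1) → ℤ) → ℂ[X]),
      (∀ k ∈ modSet K j, g k ∈ degreeLT ℂ N) → ∀ a b : ℂ,
      ∃ z : (Fin (M + 1) → ℤ) → ℂ[X], (∀ k, z k ∈ degreeLT ℂ (N + 1)) ∧
        (∀ k ∈ modSet K j,
          modOp (τ * dotFreq ρ k) (τ * freq ρ (absIdx j)) (ε ^ (ν / 2) * τ) (z k)
            = ((τ ^ 2 * ψ (τ * freq ρ (absIdx j)) : ℝ) : ℂ) • g k) ∧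
        ∑ k ∈ modFinset K j, (z k).eval 0 = a ∧
        ∑ k ∈ modFinset K j, velTerm (τ * dotFreq ρ k) (ε ^ (ν / 2) * τ) (z k)
          = 2 * τ * (Real.sinc (τ * freq ρ (absIdx j)) : ℂ) * b ∧
        ∀ (W : (Fin (M + 1) → ℤ) → ℝ) (w : ℝ), 0 ≤ w → W (unitVec j) = w → W (-unitVec j) = w →
          (∀ k ∈ modSet K j, w ≤ W k) →
          ∑ k ∈ modFinset K j, W k * pnorm (z k) ≤
            A * (w * (‖a‖ + ‖b‖)
              + ∑ k ∈ modFinset K j, W k * lossFactor K ε ν j k * pnorm (g k)) := by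
  obtain ⟨A, hA, H⟩ := exists_single_solution K ρ ν γ B N
  refine ⟨3 * A + 2 + 2 / Real.sqrt ρ, by positivity, ?_⟩
  intro M _ τ ε ψ φ S j g hg a b
  classical
  set α := τ * freq ρ (absIdx j) with hα
  set h := ε ^ (ν / 2) * τ with hh
  have hex : ∀ k, ∃ p ∈ degreeLT ℂ (N + 1), k ∈ modSet K j →
      (modOp (τ * dotFreq ρ k) α h p = ((τ ^ 2 * ψ α : ℝ) : ℂ) • g k ∧
        pnorm p ≤ A * lossFactor K ε ν j k * pnorm (g k) ∧
        ‖velTerm (τ * dotFreq ρ k) h p‖ ≤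
          A * lossFactor K ε ν j k * |Real.sin α| * pnorm (g k)) := by
    intro k
    by_cases hk : k ∈ modSet K j
    · obtain ⟨p, hp, hp'⟩ := H M τ ε ψ φ S j k hk (g k) (hg k hk)
      exact ⟨p, hp, fun _ => hp'⟩
    · exact ⟨0, Submodule.zero_mem _, fun h => absurd h hk⟩
  choose p hp hp' using hex
  have hs : Real.sin α ≠ 0 := S.sin_ne_zero j
  have hsC : (Real.sin α : ℂ) ≠ 0 := by exact_mod_cast hs
  have hα0 : 0 < α := S.alpha_pos j
  -- `P` and `Q` are the required sum and difference of the two free constants at `⟨j⟩` and `-⟨j⟩`: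
  -- position sees their sum, velocity sees their difference times `2i sin α`.
  set P : ℂ := a - ∑ k ∈ modFinset K j, (p k).eval 0 with hP
  set Q : ℂ := (2 * τ * (Real.sinc α : ℂ) * b
    - ∑ k ∈ modFinset K j, velTerm (τ * dotFreq ρ k) h (p k)) / (2 * Real.sin α * Complex.I) with hQ
  set c : (Fin (M + 1) → ℤ) → ℂ := fun k =>
    (if k = unitVec j then (P + Q) / 2 else 0) + (if k = -unitVec j then (P - Q) / 2 else 0) with hc
  have hmem := mem_modFinset.2 (unitVec_mem_modSet S.hK j)
  have hmem' := mem_modFinset.2 (neg_unitVec_mem_modSet S.hK j)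
  have hsin0 : ∀ k ∈ modSet K j, modOp (τ * dotFreq ρ k) α h (C (c k)) = 0 := by
    intro k _
    by_cases h1 : k = unitVec j
    · refine modOp_C_eq_zero h ?_ _
      rw [h1, dotFreq_unitVec]
    · by_cases h2 : k = -unitVec j
      · refine modOp_C_eq_zero h ?_ _
        rw [h2, dotFreq_neg, dotFreq_unitVec, mul_neg, Real.cos_neg]
      · simp [hc, h1, h2]
  refine ⟨fun k => p k + C (c k), fun k => Submodule.add_mem _ (hp k) (C_mem_degreeLT _), ?_, ?_,
    ?_, ?_⟩
  · intro k hk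
    rw [map_add, hsin0 k hk, add_zero]
    exact (hp' k hk).1
  · simp only [Polynomial.eval_add, Polynomial.eval_C, Finset.sum_add_distrib, hc,
      Finset.sum_ite_eq', hmem, hmem', if_true]
    rw [hP]; ring
  · simp only [velTerm_add, velTerm_C, Finset.sum_add_distrib, hc, mul_add, mul_ite, mul_zero,
      Finset.sum_ite_eq', hmem, hmem', if_true]
    rw [dotFreq_neg, dotFreq_unitVec, ← hα, mul_neg, ← hα, Real.sin_neg]
    have hI := Complex.I_ne_zero
    have : 2 * (Real.sin α : ℂ) * Complex.I * Q = 2 * τ * (Real.sinc α : ℂ) * b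
        - ∑ k ∈ modFinset K j, velTerm (τ * dotFreq ρ k) h (p k) := by
      rw [hQ]; field_simp
    push_cast at this ⊢
    linear_combination this
  · intro W w hw hW1 hW2 hW
    set G := ∑ k ∈ modFinset K j, W k * lossFactor K ε ν j k * pnorm (g k) with hG
    have hterm : ∀ k ∈ modFinset K j, 0 ≤ lossFactor K ε ν j k * pnorm (g k) := fun k _ =>
      mul_nonneg (S.lossFactor_pos j k).le (pnorm_nonneg _)
    have hwG : w * ∑ k ∈ modFinset K j, lossFactor K ε ν j k * pnorm (g k) ≤ G := by
      rw [Finset.mul_sum]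
      refine Finset.sum_le_sum fun k hk => ?_
      rw [mul_assoc]
      exact mul_le_mul_of_nonneg_right (hW k (mem_modFinset.1 hk)) (hterm k hk)
    set G₀ := ∑ k ∈ modFinset K j, lossFactor K ε ν j k * pnorm (g k) with hG₀
    have hρs := Real.sqrt_pos.2 S.hρ
    have hPn : ‖P‖ ≤ ‖a‖ + A * G₀ := by
      rw [hP]
      refine (norm_sub_le _ _).trans (add_le_add le_rfl ((norm_sum_le _ _).trans ?_))
      rw [hG₀, Finset.mul_sum]
      refine Finset.sum_le_sum fun k hk => (norm_eval_le_pnorm _ (by simp)).trans ?_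
      have := (hp' k (mem_modFinset.1 hk)).2.1
      linarith
    have hQn : ‖Q‖ ≤ (1 / Real.sqrt ρ) * ‖b‖ + A * G₀ := by
      have hsp : 0 < |Real.sin α| := abs_pos.2 hs
      rw [hQ, norm_div, div_le_iff₀ (by simpa [-Complex.ofReal_sin] using hs)]
      have e1 : ‖(2 * (Real.sin α : ℂ) * Complex.I)‖ = 2 * |Real.sin α| := by
        simp [-Complex.ofReal_sin]
      have e2 : ‖2 * (τ : ℂ) * (Real.sinc α : ℂ) * b‖ ≤ (1 / Real.sqrt ρ) * ‖b‖ *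
          (2 * |Real.sin α|) := by
        rw [Real.sinc_of_ne_zero hα0.ne']
        simp only [norm_mul, Complex.norm_real, Real.norm_eq_abs, Complex.norm_ofNat, abs_div]
        rw [abs_of_pos S.hτ, abs_of_pos hα0]
        have hω := sqrt_le_freq (ρ := ρ) (absIdx j)
        have hω0 := freq_pos S.hρ (absIdx j)
        have hτ := S.hτ
        calc 2 * τ * (|Real.sin α| / α) * ‖b‖ = 1 / freq ρ (absIdx j) * ‖b‖ * (2 * |Real.sin α|) := by
              rw [hα]; field_simp
          _ ≤ _ := by gcongr
      have e3 : ‖∑ k ∈ modFinset K j, velTerm (τ * dotFreq ρ k) h (p k)‖ ≤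
          A * G₀ * (2 * |Real.sin α|) := by
        refine (norm_sum_le _ _).trans ?_
        have hle : ∑ k ∈ modFinset K j, ‖velTerm (τ * dotFreq ρ k) h (p k)‖ ≤
            A * G₀ * |Real.sin α| := by
          rw [hG₀, Finset.mul_sum, Finset.sum_mul]
          refine Finset.sum_le_sum fun k hk => ?_
          have := (hp' k (mem_modFinset.1 hk)).2.2
          linarith
        have : 0 ≤ A * G₀ * |Real.sin α| :=
          mul_nonneg (mul_nonneg hA (Finset.sum_nonneg hterm)) (abs_nonneg _)
        linarith
      rw [e1]
      refine (norm_sub_le _ _).trans ?_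
      linarith
    have hcn : ∀ k, ‖c k‖ ≤ (if k = unitVec j then (‖P‖ + ‖Q‖) / 2 else 0)
        + (if k = -unitVec j then (‖P‖ + ‖Q‖) / 2 else 0) := by
      intro k
      refine (norm_add_le _ _).trans (add_le_add ?_ ?_)
      · split_ifs
        · rw [norm_div, Complex.norm_ofNat]; have := norm_add_le P Q; linarith
        · simp
      · split_ifs
        · rw [norm_div, Complex.norm_ofNat]; have := norm_sub_le P Q; linarith
        · simp
    have hW0 : ∀ k ∈ modFinset K j, 0 ≤ W k := fun k hk => hw.trans (hW k (mem_modFinset.1 hk))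
    have hsum1 : ∑ k ∈ modFinset K j, W k * pnorm (p k) ≤ A * G := by
      rw [hG, Finset.mul_sum]
      refine Finset.sum_le_sum fun k hk => ?_
      have := mul_le_mul_of_nonneg_left (hp' k (mem_modFinset.1 hk)).2.1 (hW0 k hk)
      linarith
    have hsum2 : ∑ k ∈ modFinset K j, W k * ‖c k‖ ≤ w * (‖P‖ + ‖Q‖) := by
      refine (Finset.sum_le_sum fun k hk => mul_le_mul_of_nonneg_left (hcn k) (hW0 k hk)).trans ?_
      simp only [mul_add, mul_ite, mul_zero, Finset.sum_add_distrib, Finset.sum_ite_eq', hmem, hmem',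
        if_true, hW1, hW2]
      linarith
    have hfin : ∑ k ∈ modFinset K j, W k * pnorm (p k + C (c k)) ≤ A * G + w * (‖P‖ + ‖Q‖) := by
      refine le_trans ?_ (add_le_add hsum1 hsum2)
      rw [← Finset.sum_add_distrib]
      refine Finset.sum_le_sum fun k hk => ?_
      rw [← mul_add]
      refine mul_le_mul_of_nonneg_left ((pnorm_add_le _ _).trans ?_) (hW0 k hk)
      rw [pnorm_C]
    have h1 : w * (‖P‖ + ‖Q‖) ≤ w * ((‖a‖ + A * G₀) + ((1 / Real.sqrt ρ) * ‖b‖ + A * G₀)) :=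
      mul_le_mul_of_nonneg_left (add_le_add hPn hQn) hw
    have h2 : A * (w * G₀) ≤ A * G := mul_le_mul_of_nonneg_left hwG hA
    have hG0 : 0 ≤ G := le_trans (mul_nonneg hw (Finset.sum_nonneg hterm)) hwG
    have hwa : 0 ≤ w * ‖a‖ := mul_nonneg hw (norm_nonneg _)
    have hwb : 0 ≤ w * ‖b‖ := mul_nonneg hw (norm_nonneg _)
    have hr : 0 ≤ 1 / Real.sqrt ρ := by positivity
    have e : (2 : ℝ) / Real.sqrt ρ = 2 * (1 / Real.sqrt ρ) := by ring
    rw [e]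
    set r := 1 / Real.sqrt ρ
    have t1 := mul_nonneg hA hwa
    have t2 := mul_nonneg hA hwb
    have t3 := mul_nonneg hr hwa
    have t4 := mul_nonneg hr hwb
    have t5 := mul_nonneg hr hG0
    nlinarith

/-! ### Conjugation symmetry and the full linear system -/

theorem map_conj_modOp (θ α h : ℝ) (p : ℂ[X]) :
    (modOp θ α h p).map (starRingEnd ℂ) = modOp (-θ) α h (p.map (starRingEnd ℂ)) := by
  have h1 : (starRingEnd ℂ) (Complex.exp (θ * Complex.I)) = Complex.exp (-θ * Complex.I) := by
    rw [← Complex.exp_conj]; simp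
  have h2 : (starRingEnd ℂ) (Complex.exp (-θ * Complex.I)) = Complex.exp (θ * Complex.I) := by
    rw [← Complex.exp_conj]; simp
  simp only [modOp_apply, Polynomial.map_add, Polynomial.map_sub, Polynomial.map_smul, h1, h2,
    Polynomial.taylor_apply, Polynomial.map_comp, Polynomial.map_X, Polynomial.map_C, Polynomial.map_neg, map_neg,
    map_mul, Complex.conj_ofReal, Complex.ofReal_neg, neg_neg, map_ofNat]

theorem eval_map_conj_ofReal (p : ℂ[X]) (x : ℝ) :
    (p.map (starRingEnd ℂ)).eval (x : ℂ) = starRingEnd ℂ (p.eval (x : ℂ)) := by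
  rw [Polynomial.eval_map, ← Polynomial.eval₂_at_apply, Complex.conj_ofReal]

theorem conj_velTerm (θ h : ℝ) (p : ℂ[X]) :
    starRingEnd ℂ (velTerm θ h p) = velTerm (-θ) h (p.map (starRingEnd ℂ)) := by
  have h1 : (starRingEnd ℂ) (Complex.exp (θ * Complex.I)) = Complex.exp (-θ * Complex.I) := by
    rw [← Complex.exp_conj]; simp
  have h2 : (starRingEnd ℂ) (Complex.exp (-θ * Complex.I)) = Complex.exp (θ * Complex.I) := by
    rw [← Complex.exp_conj]; simp
  have e2 := eval_map_conj_ofReal p (-h)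
  rw [Complex.ofReal_neg] at e2
  simp only [velTerm, map_sub, map_mul, h1, h2, eval_map_conj_ofReal, e2, Complex.ofReal_neg,
    neg_neg]

theorem velTerm_smul (θ h : ℝ) (c : ℂ) (p : ℂ[X]) :
    velTerm θ h (c • p) = c * velTerm θ h p := by
  simp only [velTerm, Polynomial.eval_smul, smul_eq_mul]; ring

theorem lossFactor_neg {K M : ℕ} (ε ν : ℝ) (j : ZMod (2 * M)) (k : Fin (M + 1) → ℤ) :
    lossFactor K ε ν (-j) (-k) = lossFactor K ε ν j k := by
  have : (absIdx (-j) ≤ K ∧ -k ≠ unitVec (-j) ∧ -k ≠ -unitVec (-j)) ↔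
      (absIdx j ≤ K ∧ k ≠ unitVec j ∧ k ≠ -unitVec j) := by
    rw [absIdx_neg, unitVec_neg, Ne, Ne, neg_inj, neg_eq_iff_eq_neg]
    tauto
  simp only [lossFactor, lossExp, this]

/-- A family of polynomials is conjugation symmetric on the index set. -/
def IsRealFamily (K : ℕ) {M : ℕ} (z : ZMod (2 * M) → (Fin (M + 1) → ℤ) → ℂ[X]) : Prop :=
  ∀ j, ∀ k ∈ modSet K j, z (-j) (-k) = (z j k).map (starRingEnd ℂ)

/-- Solution of the linear modulation system with prescribed right-hand side and initial values,
preserving conjugation symmetry. -/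
theorem exists_linear_solution (K : ℕ) (ρ ν γ B : ℝ) (N : ℕ) :
    ∃ A : ℝ, 0 ≤ A ∧ ∀ (M : ℕ) [NeZero M] (τ ε : ℝ) (ψ φ : ℝ → ℝ),
      NumSetup K M ρ τ ε ν γ B ψ φ → ∀ (g : ZMod (2 * M) → (Fin (M + 1) → ℤ) → ℂ[X]),
      (∀ j, ∀ k ∈ modSet K j, g j k ∈ degreeLT ℂ N) → IsRealFamily K g →
      ∀ a b : ZMod (2 * M) → ℂ, IsRealData a → IsRealData b →
      ∃ z : ZMod (2 * M) → (Fin (M + 1) → ℤ) → ℂ[X],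
        (∀ j k, z j k ∈ degreeLT ℂ (N + 1)) ∧ IsRealFamily K z ∧
        (∀ j, ∀ k ∈ modSet K j,
          modOp (τ * dotFreq ρ k) (τ * freq ρ (absIdx j)) (ε ^ (ν / 2) * τ) (z j k)
            = ((τ ^ 2 * ψ (τ * freq ρ (absIdx j)) : ℝ) : ℂ) • g j k) ∧
        (∀ j, ∑ k ∈ modFinset K j, (z j k).eval 0 = a j) ∧
        (∀ j, ∑ k ∈ modFinset K j, velTerm (τ * dotFreq ρ k) (ε ^ (ν / 2) * τ) (z j k)
          = 2 * τ * (Real.sinc (τ * freq ρ (absIdx j)) : ℂ) * b j) ∧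
        ∀ (W : ZMod (2 * M) → (Fin (M + 1) → ℤ) → ℝ) (w : ZMod (2 * M) → ℝ), (∀ j, 0 ≤ w j) →
          (∀ j, W j (unitVec j) = w j) → (∀ j, W j (-unitVec j) = w j) →
          (∀ j, ∀ k ∈ modSet K j, w j ≤ W j k) → (∀ j k, W (-j) (-k) = W j k) →
          (∀ j, w (-j) = w j) →
          ∀ j, ∑ k ∈ modFinset K j, W j k * pnorm (z j k) ≤
            A * (w j * (‖a j‖ + ‖b j‖)
              + ∑ k ∈ modFinset K j, W j k * lossFactor K ε ν j k * pnorm (g j k)) := by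
  obtain ⟨A, hA, H⟩ := exists_mode_solution K ρ ν γ B N
  refine ⟨A, hA, ?_⟩
  intro M _ τ ε ψ φ S g hg hgr a b ha hb
  choose z hz hL hinit hvel hbound using fun j => H M τ ε ψ φ S j (g j) (hg j) (a j) (b j)
  have hK := S.hK
  have hmapsmul : ∀ (p : ℂ[X]), ((1 / 2 : ℂ) • p).map (starRingEnd ℂ)
      = (1 / 2 : ℂ) • p.map (starRingEnd ℂ) := by
    intro p
    rw [Polynomial.map_smul, show (1 / 2 : ℂ) = ((1 / 2 : ℝ) : ℂ) by norm_num, Complex.conj_ofReal]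
  have hmm : ∀ p : ℂ[X], (p.map (starRingEnd ℂ)).map (starRingEnd ℂ) = p := by
    intro p; ext i; simp
  -- The system is linear and its data are symmetric, so reflecting and conjugating a solution gives
  -- another one. Their average is a solution with the symmetry.
  refine ⟨fun j k => (1 / 2 : ℂ) • (z j k + (z (-j) (-k)).map (starRingEnd ℂ)), ?_, ?_, ?_, ?_, ?_,
    ?_⟩
  · exact fun j k => Submodule.smul_mem _ _
      (Submodule.add_mem _ (hz j k) (map_conj_mem_degreeLT (hz _ _)))
  · intro j k _
    dsimp only
    rw [hmapsmul, Polynomial.map_add, hmm, neg_neg, neg_neg, add_comm]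
  · intro j k hk
    have h1 := hL j k hk
    have h2 := congrArg (Polynomial.map (starRingEnd ℂ)) (hL (-j) (-k) (neg_mem_modSet hK hk))
    rw [map_conj_modOp, Polynomial.map_smul, ← hgr (-j) (-k) (neg_mem_modSet hK hk), neg_neg,
      neg_neg, Complex.conj_ofReal, absIdx_neg, dotFreq_neg, mul_neg, neg_neg] at h2
    rw [map_smul, map_add, h1, h2]
    module
  · intro j
    have h2 := congrArg (starRingEnd ℂ) (hinit (-j))
    rw [sum_modFinset_neg hK, map_sum, ha, Complex.conj_conj] at h2
    have h3 : ∀ k, (starRingEnd ℂ) ((z (-j) (-k)).eval 0)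
        = ((z (-j) (-k)).map (starRingEnd ℂ)).eval 0 := fun k => by
      have := eval_map_conj_ofReal (z (-j) (-k)) 0
      rw [Complex.ofReal_zero] at this
      exact this.symm
    simp only [h3] at h2
    simp only [Polynomial.eval_smul, Polynomial.eval_add, smul_eq_mul]
    rw [← Finset.mul_sum, Finset.sum_add_distrib, hinit, h2]
    ring
  · intro j
    have h2 := congrArg (starRingEnd ℂ) (hvel (-j))
    rw [sum_modFinset_neg hK, map_sum] at h2
    simp only [conj_velTerm, dotFreq_neg, mul_neg, neg_neg, map_mul, Complex.conj_ofReal, hb j,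
      Complex.conj_conj, absIdx_neg, map_ofNat] at h2
    simp only [velTerm_smul, velTerm_add]
    rw [← Finset.mul_sum, Finset.sum_add_distrib, hvel, h2]
    ring
  · intro W w hw hW1 hW2 hW hWs hws j
    have h1 := hbound j (W j) (w j) (hw j) (hW1 j) (hW2 j) (hW j)
    have h2 := hbound (-j) (W (-j)) (w (-j)) (hw _) (hW1 _) (hW2 _) (hW _)
    rw [sum_modFinset_neg hK, sum_modFinset_neg hK, ha, hb, RCLike.norm_conj, RCLike.norm_conj,
      hws] at h2
    have e : ∑ k ∈ modFinset K j, W (-j) (-k) * lossFactor K ε ν (-j) (-k) * pnorm (g (-j) (-k))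
        = ∑ k ∈ modFinset K j, W j k * lossFactor K ε ν j k * pnorm (g j k) := by
      refine Finset.sum_congr rfl fun k hk => ?_
      rw [hWs, lossFactor_neg, hgr j k (mem_modFinset.1 hk), pnorm_map_conj]
    rw [e] at h2
    simp only [hWs] at h2
    have h3 : ∑ k ∈ modFinset K j, W j k * pnorm
        ((1 / 2 : ℂ) • (z j k + (z (-j) (-k)).map (starRingEnd ℂ))) ≤
        1 / 2 * (∑ k ∈ modFinset K j, W j k * pnorm (z j k)
          + ∑ k ∈ modFinset K j, W j k * pnorm (z (-j) (-k))) := by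
      rw [← Finset.sum_add_distrib, Finset.mul_sum]
      refine Finset.sum_le_sum fun k hk => ?_
      have hW0 : 0 ≤ W j k := (hw j).trans (hW j k (mem_modFinset.1 hk))
      rw [pnorm_smul]
      have := (pnorm_add_le (z j k) ((z (-j) (-k)).map (starRingEnd ℂ)))
      rw [pnorm_map_conj] at this
      have := mul_le_mul_of_nonneg_left this hW0
      have e : ‖(1 / 2 : ℂ)‖ = 1 / 2 := by simp
      rw [e]
      linarith
    linarith

/-! ### Products of modulated families -/

section ModConv
variable {K M : ℕ} [NeZero M]

/-- The coefficients `∑_{j₁+j₂=j} ∑_{k₁+k₂=k} Y_{j₁}^{k₁} Z_{j₂}^{k₂}` of the product of two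
modulated expansions. -/
noncomputable def modConv (K : ℕ) {M : ℕ} [NeZero M] {R : Type*} [CommRing R]
    (Y Z : ZMod (2 * M) → (Fin (M + 1) → ℤ) → R) (j : ZMod (2 * M)) (k : Fin (M + 1) → ℤ) : R :=
  ∑ j₁ : ZMod (2 * M), ∑ k₁ ∈ modFinset K j₁, ∑ k₂ ∈ modFinset K (j - j₁),
    if k₁ + k₂ = k then Y j₁ k₁ * Z (j - j₁) k₂ else 0

theorem modConv_self_sub {R : Type*} [CommRing R] (Y Z : ZMod (2 * M) → (Fin (M + 1) → ℤ) → R)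
    (j : ZMod (2 * M)) (k : Fin (M + 1) → ℤ) :
    modConv K Y Y j k - modConv K Z Z j k =
      modConv K Y (fun j k => Y j k - Z j k) j k + modConv K (fun j k => Y j k - Z j k) Z j k := by
  unfold modConv
  simp only [← Finset.sum_sub_distrib, ← Finset.sum_add_distrib]
  refine Finset.sum_congr rfl fun j₁ _ => Finset.sum_congr rfl fun k₁ _ =>
    Finset.sum_congr rfl fun k₂ _ => ?_
  split_ifs <;> ring

theorem map_modConv {R R' : Type*} [CommRing R] [CommRing R'] (f : R →+* R')
    (Y Z : ZMod (2 * M) → (Fin (M + 1) → ℤ) → R) (j : ZMod (2 * M)) (k : Fin (M + 1) → ℤ) :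
    f (modConv K Y Z j k) = modConv K (fun j k => f (Y j k)) (fun j k => f (Z j k)) j k := by
  unfold modConv
  simp only [map_sum]
  refine Finset.sum_congr rfl fun j₁ _ => Finset.sum_congr rfl fun k₁ _ =>
    Finset.sum_congr rfl fun k₂ _ => ?_
  split_ifs <;> simp

theorem IsRealFamily.modConv (hK : 3 ≤ K) {Y Z : ZMod (2 * M) → (Fin (M + 1) → ℤ) → ℂ[X]}
    (hY : IsRealFamily K Y) (hZ : IsRealFamily K Z) : IsRealFamily K (modConv K Y Z) := by
  intro j k _
  rw [← Polynomial.coe_mapRingHom, map_modConv]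
  unfold _root_.modConv
  rw [← Equiv.sum_comp (Equiv.neg (ZMod (2 * M)))]
  refine Finset.sum_congr rfl fun j₁ _ => ?_
  rw [Equiv.neg_apply, sum_modFinset_neg hK]
  refine Finset.sum_congr rfl fun k₁ hk₁ => ?_
  rw [show -j - -j₁ = -(j - j₁) by ring, sum_modFinset_neg hK]
  refine Finset.sum_congr rfl fun k₂ hk₂ => ?_
  have e : (-k₁ + -k₂ = -k) ↔ (k₁ + k₂ = k) := by
    rw [← neg_add, neg_inj]
  simp only [e, hY _ _ (mem_modFinset.1 hk₁), hZ _ _ (mem_modFinset.1 hk₂),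
    Polynomial.coe_mapRingHom]

theorem modConv_mem_degreeLT {m n : ℕ} {Y Z : ZMod (2 * M) → (Fin (M + 1) → ℤ) → ℂ[X]}
    (hY : ∀ j k, Y j k ∈ degreeLT ℂ m) (hZ : ∀ j k, Z j k ∈ degreeLT ℂ n)
    (j : ZMod (2 * M)) (k : Fin (M + 1) → ℤ) : modConv K Y Z j k ∈ degreeLT ℂ (m + n) := by
  refine Submodule.sum_mem _ fun j₁ _ => Submodule.sum_mem _ fun k₁ _ =>
    Submodule.sum_mem _ fun k₂ _ => ?_
  split_ifs
  · exact mul_mem_degreeLT (hY _ _) (hZ _ _)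
  · exact Submodule.zero_mem _

/-- The weighted sum `∑_{k ∈ 𝒦_j} W_j^k ‖Y_j^k‖`. -/
noncomputable def modSum (K : ℕ) {M : ℕ} (W : ZMod (2 * M) → (Fin (M + 1) → ℤ) → ℝ)
    (Y : ZMod (2 * M) → (Fin (M + 1) → ℤ) → ℂ[X]) (j : ZMod (2 * M)) : ℝ :=
  ∑ k ∈ modFinset K j, W j k * pnorm (Y j k)

/-- A submultiplicative weight passes through the convolution in `k`, leaving a scalar convolution
in `j` to which the Sobolev algebra bound applies. -/
theorem modSum_modConv_le {V W₁ W₂ : ZMod (2 * M) → (Fin (M + 1) → ℤ) → ℝ}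
    (hV : ∀ j k, 0 ≤ V j k)
    (h : ∀ j₁ j₂ : ZMod (2 * M), ∀ k₁ ∈ modSet K j₁, ∀ k₂ ∈ modSet K j₂,
      k₁ + k₂ ∈ modSet K (j₁ + j₂) → V (j₁ + j₂) (k₁ + k₂) ≤ W₁ j₁ k₁ * W₂ j₂ k₂)
    (hW₁ : ∀ j k, 0 ≤ W₁ j k) (hW₂ : ∀ j k, 0 ≤ W₂ j k)
    (Y Z : ZMod (2 * M) → (Fin (M + 1) → ℤ) → ℂ[X]) (j : ZMod (2 * M)) :
    modSum K V (modConv K Y Z) j ≤ rconv (modSum K W₁ Y) (modSum K W₂ Z) j := by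
  classical
  unfold modSum rconv
  have h1 : ∀ k ∈ modFinset K j, V j k * pnorm (modConv K Y Z j k) ≤
      ∑ j₁ : ZMod (2 * M), ∑ k₁ ∈ modFinset K j₁, ∑ k₂ ∈ modFinset K (j - j₁),
        if k = k₁ + k₂ then (W₁ j₁ k₁ * pnorm (Y j₁ k₁)) * (W₂ (j - j₁) k₂ * pnorm (Z (j - j₁) k₂))
          else 0 := by
    intro k hk
    refine (mul_le_mul_of_nonneg_left (pnorm_sum_le _ _) (hV j k)).trans ?_
    rw [Finset.mul_sum]
    refine Finset.sum_le_sum fun j₁ _ => ?_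
    refine (mul_le_mul_of_nonneg_left (pnorm_sum_le _ _) (hV j k)).trans ?_
    rw [Finset.mul_sum]
    refine Finset.sum_le_sum fun k₁ hk₁ => ?_
    refine (mul_le_mul_of_nonneg_left (pnorm_sum_le _ _) (hV j k)).trans ?_
    rw [Finset.mul_sum]
    refine Finset.sum_le_sum fun k₂ hk₂ => ?_
    by_cases hkk : k = k₁ + k₂
    · rw [if_pos hkk, if_pos hkk.symm]
      have h2 := h j₁ (j - j₁) k₁ (mem_modFinset.1 hk₁) k₂ (mem_modFinset.1 hk₂)
      rw [add_sub_cancel, ← hkk] at h2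
      have h3 := h2 (mem_modFinset.1 hk)
      have p1 := pnorm_nonneg (Y j₁ k₁)
      have p2 := pnorm_nonneg (Z (j - j₁) k₂)
      calc V j k * pnorm (Y j₁ k₁ * Z (j - j₁) k₂)
          ≤ V j k * (pnorm (Y j₁ k₁) * pnorm (Z (j - j₁) k₂)) :=
            mul_le_mul_of_nonneg_left (pnorm_mul_le _ _) (hV j k)
        _ ≤ (W₁ j₁ k₁ * W₂ (j - j₁) k₂) * (pnorm (Y j₁ k₁) * pnorm (Z (j - j₁) k₂)) :=
            mul_le_mul_of_nonneg_right h3 (mul_nonneg p1 p2)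
        _ = _ := by ring
    · rw [if_neg hkk, if_neg (fun h => hkk h.symm)]; simp
  refine (Finset.sum_le_sum h1).trans ?_
  rw [Finset.sum_comm]
  refine Finset.sum_le_sum fun j₁ _ => ?_
  rw [Finset.sum_comm, Finset.sum_mul]
  refine Finset.sum_le_sum fun k₁ _ => ?_
  rw [Finset.sum_comm, Finset.mul_sum]
  refine Finset.sum_le_sum fun k₂ _ => ?_
  rw [Finset.sum_ite_eq']
  split_ifs
  · exact le_rfl
  · exact mul_nonneg (mul_nonneg (hW₁ _ _) (pnorm_nonneg _)) (mul_nonneg (hW₂ _ _) (pnorm_nonneg _))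

/-- The part of the product of two modulated expansions with indices outside the index set. -/
noncomputable def truncTerm (K : ℕ) {M : ℕ} [NeZero M]
    (Y Z : ZMod (2 * M) → (Fin (M + 1) → ℤ) → ℂ) (j : ZMod (2 * M)) : ℂ :=
  open Classical in
  ∑ j₁ : ZMod (2 * M), ∑ k₁ ∈ modFinset K j₁, ∑ k₂ ∈ modFinset K (j - j₁),
    if k₁ + k₂ ∈ modFinset K j then 0 else Y j₁ k₁ * Z (j - j₁) k₂

/-- Sorts the product of two expansions by the frequency `k₁ + k₂`, separating those that belong to
`𝒦_j` from those that do not. -/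
theorem sum_mul_sum_eq_modConv_add_truncTerm (Y Z : ZMod (2 * M) → (Fin (M + 1) → ℤ) → ℂ)
    (j : ZMod (2 * M)) :
    ∑ j₁ : ZMod (2 * M), (∑ k₁ ∈ modFinset K j₁, Y j₁ k₁) * (∑ k₂ ∈ modFinset K (j - j₁), Z (j - j₁) k₂)
      = ∑ k ∈ modFinset K j, modConv K Y Z j k + truncTerm K Y Z j := by
  classical
  unfold modConv truncTerm
  rw [Finset.sum_comm, ← Finset.sum_add_distrib]
  refine Finset.sum_congr rfl fun j₁ _ => ?_
  rw [Finset.sum_comm, ← Finset.sum_add_distrib, Finset.sum_mul]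
  refine Finset.sum_congr rfl fun k₁ _ => ?_
  rw [Finset.sum_comm, ← Finset.sum_add_distrib, Finset.mul_sum]
  refine Finset.sum_congr rfl fun k₂ _ => ?_
  rw [Finset.sum_ite_eq]
  split_ifs <;> simp

theorem norm_truncTerm_le {W : ZMod (2 * M) → (Fin (M + 1) → ℤ) → ℝ} {c : ℝ} (hc : 0 ≤ c)
    (h : ∀ j₁ j₂ : ZMod (2 * M), ∀ k₁ ∈ modSet K j₁, ∀ k₂ ∈ modSet K j₂,
      k₁ + k₂ ∉ modSet K (j₁ + j₂) → 1 ≤ c * (W j₁ k₁ * W j₂ k₂))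
    (hW : ∀ j k, 0 ≤ W j k)
    {Y : ZMod (2 * M) → (Fin (M + 1) → ℤ) → ℂ} {P : ZMod (2 * M) → (Fin (M + 1) → ℤ) → ℂ[X]}
    (hY : ∀ j k, ‖Y j k‖ ≤ pnorm (P j k)) (j : ZMod (2 * M)) :
    ‖truncTerm K Y Y j‖ ≤ c * rconv (modSum K W P) (modSum K W P) j := by
  classical
  unfold truncTerm rconv modSum
  rw [Finset.mul_sum]
  refine (norm_sum_le _ _).trans (Finset.sum_le_sum fun j₁ _ => ?_)
  rw [Finset.sum_mul, Finset.mul_sum]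
  refine (norm_sum_le _ _).trans (Finset.sum_le_sum fun k₁ hk₁ => ?_)
  rw [Finset.mul_sum, Finset.mul_sum]
  refine (norm_sum_le _ _).trans (Finset.sum_le_sum fun k₂ hk₂ => ?_)
  have p1 := pnorm_nonneg (P j₁ k₁)
  have p2 := pnorm_nonneg (P (j - j₁) k₂)
  have w1 := hW j₁ k₁
  have w2 := hW (j - j₁) k₂
  split_ifs with hkk
  · rw [norm_zero]; positivity
  · have h2 := h j₁ (j - j₁) k₁ (mem_modFinset.1 hk₁) k₂ (mem_modFinset.1 hk₂)
    rw [add_sub_cancel] at h2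
    have h3 := h2 (fun h => hkk (mem_modFinset.2 h))
    rw [norm_mul]
    calc ‖Y j₁ k₁‖ * ‖Y (j - j₁) k₂‖ ≤ 1 * (pnorm (P j₁ k₁) * pnorm (P (j - j₁) k₂)) := by
          rw [one_mul]; exact mul_le_mul (hY _ _) (hY _ _) (norm_nonneg _) p1
      _ ≤ (c * (W j₁ k₁ * W (j - j₁) k₂)) * (pnorm (P j₁ k₁) * pnorm (P (j - j₁) k₂)) :=
          mul_le_mul_of_nonneg_right h3 (mul_nonneg p1 p2)
      _ = _ := by ring

theorem phase_add_idx {M : ℕ} (ρ : ℝ) (k₁ k₂ : Fin (M + 1) → ℤ) (t : ℝ) :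
    phase ρ (k₁ + k₂) t = phase ρ k₁ t * phase ρ k₂ t := by
  unfold phase
  rw [← Complex.exp_add, dotFreq_add]
  congr 1; push_cast; ring

/-- Phases are multiplicative in `k`, so they factor out of all terms with a common `k₁ + k₂`. This
is what permits comparing coefficients. -/
theorem modConv_mul_phase (ρ t : ℝ) (Y Z : ZMod (2 * M) → (Fin (M + 1) → ℤ) → ℂ)
    (j : ZMod (2 * M)) (k : Fin (M + 1) → ℤ) :
    modConv K (fun j k => Y j k * phase ρ k t) (fun j k => Z j k * phase ρ k t) j k
      = modConv K Y Z j k * phase ρ k t := by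
  unfold modConv
  simp only [Finset.sum_mul]
  refine Finset.sum_congr rfl fun j₁ _ => Finset.sum_congr rfl fun k₁ _ =>
    Finset.sum_congr rfl fun k₂ _ => ?_
  split_ifs with h
  · rw [← h, phase_add_idx]; ring
  · simp

/-! ### The gradient of the extended potential -/

/-- The symmetric trilinear form underlying the extended potential. -/
noncomputable def triForm (K : ℕ) {M : ℕ} [NeZero M]
    (f g h : ZMod (2 * M) → (Fin (M + 1) → ℤ) → ℂ) : ℂ :=
  ∑ j₁ : ZMod (2 * M), ∑ j₂ : ZMod (2 * M), ∑ j₃ : ZMod (2 * M),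
    ∑ k₁ ∈ modFinset K j₁, ∑ k₂ ∈ modFinset K j₂, ∑ k₃ ∈ modFinset K j₃,
      if j₁ + j₂ + j₃ = 0 ∧ k₁ + k₂ + k₃ = 0 then f j₁ k₁ * g j₂ k₂ * h j₃ k₃ else 0

theorem triForm_swap_left (f g h : ZMod (2 * M) → (Fin (M + 1) → ℤ) → ℂ) :
    triForm K f g h = triForm K g f h := by
  unfold triForm
  rw [Finset.sum_comm]
  refine Finset.sum_congr rfl fun j₁ _ => Finset.sum_congr rfl fun j₂ _ =>
    Finset.sum_congr rfl fun j₃ _ => ?_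
  rw [Finset.sum_comm]
  refine Finset.sum_congr rfl fun k₁ _ => Finset.sum_congr rfl fun k₂ _ =>
    Finset.sum_congr rfl fun k₃ _ => ?_
  rw [add_comm j₂ j₁, add_comm k₂ k₁, mul_comm (f j₂ k₂)]

theorem triForm_swap_right (f g h : ZMod (2 * M) → (Fin (M + 1) → ℤ) → ℂ) :
    triForm K f g h = triForm K f h g := by
  unfold triForm
  refine Finset.sum_congr rfl fun j₁ _ => ?_
  rw [Finset.sum_comm]
  refine Finset.sum_congr rfl fun j₂ _ => Finset.sum_congr rfl fun j₃ _ =>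
    Finset.sum_congr rfl fun k₁ _ => ?_
  rw [Finset.sum_comm]
  refine Finset.sum_congr rfl fun k₂ _ => Finset.sum_congr rfl fun k₃ _ => ?_
  rw [add_right_comm j₁ j₃ j₂, add_right_comm k₁ k₃ k₂, mul_right_comm]

theorem triForm_indicator {j : ZMod (2 * M)} {k : Fin (M + 1) → ℤ} (hk : -k ∈ modSet K (-j))
    (g h : ZMod (2 * M) → (Fin (M + 1) → ℤ) → ℂ) :
    triForm K (fun j' k' => if j' = -j ∧ k' = -k then 1 else 0) g h = modConv K g h j k := by
  unfold triForm modConv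
  rw [Finset.sum_eq_single (-j)]
  · refine Finset.sum_congr rfl fun j₂ _ => ?_
    rw [Finset.sum_eq_single (j - j₂)]
    · rw [Finset.sum_eq_single (-k)]
      · refine Finset.sum_congr rfl fun k₂ _ => Finset.sum_congr rfl fun k₃ _ => ?_
        have e : (-j + j₂ + (j - j₂) = 0 ∧ -k + k₂ + k₃ = 0) ↔ (k₂ + k₃ = k) := by
          rw [add_assoc (-k), neg_add_eq_zero, eq_comm (a := k)]
          constructor
          · exact fun h => h.2
          · exact fun h => ⟨by ring, h⟩
        simp only [e]
        simp
      · intro k₁ _ hk₁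
        refine Finset.sum_eq_zero fun k₂ _ => Finset.sum_eq_zero fun k₃ _ => ?_
        simp [hk₁]
      · intro h; exact absurd (mem_modFinset.2 hk) h
    · intro j₃ _ hj₃
      refine Finset.sum_eq_zero fun k₁ _ => Finset.sum_eq_zero fun k₂ _ =>
        Finset.sum_eq_zero fun k₃ _ => if_neg fun h => hj₃ ?_
      linear_combination h.1
    · simp
  · intro j₁ _ hj₁
    refine Finset.sum_eq_zero fun j₂ _ => Finset.sum_eq_zero fun j₃ _ =>
      Finset.sum_eq_zero fun k₁ _ => Finset.sum_eq_zero fun k₂ _ =>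
        Finset.sum_eq_zero fun k₃ _ => ?_
    simp [hj₁]
  · simp

/-- `𝒰` is `-1/3` times a symmetric cubic form. The product rule gives three equal terms, each with
the indicator of `(-j,-k)` in one slot, which collapses the form to the convolution at `(j,k)`. -/
theorem gradPotential_neg (hK : 3 ≤ K) {j : ZMod (2 * M)} {k : Fin (M + 1) → ℤ}
    (hk : k ∈ modSet K j) (y : ZMod (2 * M) → (Fin (M + 1) → ℤ) → ℂ) :
    gradPotential K (-j) (-k) y = -modConv K y y j k := by
  unfold gradPotential
  refine HasDerivAt.deriv ?_
  set w₀ := y (-j) (-k) with hw₀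
  set E : ℂ → ZMod (2 * M) → (Fin (M + 1) → ℤ) → ℂ := fun w =>
    Function.update y (-j) (Function.update (y (-j)) (-k) w) with hE
  set ι : ZMod (2 * M) → (Fin (M + 1) → ℤ) → ℂ := fun j' k' =>
    if j' = -j ∧ k' = -k then 1 else 0 with hι
  have hEy : E w₀ = y := by simp [hE, hw₀]
  have hder : ∀ j' k', HasDerivAt (fun w => E w j' k') (ι j' k') w₀ := by
    intro j' k'
    by_cases h1 : j' = -j
    · subst h1
      by_cases h2 : k' = -k
      · subst h2
        simpa [hE, hι] using hasDerivAt_id' w₀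
      · simpa [hE, hι, h2] using hasDerivAt_const w₀ (y (-j) k')
    · simpa [hE, hι, h1] using hasDerivAt_const w₀ (y j' k')
  have hmain : HasDerivAt (fun w => triForm K (E w) (E w) (E w))
      (triForm K ι y y + triForm K y ι y + triForm K y y ι) w₀ := by
    have : triForm K ι y y + triForm K y ι y + triForm K y y ι =
        ∑ j₁ : ZMod (2 * M), ∑ j₂ : ZMod (2 * M), ∑ j₃ : ZMod (2 * M),
        ∑ k₁ ∈ modFinset K j₁, ∑ k₂ ∈ modFinset K j₂, ∑ k₃ ∈ modFinset K j₃,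
        if j₁ + j₂ + j₃ = 0 ∧ k₁ + k₂ + k₃ = 0 then
          (ι j₁ k₁ * y j₂ k₂ + y j₁ k₁ * ι j₂ k₂) * y j₃ k₃ + y j₁ k₁ * y j₂ k₂ * ι j₃ k₃
        else 0 := by
      unfold triForm
      simp only [← Finset.sum_add_distrib]
      refine Finset.sum_congr rfl fun j₁ _ => Finset.sum_congr rfl fun j₂ _ =>
        Finset.sum_congr rfl fun j₃ _ => Finset.sum_congr rfl fun k₁ _ =>
        Finset.sum_congr rfl fun k₂ _ => Finset.sum_congr rfl fun k₃ _ => ?_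
      split_ifs
      · ring
      · simp
    rw [this]
    unfold triForm
    refine HasDerivAt.fun_sum fun j₁ _ => HasDerivAt.fun_sum fun j₂ _ =>
      HasDerivAt.fun_sum fun j₃ _ => HasDerivAt.fun_sum fun k₁ _ =>
      HasDerivAt.fun_sum fun k₂ _ => HasDerivAt.fun_sum fun k₃ _ => ?_
    split_ifs
    · have := ((hder j₁ k₁).fun_mul (hder j₂ k₂)).fun_mul (hder j₃ k₃)
      simpa only [hEy] using this
    · exact hasDerivAt_const _ _
  have hk' := neg_mem_modSet hK hk
  have h1 := triForm_indicator hk' y y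
  rw [triForm_swap_left y ι y, triForm_swap_right y y ι, triForm_swap_left y ι y, h1] at hmain
  have h3 := hmain.const_mul (-(1 / 3 : ℂ))
  have e : -(1 / 3 : ℂ) * (modConv K y y j k + modConv K y y j k + modConv K y y j k)
      = -modConv K y y j k := by ring
  rw [e] at h3
  exact h3

end ModConv

/-! ### Construction of the modulation functions by iteration -/

section Iteration

/-- The weight `ε^{-w(j,k)}`, where `w(j,k)` is the expected order of `z_j^k`. -/
noncomputable def modWeight (K : ℕ) (ε ν : ℝ) {M : ℕ} (j : ZMod (2 * M))
    (k : Fin (M + 1) → ℤ) : ℝ := ε ^ (-sizeExp K ν (idxSize K j k))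

/-- The weight `ε^{-e(j)/2}`. -/
noncomputable def diagWeight (K : ℕ) (ε : ℝ) {M : ℕ} (j : ZMod (2 * M)) : ℝ :=
  ε ^ (-((profile K (absIdx j) : ℝ) / 2))

/-- Multiplication of a modulated family by the filter `φ(τΩ)`. -/
noncomputable def phiMul (ρ τ : ℝ) (φ : ℝ → ℝ) {M : ℕ}
    (z : ZMod (2 * M) → (Fin (M + 1) → ℤ) → ℂ[X]) : ZMod (2 * M) → (Fin (M + 1) → ℤ) → ℂ[X] :=
  fun j k => C (φ (τ * freq ρ (absIdx j)) : ℂ) * z j k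

/-- The quadratic nonlinearity of the modulation system. -/
noncomputable def modNonlin (K : ℕ) (ρ τ : ℝ) (φ : ℝ → ℝ) {M : ℕ} [NeZero M]
    (z : ZMod (2 * M) → (Fin (M + 1) → ℤ) → ℂ[X]) : ZMod (2 * M) → (Fin (M + 1) → ℤ) → ℂ[X] :=
  modConv K (phiMul ρ τ φ z) (phiMul ρ τ φ z)

theorem modSum_nonneg {K M : ℕ} {W : ZMod (2 * M) → (Fin (M + 1) → ℤ) → ℝ}
    (hW : ∀ j k, 0 ≤ W j k) (Y : ZMod (2 * M) → (Fin (M + 1) → ℤ) → ℂ[X]) (j : ZMod (2 * M)) :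
    0 ≤ modSum K W Y j :=
  Finset.sum_nonneg fun k _ => mul_nonneg (hW j k) (pnorm_nonneg _)

theorem modSum_add_le {K M : ℕ} {W : ZMod (2 * M) → (Fin (M + 1) → ℤ) → ℝ}
    (hW : ∀ j k, 0 ≤ W j k) (Y Z : ZMod (2 * M) → (Fin (M + 1) → ℤ) → ℂ[X]) (j : ZMod (2 * M)) :
    modSum K W (fun j k => Y j k + Z j k) j ≤ modSum K W Y j + modSum K W Z j := by
  unfold modSum
  rw [← Finset.sum_add_distrib]
  refine Finset.sum_le_sum fun k _ => ?_
  rw [← mul_add]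
  exact mul_le_mul_of_nonneg_left (pnorm_add_le _ _) (hW j k)

theorem modSum_sub_le {K M : ℕ} {W : ZMod (2 * M) → (Fin (M + 1) → ℤ) → ℝ}
    (hW : ∀ j k, 0 ≤ W j k) (Y Z : ZMod (2 * M) → (Fin (M + 1) → ℤ) → ℂ[X]) (j : ZMod (2 * M)) :
    modSum K W (fun j k => Y j k - Z j k) j ≤ modSum K W Y j + modSum K W Z j := by
  unfold modSum
  rw [← Finset.sum_add_distrib]
  refine Finset.sum_le_sum fun k _ => ?_
  rw [← mul_add]
  exact mul_le_mul_of_nonneg_left (pnorm_sub_le _ _) (hW j k)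

theorem modSum_mono {K M : ℕ} {V W : ZMod (2 * M) → (Fin (M + 1) → ℤ) → ℝ}
    (h : ∀ j k, V j k ≤ W j k) (Y : ZMod (2 * M) → (Fin (M + 1) → ℤ) → ℂ[X]) (j : ZMod (2 * M)) :
    modSum K V Y j ≤ modSum K W Y j :=
  Finset.sum_le_sum fun k _ => mul_le_mul_of_nonneg_right (h j k) (pnorm_nonneg _)

theorem modSum_const {K M : ℕ} (c : ℝ) (Y : ZMod (2 * M) → (Fin (M + 1) → ℤ) → ℂ[X])
    (j : ZMod (2 * M)) :
    modSum K (fun _ _ => c) Y j = c * modSum K (fun _ _ => 1) Y j := by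
  simp [modSum, Finset.mul_sum]

theorem rconv_mono {M : ℕ} [NeZero M] {a b a' b' : ZMod (2 * M) → ℝ} (ha : ∀ j, 0 ≤ a j)
    (hb : ∀ j, 0 ≤ b j) (h1 : ∀ j, a j ≤ a' j) (h2 : ∀ j, b j ≤ b' j) (j : ZMod (2 * M)) :
    rconv a b j ≤ rconv a' b' j :=
  Finset.sum_le_sum fun _ _ => mul_le_mul (h1 _) (h2 _) (hb _) ((ha _).trans (h1 _))

theorem rconv_mul_left {M : ℕ} [NeZero M] (c : ℝ) (a b : ZMod (2 * M) → ℝ) (j : ZMod (2 * M)) :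
    rconv (fun j => c * a j) b j = c * rconv a b j := by
  simp [rconv, Finset.mul_sum, mul_assoc]

theorem rconv_mul_right {M : ℕ} [NeZero M] (c : ℝ) (a b : ZMod (2 * M) → ℝ) (j : ZMod (2 * M)) :
    rconv a (fun j => c * b j) j = c * rconv a b j := by
  simp [rconv, Finset.mul_sum, mul_left_comm]

variable {K M : ℕ} {ρ τ ε ν γ B : ℝ} {ψ φ : ℝ → ℝ}

theorem phiMul_mem_degreeLT {n : ℕ} {z : ZMod (2 * M) → (Fin (M + 1) → ℤ) → ℂ[X]}
    (hz : ∀ j k, z j k ∈ degreeLT ℂ n) (j : ZMod (2 * M)) (k : Fin (M + 1) → ℤ) :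
    phiMul ρ τ φ z j k ∈ degreeLT ℂ n := by
  rw [phiMul, ← Polynomial.smul_eq_C_mul]
  exact Submodule.smul_mem _ _ (hz j k)

theorem IsRealFamily.phiMul {z : ZMod (2 * M) → (Fin (M + 1) → ℤ) → ℂ[X]}
    (hz : IsRealFamily K z) : IsRealFamily K (phiMul ρ τ φ z) := by
  intro j k hk
  simp [_root_.phiMul, absIdx_neg, hz j k hk]

theorem phiMul_sub (Y Z : ZMod (2 * M) → (Fin (M + 1) → ℤ) → ℂ[X]) (j : ZMod (2 * M))
    (k : Fin (M + 1) → ℤ) :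
    phiMul ρ τ φ Y j k - phiMul ρ τ φ Z j k = phiMul ρ τ φ (fun j k => Y j k - Z j k) j k := by
  simp only [phiMul]; ring

namespace NumSetup

theorem modSum_phiMul_le (S : NumSetup K M ρ τ ε ν γ B ψ φ)
    {W : ZMod (2 * M) → (Fin (M + 1) → ℤ) → ℝ}
    (hW : ∀ j k, 0 ≤ W j k) (Y : ZMod (2 * M) → (Fin (M + 1) → ℤ) → ℂ[X]) (j : ZMod (2 * M)) :
    modSum K W (phiMul ρ τ φ Y) j ≤ B * modSum K W Y j := by
  unfold modSum phiMul
  rw [Finset.mul_sum]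
  refine Finset.sum_le_sum fun k _ => ?_
  rw [pnorm_C_mul, Complex.norm_real, Real.norm_eq_abs, mul_left_comm]
  exact mul_le_mul_of_nonneg_right (S.filter.bound_φ _) (mul_nonneg (hW j k) (pnorm_nonneg _))

theorem modWeight_pos (S : NumSetup K M ρ τ ε ν γ B ψ φ) (j : ZMod (2 * M))
    (k : Fin (M + 1) → ℤ) : 0 < modWeight K ε ν j k := Real.rpow_pos_of_pos S.hε _

theorem rpow_neg_half_le_modWeight (S : NumSetup K M ρ τ ε ν γ B ψ φ) (j : ZMod (2 * M))
    (k : Fin (M + 1) → ℤ) : ε ^ (-(1 / 2) : ℝ) ≤ modWeight K ε ν j k :=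
  Real.rpow_le_rpow_of_exponent_ge S.hε S.hε1
    (neg_le_neg (half_le_sizeExp S.hK S.hν0 S.hν j k))

theorem one_le_modWeight (S : NumSetup K M ρ τ ε ν γ B ψ φ) (j : ZMod (2 * M))
    (k : Fin (M + 1) → ℤ) : 1 ≤ modWeight K ε ν j k :=
  (Real.one_le_rpow_of_pos_of_le_one_of_nonpos S.hε S.hε1 (by norm_num)).trans
    (S.rpow_neg_half_le_modWeight j k)

theorem diagWeight_pos (S : NumSetup K M ρ τ ε ν γ B ψ φ) (j : ZMod (2 * M)) :
    0 < diagWeight K ε j := Real.rpow_pos_of_pos S.hε _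

/-- Source of the gain per iteration in the unweighted norm: the loss is at most `ε^{-ν}`, and a
factor measured with `modWeight` is worth at least `ε^{1/2}`. -/
theorem lossFactor_le (S : NumSetup K M ρ τ ε ν γ B ψ φ) (j j' : ZMod (2 * M))
    (k k' : Fin (M + 1) → ℤ) :
    lossFactor K ε ν j k ≤ modWeight K ε ν j' k' * ε ^ (1 / 2 - ν) := by
  have h1 : lossFactor K ε ν j k ≤ ε ^ (-ν) :=
    Real.rpow_le_rpow_of_exponent_ge S.hε S.hε1 (neg_le_neg (lossExp_le S.hν0 j k))
  refine h1.trans ?_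
  have h2 : ε ^ (-ν) = ε ^ (-(1 / 2) : ℝ) * ε ^ (1 / 2 - ν) := by
    rw [← Real.rpow_add S.hε]; congr 1; ring
  rw [h2]
  exact mul_le_mul_of_nonneg_right (S.rpow_neg_half_le_modWeight j' k')
    (Real.rpow_nonneg S.hε.le _)

variable [NeZero M]

theorem modWeight_diag (S : NumSetup K M ρ τ ε ν γ B ψ φ) (j : ZMod (2 * M))
    {k : Fin (M + 1) → ℤ} (hk : k = unitVec j ∨ k = -unitVec j) :
    modWeight K ε ν j k = diagWeight K ε j := by
  rw [modWeight, sizeExp_diag S.hK j hk, diagWeight]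

theorem diagWeight_le (S : NumSetup K M ρ τ ε ν γ B ψ φ) (j : ZMod (2 * M))
    (k : Fin (M + 1) → ℤ) : diagWeight K ε j ≤ modWeight K ε ν j k := by
  rw [← S.modWeight_diag j (Or.inl rfl), modWeight, modWeight]
  refine Real.rpow_le_rpow_of_exponent_ge S.hε S.hε1
    (neg_le_neg (sizeExp_mono S.hν0 S.hν ?_))
  rw [idxSize_diag S.hK j (Or.inl rfl)]
  exact profile_le_idxSize S.hK j k

theorem modWeight_mul_lossFactor_le (S : NumSetup K M ρ τ ε ν γ B ψ φ) (j₁ j₂ : ZMod (2 * M))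
    (k₁ : Fin (M + 1) → ℤ) (hk₁ : k₁ ∈ modSet K j₁) (k₂ : Fin (M + 1) → ℤ)
    (hk₂ : k₂ ∈ modSet K j₂) :
    modWeight K ε ν (j₁ + j₂) (k₁ + k₂) * lossFactor K ε ν (j₁ + j₂) (k₁ + k₂) ≤
      modWeight K ε ν j₁ k₁ * modWeight K ε ν j₂ k₂ := by
  unfold modWeight lossFactor
  rw [← Real.rpow_add S.hε, ← Real.rpow_add S.hε]
  refine Real.rpow_le_rpow_of_exponent_ge S.hε S.hε1 ?_
  have := sizeExp_add_lossExp_le S.hK S.hν0 S.hν hk₁ hk₂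
  linarith

/-- Lipschitz bound by polarisation. The difference may be measured in a weight `W'` other than that
of `Y` and `Z`, which allows a weighted and an unweighted version from one statement. -/
theorem modSum_modNonlin_sub_le (S : NumSetup K M ρ τ ε ν γ B ψ φ)
    {V W W' : ZMod (2 * M) → (Fin (M + 1) → ℤ) → ℝ}
    (hV : ∀ j k, 0 ≤ V j k) (hW : ∀ j k, 0 ≤ W j k) (hW' : ∀ j k, 0 ≤ W' j k)
    (h : ∀ j₁ j₂ : ZMod (2 * M), ∀ k₁ ∈ modSet K j₁, ∀ k₂ ∈ modSet K j₂,
      k₁ + k₂ ∈ modSet K (j₁ + j₂) → V (j₁ + j₂) (k₁ + k₂) ≤ W j₁ k₁ * W' j₂ k₂)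
    (h' : ∀ j₁ j₂ : ZMod (2 * M), ∀ k₁ ∈ modSet K j₁, ∀ k₂ ∈ modSet K j₂,
      k₁ + k₂ ∈ modSet K (j₁ + j₂) → V (j₁ + j₂) (k₁ + k₂) ≤ W' j₁ k₁ * W j₂ k₂)
    (Y Z : ZMod (2 * M) → (Fin (M + 1) → ℤ) → ℂ[X]) (j : ZMod (2 * M)) :
    modSum K V (fun j k => modNonlin K ρ τ φ Y j k - modNonlin K ρ τ φ Z j k) j ≤
      B ^ 2 * (rconv (modSum K W Y) (modSum K W' fun j k => Y j k - Z j k) j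
        + rconv (modSum K W' fun j k => Y j k - Z j k) (modSum K W Z) j) := by
  have hB := S.B_nonneg
  have e : (fun (j : ZMod (2 * M)) k => modNonlin K ρ τ φ Y j k - modNonlin K ρ τ φ Z j k) =
      fun j k => modConv K (phiMul ρ τ φ Y) (phiMul ρ τ φ fun j k => Y j k - Z j k) j k
        + modConv K (phiMul ρ τ φ fun j k => Y j k - Z j k) (phiMul ρ τ φ Z) j k := by
    funext j k
    unfold modNonlin
    rw [modConv_self_sub]
    simp only [phiMul_sub]
  rw [e]
  refine (modSum_add_le hV _ _ j).trans ?_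
  have e1 : ∀ (U U' : ZMod (2 * M) → (Fin (M + 1) → ℤ) → ℝ), (∀ j k, 0 ≤ U j k) →
      (∀ j k, 0 ≤ U' j k) → (∀ j₁ j₂ : ZMod (2 * M), ∀ k₁ ∈ modSet K j₁, ∀ k₂ ∈ modSet K j₂,
      k₁ + k₂ ∈ modSet K (j₁ + j₂) → V (j₁ + j₂) (k₁ + k₂) ≤ U j₁ k₁ * U' j₂ k₂) →
      ∀ X X' : ZMod (2 * M) → (Fin (M + 1) → ℤ) → ℂ[X],
      modSum K V (modConv K (phiMul ρ τ φ X) (phiMul ρ τ φ X')) j ≤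
        B ^ 2 * rconv (modSum K U X) (modSum K U' X') j := by
    intro U U' hU hU' hh X X'
    refine (modSum_modConv_le hV hh hU hU' _ _ j).trans ?_
    refine (rconv_mono (modSum_nonneg hU _) (modSum_nonneg hU' _) (S.modSum_phiMul_le hU X)
      (S.modSum_phiMul_le hU' X') j).trans (le_of_eq ?_)
    rw [rconv_mul_left, rconv_mul_right]; ring
  rw [mul_add]
  exact add_le_add (e1 W W' hW hW' h _ _) (e1 W' W hW' hW h' _ _)

end NumSetup

theorem IsRealFamily.modNonlin [NeZero M] (hK : 3 ≤ K)
    {z : ZMod (2 * M) → (Fin (M + 1) → ℤ) → ℂ[X]} (hz : IsRealFamily K z) :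
    IsRealFamily K (modNonlin K ρ τ φ z) :=
  IsRealFamily.modConv hK hz.phiMul hz.phiMul

theorem modNonlin_mem_degreeLT [NeZero M] {n : ℕ} {z : ZMod (2 * M) → (Fin (M + 1) → ℤ) → ℂ[X]}
    (hz : ∀ j k, z j k ∈ degreeLT ℂ n) (j : ZMod (2 * M)) (k : Fin (M + 1) → ℤ) :
    modNonlin K ρ τ φ z j k ∈ degreeLT ℂ (n + n) :=
  modConv_mem_degreeLT (phiMul_mem_degreeLT hz) (phiMul_mem_degreeLT hz) j k

/-- `z` solves the modulation system with the nonlinearity evaluated at `y`, together with the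
initial conditions. -/
structure IsModIterate (K : ℕ) (ρ τ ε ν : ℝ) (ψ φ : ℝ → ℝ) {M : ℕ} [NeZero M]
    (a b : ZMod (2 * M) → ℂ) (y z : ZMod (2 * M) → (Fin (M + 1) → ℤ) → ℂ[X]) : Prop where
  real : IsRealFamily K z
  real' : IsRealFamily K y
  eqn : ∀ j, ∀ k ∈ modSet K j,
    modOp (τ * dotFreq ρ k) (τ * freq ρ (absIdx j)) (ε ^ (ν / 2) * τ) (z j k)
      = ((τ ^ 2 * ψ (τ * freq ρ (absIdx j)) : ℝ) : ℂ) • modNonlin K ρ τ φ y j k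
  init : ∀ j, ∑ k ∈ modFinset K j, (z j k).eval 0 = a j
  vel : ∀ j, ∑ k ∈ modFinset K j, velTerm (τ * dotFreq ρ k) (ε ^ (ν / 2) * τ) (z j k)
    = 2 * τ * (Real.sinc (τ * freq ρ (absIdx j)) : ℂ) * b j

/-- Picard iteration: `z` is the next iterate after `y`. The degrees and constants grow with `m` but
depend on neither `ε`, `τ` nor `M`, and no contraction in the weighted norm is required because `m`
will be fixed. -/
theorem exists_modIterate (K : ℕ) (ρ ν γ B : ℝ) {s : ℝ} (hs : 1 / 2 < s) (D : ℝ) (m : ℕ) :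
    ∃ (N : ℕ) (A : ℝ), 0 ≤ A ∧ ∀ (M : ℕ) [NeZero M] (τ ε : ℝ) (ψ φ : ℝ → ℝ),
      NumSetup K M ρ τ ε ν γ B ψ φ →
      ∀ a b : ZMod (2 * M) → ℂ, IsRealData a → IsRealData b →
      snorm s (fun j => diagWeight K ε j * (‖a j‖ + ‖b j‖)) ≤ D →
      ∃ y z : ZMod (2 * M) → (Fin (M + 1) → ℤ) → ℂ[X],
        IsModIterate K ρ τ ε ν ψ φ a b y z ∧
        (∀ j k, y j k ∈ degreeLT ℂ N) ∧ (∀ j k, z j k ∈ degreeLT ℂ N) ∧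
        snorm s (modSum K (modWeight K ε ν) y) ≤ A ∧ snorm s (modSum K (modWeight K ε ν) z) ≤ A ∧
        snorm s (modSum K (fun _ _ => 1) fun j k => z j k - y j k) ≤ A * (ε ^ (1 / 2 - ν)) ^ m := by
  induction m with
  | zero =>
    obtain ⟨A, hA, H⟩ := exists_linear_solution K ρ ν γ B 0
    refine ⟨1, A * |D|, by positivity, ?_⟩
    intro M _ τ ε ψ φ S a b ha hb hD
    obtain ⟨z, hz, hzr, hL, hinit, hvel, hbound⟩ := H M τ ε ψ φ S (fun _ _ => 0)
      (fun _ _ _ => Submodule.zero_mem _) (fun _ _ _ => by simp) a b ha hb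
    have hW : ∀ (j : ZMod (2 * M)) (k : Fin (M + 1) → ℤ), 0 ≤ modWeight K ε ν j k :=
      fun j k => (S.modWeight_pos j k).le
    have hb := hbound (modWeight K ε ν) (diagWeight K ε) (fun j => (S.diagWeight_pos j).le)
      (fun j => S.modWeight_diag j (Or.inl rfl)) (fun j => S.modWeight_diag j (Or.inr rfl))
      (fun j k _ => S.diagWeight_le j k) (fun j k => by rw [modWeight, idxSize_neg, modWeight])
      (fun j => by rw [diagWeight, absIdx_neg, diagWeight])
    simp only [pnorm_zero, mul_zero, Finset.sum_const_zero, add_zero] at hb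
    have hzn : snorm s (modSum K (modWeight K ε ν) z) ≤ A * |D| := by
      refine (snorm_mono' (modSum_nonneg hW z) hb).trans ?_
      rw [snorm_mul_left, abs_of_nonneg hA]
      exact mul_le_mul_of_nonneg_left (hD.trans (le_abs_self D)) hA
    have h0 : modNonlin K ρ τ φ (fun (_ : ZMod (2 * M)) _ => 0) = fun _ _ => 0 := by
      funext j k
      simp [modNonlin, modConv, phiMul]
    refine ⟨fun _ _ => 0, z, ⟨hzr, fun _ _ _ => by simp, ?_, hinit, hvel⟩,
      fun _ _ => Submodule.zero_mem _, hz, ?_, hzn, ?_⟩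
    · rw [h0]; exact hL
    · have : modSum K (modWeight K ε ν) (fun (_ : ZMod (2 * M)) _ => 0) = fun _ => 0 := by
        funext j; simp [modSum]
      rw [this]
      have : snorm s (fun _ : ZMod (2 * M) => (0 : ℝ)) = 0 := by simp [snorm]
      rw [this]; positivity
    · simp only [sub_zero, pow_zero, mul_one]
      exact (snorm_mono' (modSum_nonneg (fun _ _ => zero_le_one) z)
        (modSum_mono (fun j k => S.one_le_modWeight j k) z)).trans hzn
  | succ m ih =>
    obtain ⟨N, A, hA, ih⟩ := ih
    obtain ⟨A₁, hA₁, H⟩ := exists_linear_solution K ρ ν γ B (N + N)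
    obtain ⟨Cs, hCs, hconv⟩ := exists_snorm_rconv_le hs
    set A' : ℝ := A₁ * B ^ 2 * Cs with hA'
    have hA'0 : 0 ≤ A' := by positivity
    refine ⟨N + N + 1, A + A' * (4 * A ^ 2), by positivity, ?_⟩
    intro M _ τ ε ψ φ S a b ha hb hD
    obtain ⟨y, z, hyz, hyN, hzN, hyA, hzA, hδ⟩ := ih M τ ε ψ φ S a b ha hb hD
    -- The correction to `z` solves the linear system with the difference of nonlinearities and zero
    -- initial data; by linearity the sum solves the system with the nonlinearity at `z`.
    set g : ZMod (2 * M) → (Fin (M + 1) → ℤ) → ℂ[X] := fun j k =>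
      modNonlin K ρ τ φ z j k - modNonlin K ρ τ φ y j k with hg
    have hgr : IsRealFamily K g := by
      intro j k hk
      simp only [hg, Polynomial.map_sub, hyz.real.modNonlin S.hK j k hk,
        hyz.real'.modNonlin S.hK j k hk]
    have hzero : IsRealData (fun _ : ZMod (2 * M) => (0 : ℂ)) := fun j => by simp
    obtain ⟨δ, hδN, hδr, hδL, hδi, hδv, hδb⟩ := H M τ ε ψ φ S g
      (fun j k _ => Submodule.sub_mem _ (modNonlin_mem_degreeLT hzN j k)
        (modNonlin_mem_degreeLT hyN j k)) hgr _ _ hzero hzero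
    have hW : ∀ (j : ZMod (2 * M)) (k : Fin (M + 1) → ℤ), 0 ≤ modWeight K ε ν j k :=
      fun j k => (S.modWeight_pos j k).le
    have hE : ∀ (j : ZMod (2 * M)) (k : Fin (M + 1) → ℤ), 0 ≤ lossFactor K ε ν j k :=
      fun j k => (S.lossFactor_pos j k).le
    set β : ℝ := ε ^ (1 / 2 - ν) with hβ
    have hβ0 : 0 ≤ β := Real.rpow_nonneg S.hε.le _
    have hone : ∀ (j : ZMod (2 * M)) (k : Fin (M + 1) → ℤ), (0 : ℝ) ≤ (fun _ _ => 1 :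
      ZMod (2 * M) → (Fin (M + 1) → ℤ) → ℝ) j k := fun _ _ => zero_le_one
    -- bound in the weighted norm
    have hbW : ∀ j, modSum K (modWeight K ε ν) δ j ≤ A₁ * B ^ 2 *
        (rconv (modSum K (modWeight K ε ν) z)
            (modSum K (modWeight K ε ν) fun j k => z j k - y j k) j
          + rconv (modSum K (modWeight K ε ν) fun j k => z j k - y j k)
            (modSum K (modWeight K ε ν) y) j) := by
      intro j
      have h1 := hδb (modWeight K ε ν) (diagWeight K ε) (fun j => (S.diagWeight_pos j).le)
        (fun j => S.modWeight_diag j (Or.inl rfl)) (fun j => S.modWeight_diag j (Or.inr rfl))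
        (fun j k _ => S.diagWeight_le j k) (fun j k => by rw [modWeight, idxSize_neg, modWeight])
        (fun j => by rw [diagWeight, absIdx_neg, diagWeight]) j
      simp only [norm_zero, add_zero, mul_zero, zero_add] at h1
      refine h1.trans ?_
      rw [mul_assoc A₁]
      exact mul_le_mul_of_nonneg_left (S.modSum_modNonlin_sub_le
        (V := fun j k => modWeight K ε ν j k * lossFactor K ε ν j k)
        (fun j k => mul_nonneg (hW j k) (hE j k)) hW hW
        (fun j₁ j₂ k₁ hk₁ k₂ hk₂ _ => S.modWeight_mul_lossFactor_le j₁ j₂ k₁ hk₁ k₂ hk₂)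
        (fun j₁ j₂ k₁ hk₁ k₂ hk₂ _ => S.modWeight_mul_lossFactor_le j₁ j₂ k₁ hk₁ k₂ hk₂)
        z y j) hA₁
    -- bound in the unweighted norm
    have hb1 : ∀ j, modSum K (fun _ _ => 1) δ j ≤ A₁ * B ^ 2 * β *
        (rconv (modSum K (modWeight K ε ν) z)
            (modSum K (fun _ _ => 1) fun j k => z j k - y j k) j
          + rconv (modSum K (fun _ _ => 1) fun j k => z j k - y j k)
            (modSum K (modWeight K ε ν) y) j) := by
      intro j
      have h1 := hδb (fun _ _ => 1) (fun _ => 1) (fun j => zero_le_one)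
        (fun _ => rfl) (fun _ => rfl) (fun _ _ _ => le_rfl) (fun _ _ => rfl) (fun _ => rfl) j
      simp only [norm_zero, add_zero, mul_zero, zero_add] at h1
      refine h1.trans ?_
      have h2 := S.modSum_modNonlin_sub_le (W' := fun _ _ => β)
        (V := fun j k => 1 * lossFactor K ε ν j k)
        (fun j k => mul_nonneg zero_le_one (hE j k)) hW (fun _ _ => hβ0)
        (fun j₁ j₂ k₁ _ k₂ _ _ => by rw [one_mul]; exact S.lossFactor_le _ _ _ _)
        (fun j₁ j₂ k₁ _ k₂ _ _ => by rw [one_mul, mul_comm β]; exact S.lossFactor_le _ _ _ _)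
        z y j
      have h3 : (modSum K (fun _ _ => β) fun (j : ZMod (2 * M)) k => z j k - y j k)
          = fun j => β * (modSum K (fun _ _ => 1) fun j k => z j k - y j k) j := by
        funext j; rw [modSum_const]
      rw [h3, rconv_mul_left, rconv_mul_right, ← mul_add, ← mul_assoc] at h2
      refine (mul_le_mul_of_nonneg_left h2 hA₁).trans (le_of_eq ?_)
      ring
    -- In the weighted norm consecutive iterates are merely bounded, by the triangle inequality.
    have hXδ : snorm s (modSum K (modWeight K ε ν) fun j k => z j k - y j k) ≤ 2 * A := by
      refine (snorm_mono' (modSum_nonneg hW _) (modSum_sub_le hW z y)).trans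
        ((snorm_add_le _ _ _).trans ?_)
      linarith
    have hsnn : ∀ v : ZMod (2 * M) → ℝ, 0 ≤ snorm s v := snorm_nonneg s
    have hδW : snorm s (modSum K (modWeight K ε ν) δ) ≤ A' * (4 * A ^ 2) := by
      refine (snorm_mono' (modSum_nonneg hW δ) hbW).trans ?_
      rw [snorm_mul_left, abs_of_nonneg (by positivity)]
      have h1 := (snorm_add_le s _ _).trans (add_le_add (hconv M
        (modSum K (modWeight K ε ν) z) (modSum K (modWeight K ε ν) fun j k => z j k - y j k))
        (hconv M (modSum K (modWeight K ε ν) fun j k => z j k - y j k)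
            (modSum K (modWeight K ε ν) y)))
      refine (mul_le_mul_of_nonneg_left h1 (by positivity)).trans ?_
      have p1 := hsnn (modSum K (modWeight K ε ν) z)
      have p2 := hsnn (modSum K (modWeight K ε ν) y)
      have p3 := hsnn (modSum K (modWeight K ε ν) fun j k => z j k - y j k)
      calc _ ≤ A₁ * B ^ 2 * (Cs * A * (2 * A) + Cs * (2 * A) * A) := by gcongr
        _ = A' * (4 * A ^ 2) := by rw [hA']; ring
    have hδ1 : snorm s (modSum K (fun _ _ => 1) δ) ≤ (A' * (4 * A ^ 2)) * β ^ (m + 1) := by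
      refine (snorm_mono' (modSum_nonneg hone δ) hb1).trans ?_
      rw [snorm_mul_left, abs_of_nonneg (by positivity)]
      have h1 := (snorm_add_le s _ _).trans (add_le_add (hconv M
        (modSum K (modWeight K ε ν) z) (modSum K (fun _ _ => 1) fun j k => z j k - y j k))
        (hconv M (modSum K (fun _ _ => 1) fun j k => z j k - y j k)
            (modSum K (modWeight K ε ν) y)))
      refine (mul_le_mul_of_nonneg_left h1 (by positivity)).trans ?_
      have p1 := hsnn (modSum K (modWeight K ε ν) z)
      have p2 := hsnn (modSum K (modWeight K ε ν) y)
      have p3 := hsnn (modSum K (fun _ _ => 1) fun j k => z j k - y j k)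
      calc _ ≤ A₁ * B ^ 2 * β * (Cs * A * (A * β ^ m) + Cs * (A * β ^ m) * A) := by gcongr
        _ = (A' * (2 * A ^ 2)) * β ^ (m + 1) := by rw [hA', pow_succ]; ring
        _ ≤ (A' * (4 * A ^ 2)) * β ^ (m + 1) := by gcongr; norm_num
    refine ⟨z, fun j k => z j k + δ j k, ⟨?_, hyz.real, ?_, ?_, ?_⟩, ?_, ?_, ?_, ?_, ?_⟩
    · intro j k hk
      simp only [Polynomial.map_add, hyz.real j k hk, hδr j k hk]
    · intro j k hk
      rw [map_add, hyz.eqn j k hk, hδL j k hk, ← smul_add]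
      simp only [hg, add_sub_cancel]
    · intro j
      simp only [Polynomial.eval_add, Finset.sum_add_distrib, hyz.init, hδi, add_zero]
    · intro j
      simp only [velTerm_add, Finset.sum_add_distrib, hyz.vel, hδv, mul_zero, add_zero]
    · exact fun j k => degreeLT_mono' (by omega) (hzN j k)
    · exact fun j k => Submodule.add_mem _ (degreeLT_mono' (by omega) (hzN j k)) (hδN j k)
    · have : 0 ≤ A' * (4 * A ^ 2) := by positivity
      linarith
    · refine (snorm_mono' (modSum_nonneg hW _) (modSum_add_le hW z δ)).trans
        ((snorm_add_le _ _ _).trans ?_)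
      linarith
    · simp only [add_sub_cancel_left]
      refine hδ1.trans (mul_le_mul_of_nonneg_right ?_ (by positivity))
      linarith

end Iteration

/-! ### Stability of the trigonometric integrator -/

section Stability

/-- The Euclidean norm of a pair. -/
noncomputable def pairNorm (x y : ℂ) : ℝ := Real.sqrt (‖x‖ ^ 2 + ‖y‖ ^ 2)

theorem pairNorm_nonneg (x y : ℂ) : 0 ≤ pairNorm x y := Real.sqrt_nonneg _

theorem norm_fst_le_pairNorm (x y : ℂ) : ‖x‖ ≤ pairNorm x y :=
  Real.le_sqrt_of_sq_le (by nlinarith [sq_nonneg ‖y‖])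

theorem norm_snd_le_pairNorm (x y : ℂ) : ‖y‖ ≤ pairNorm x y :=
  Real.le_sqrt_of_sq_le (by nlinarith [sq_nonneg ‖x‖])

theorem pairNorm_add_le (x y f g : ℂ) :
    pairNorm (x + f) (y + g) ≤ pairNorm x y + (‖f‖ + ‖g‖) := by
  have hx := norm_fst_le_pairNorm x y
  have hy := norm_snd_le_pairNorm x y
  have hp := pairNorm_nonneg x y
  have hsq : pairNorm x y ^ 2 = ‖x‖ ^ 2 + ‖y‖ ^ 2 := Real.sq_sqrt (by positivity)
  have h1 := norm_add_le x f
  have h2 := norm_add_le y g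
  have f0 := norm_nonneg f
  have g0 := norm_nonneg g
  refine Real.sqrt_le_iff.2 ⟨by positivity, ?_⟩
  have e1 : ‖x + f‖ ^ 2 ≤ (‖x‖ + ‖f‖) ^ 2 := by gcongr
  have e2 : ‖y + g‖ ^ 2 ≤ (‖y‖ + ‖g‖) ^ 2 := by gcongr
  nlinarith [mul_le_mul_of_nonneg_right hx f0, mul_le_mul_of_nonneg_right hy g0,
    mul_nonneg hp f0, mul_nonneg hp g0, mul_nonneg f0 g0]

theorem pairNorm_rotation (θ : ℝ) (x y : ℂ) :
    pairNorm ((Real.cos θ : ℂ) * x + (Real.sin θ : ℂ) * y)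
      (-(Real.sin θ : ℂ) * x + (Real.cos θ : ℂ) * y) = pairNorm x y := by
  unfold pairNorm
  congr 1
  have hc := Real.cos_sq_add_sin_sq θ
  rw [← Complex.normSq_eq_norm_sq, ← Complex.normSq_eq_norm_sq, ← Complex.normSq_eq_norm_sq,
    ← Complex.normSq_eq_norm_sq]
  simp only [Complex.normSq_apply, Complex.add_re, Complex.add_im, Complex.mul_re, Complex.mul_im,
    Complex.neg_re, Complex.neg_im, Complex.ofReal_re, Complex.ofReal_im]
  linear_combination (x.re * x.re + x.im * x.im + y.re * y.re + y.im * y.im) * hc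

variable {K M : ℕ} [NeZero M] {ρ τ ε ν γ B : ℝ} {ψ φ : ℝ → ℝ}

/-- The convolution `(Φu) ∗ (Φu)`. -/
noncomputable def filteredSquare (ρ τ : ℝ) (φ : ℝ → ℝ) {M : ℕ} [NeZero M]
    (u : ZMod (2 * M) → ℂ) : ZMod (2 * M) → ℂ :=
  discConv (diagMul ρ (fun w => φ (τ * w)) u) (diagMul ρ (fun w => φ (τ * w)) u)

/-- Polarisation of the square; `u` remains in one factor and is estimated later through `x` plus
the error. -/
theorem norm_filteredSquare_sub_le (S : NumSetup K M ρ τ ε ν γ B ψ φ) (u x : ZMod (2 * M) → ℂ)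
    (j : ZMod (2 * M)) :
    ‖filteredSquare ρ τ φ u j - filteredSquare ρ τ φ x j‖ ≤
      B ^ 2 * (rconv (fun j => ‖u j - x j‖) (fun j => ‖u j‖) j
        + rconv (fun j => ‖x j‖) (fun j => ‖u j - x j‖) j) := by
  have hB := S.B_nonneg
  unfold filteredSquare discConv diagMul rconv
  rw [← Finset.sum_sub_distrib, ← Finset.sum_add_distrib, Finset.mul_sum]
  refine (norm_sum_le _ _).trans (Finset.sum_le_sum fun i _ => ?_)
  set p := φ (τ * freq ρ (absIdx i))
  set p' := φ (τ * freq ρ (absIdx (j - i)))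
  have hp : |p| ≤ B := S.filter.bound_φ _
  have hp' : |p'| ≤ B := S.filter.bound_φ _
  have e : (p : ℂ) * u i * ((p' : ℂ) * u (j - i)) - (p : ℂ) * x i * ((p' : ℂ) * x (j - i))
      = ((p : ℂ) * p') * ((u i - x i) * u (j - i) + x i * (u (j - i) - x (j - i))) := by ring
  rw [e, norm_mul, norm_mul, Complex.norm_real, Complex.norm_real, Real.norm_eq_abs,
    Real.norm_eq_abs, sq]
  refine mul_le_mul (mul_le_mul hp hp' (abs_nonneg _) hB) ((norm_add_le _ _).trans ?_)
    (norm_nonneg _) (by positivity)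
  rw [norm_mul, norm_mul]

/-- `x`, `w` satisfy the equations of the trigonometric integrator up to a defect `e` in the
nonlinearity. -/
structure IsPerturbedIntegrator (ρ τ : ℝ) (ψ φ : ℝ → ℝ) {M : ℕ} [NeZero M]
    (x w e : ℕ → ZMod (2 * M) → ℂ) : Prop where
  start : ∀ j, x 1 j = (Real.cos (τ * freq ρ (absIdx j)) : ℂ) * x 0 j
    + (τ : ℂ) * (Real.sinc (τ * freq ρ (absIdx j)) : ℂ) * w 0 j
    + 1 / 2 * (τ : ℂ) ^ 2 * ((ψ (τ * freq ρ (absIdx j)) : ℂ) * (filteredSquare ρ τ φ (x 0) j + e 0 j))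
  step : ∀ n j, x (n + 2) j - 2 * (Real.cos (τ * freq ρ (absIdx j)) : ℂ) * x (n + 1) j + x n j
    = (τ : ℂ) ^ 2 * ((ψ (τ * freq ρ (absIdx j)) : ℂ) *
        (filteredSquare ρ τ φ (x (n + 1)) j + e (n + 1) j))
  velocity : ∀ n j, 2 * (τ : ℂ) * (Real.sinc (τ * freq ρ (absIdx j)) : ℂ) * w (n + 1) j
    = x (n + 2) j - x n j

theorem IsTrigIntegrator.isPerturbedIntegrator {u v : ℕ → ZMod (2 * M) → ℂ}
    (h : IsTrigIntegrator ρ τ ψ φ u v) :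
    IsPerturbedIntegrator ρ τ ψ φ u v (fun _ _ => 0) where
  start := fun j => by rw [h.start j, add_zero]; rfl
  step := fun n j => by rw [h.step n j, add_zero]; rfl
  velocity := h.velocity

/-- Half the sum of the two-step recursion and the velocity formula eliminates the previous step, so
the starting formula holds at every step. -/
theorem IsPerturbedIntegrator.position {x w e : ℕ → ZMod (2 * M) → ℂ}
    (h : IsPerturbedIntegrator ρ τ ψ φ x w e) (n : ℕ) (j : ZMod (2 * M)) :
    x (n + 1) j = (Real.cos (τ * freq ρ (absIdx j)) : ℂ) * x n j
      + (τ : ℂ) * (Real.sinc (τ * freq ρ (absIdx j)) : ℂ) * w n j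
      + 1 / 2 * (τ : ℂ) ^ 2 *
        ((ψ (τ * freq ρ (absIdx j)) : ℂ) * (filteredSquare ρ τ φ (x n) j + e n j)) := by
  cases n with
  | zero => exact h.start j
  | succ n =>
    have h1 := h.step n j
    have h2 := h.velocity n j
    linear_combination 1 / 2 * h1 - 1 / 2 * h2

/-- The one-step form of the velocity: the recursion eliminates `x (n + 2)`, the position formula
eliminates `x (n + 1)`, and division by `2 sin α / ω` is possible by non-resonance. The relation `ψ
= sinc · φ` removes the sine from the kick, leaving no small divisor. -/
theorem IsPerturbedIntegrator.velocity_step (S : NumSetup K M ρ τ ε ν γ B ψ φ)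
    {x w e : ℕ → ZMod (2 * M) → ℂ}
    (h : IsPerturbedIntegrator ρ τ ψ φ x w e) (n : ℕ) (j : ZMod (2 * M)) :
    w (n + 1) j = -(Real.sin (τ * freq ρ (absIdx j)) : ℂ) * ((freq ρ (absIdx j) : ℂ) * x n j)
      + (Real.cos (τ * freq ρ (absIdx j)) : ℂ) * w n j
      + 1 / 2 * (τ : ℂ) * (φ (τ * freq ρ (absIdx j)) : ℂ) *
        ((Real.cos (τ * freq ρ (absIdx j)) : ℂ) * (filteredSquare ρ τ φ (x n) j + e n j)
          + (filteredSquare ρ τ φ (x (n + 1)) j + e (n + 1) j)) := by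
  have h1 := h.step n j
  have h2 := h.velocity n j
  have h3 := h.position n j
  have hα := S.alpha_pos j
  have hs := S.sin_ne_zero j
  have hsym := S.filter.symplectic (τ * freq ρ (absIdx j))
  have hω := freq_pos S.hρ (absIdx j)
  have hcs := Real.cos_sq_add_sin_sq (τ * freq ρ (absIdx j))
  rw [hsym] at h1 h3
  rw [Real.sinc_of_ne_zero hα.ne'] at h1 h2 h3
  set α := τ * freq ρ (absIdx j) with hαd
  have hτ : (τ : ℂ) ≠ 0 := by exact_mod_cast S.hτ.ne'
  have hωC : (freq ρ (absIdx j) : ℂ) ≠ 0 := by exact_mod_cast hω.ne'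
  have hsC : (Real.sin α : ℂ) ≠ 0 := by exact_mod_cast hs
  have hcsC : (Real.cos α : ℂ) ^ 2 + (Real.sin α : ℂ) ^ 2 = 1 := by exact_mod_cast hcs
  have eα : ((Real.sin α / α : ℝ) : ℂ) = Real.sin α / (τ * freq ρ (absIdx j)) := by
    rw [hαd]; push_cast; rfl
  rw [eα] at h2
  push_cast [-Complex.ofReal_sin, -Complex.ofReal_cos] at h1 h3
  have eα' : (α : ℂ) = τ * freq ρ (absIdx j) := by rw [hαd]; push_cast; rfl
  rw [eα'] at h1 h3
  have key : (2 : ℂ) * Real.sin α / freq ρ (absIdx j) ≠ 0 := by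
    refine div_ne_zero (mul_ne_zero two_ne_zero hsC) hωC
  refine mul_left_cancel₀ key ?_
  have h2' : (2 : ℂ) * Real.sin α / freq ρ (absIdx j) * w (n + 1) j = x (n + 2) j - x n j := by
    rw [← h2]; field_simp
  rw [h2']
  set F := filteredSquare ρ τ φ (x n) j + e n j
  set F' := filteredSquare ρ τ φ (x (n + 1)) j + e (n + 1) j
  set ω := freq ρ (absIdx j)
  have h1' : x (n + 2) j - 2 * (Real.cos α : ℂ) * x (n + 1) j + x n j
      = τ * ((Real.sin α : ℂ) / ω) * (φ α * F') := by
    rw [h1]; field_simp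
  have h3' : x (n + 1) j = (Real.cos α : ℂ) * x n j + ((Real.sin α : ℂ) / ω) * w n j
      + 1 / 2 * τ * ((Real.sin α : ℂ) / ω) * (φ α * F) := by
    rw [h3]; field_simp
  have e1 : 2 * (Real.sin α : ℂ) / ω * (-(Real.sin α : ℂ) * (ω * x n j) + (Real.cos α : ℂ) * w n j
      + 1 / 2 * τ * φ α * ((Real.cos α : ℂ) * F + F')) = -2 * (Real.sin α : ℂ) ^ 2 * x n j
      + ((Real.sin α : ℂ) / ω) * (2 * (Real.cos α : ℂ) * w n j
        + τ * φ α * ((Real.cos α : ℂ) * F + F')) := by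
    field_simp
    ring
  rw [e1]
  linear_combination h1' + 2 * (Real.cos α : ℂ) * h3' + 2 * x n j * hcsC

/-- The energy norm of one Fourier mode. -/
noncomputable def modePair (ρ : ℝ) {M : ℕ} (r r' : ZMod (2 * M) → ℂ) (j : ZMod (2 * M)) : ℝ :=
  pairNorm ((freq ρ (absIdx j) : ℂ) * r j) (r' j)

/-- One step of the error propagation of the integrator, mode by mode. -/
theorem IsPerturbedIntegrator.modePair_step (S : NumSetup K M ρ τ ε ν γ B ψ φ)
    {u v x w e : ℕ → ZMod (2 * M) → ℂ} (hu : IsPerturbedIntegrator ρ τ ψ φ u v fun _ _ => 0)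
    (hx : IsPerturbedIntegrator ρ τ ψ φ x w e) (n : ℕ) (j : ZMod (2 * M)) :
    modePair ρ (fun j => u (n + 1) j - x (n + 1) j) (fun j => v (n + 1) j - w (n + 1) j) j ≤
      modePair ρ (fun j => u n j - x n j) (fun j => v n j - w n j) j + τ * B *
        (‖filteredSquare ρ τ φ (u n) j - filteredSquare ρ τ φ (x n) j - e n j‖
          + ‖filteredSquare ρ τ φ (u (n + 1)) j - filteredSquare ρ τ φ (x (n + 1)) j
              - e (n + 1) j‖) ∧
    ‖(freq ρ (absIdx j) : ℂ) * (u (n + 1) j - x (n + 1) j)‖ ≤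
      modePair ρ (fun j => u n j - x n j) (fun j => v n j - w n j) j + τ * B *
        ‖filteredSquare ρ τ φ (u n) j - filteredSquare ρ τ φ (x n) j - e n j‖ := by
  have hτ := S.hτ
  have hB := S.B_nonneg
  have p1 := hu.position n j
  have p2 := hx.position n j
  have v1 := hu.velocity_step S n j
  have v2 := hx.velocity_step S n j
  have hα := S.alpha_pos j
  have hsym := S.filter.symplectic (τ * freq ρ (absIdx j))
  have hφ := S.filter.bound_φ (τ * freq ρ (absIdx j))
  have hω := freq_pos S.hρ (absIdx j)
  rw [hsym, Real.sinc_of_ne_zero hα.ne'] at p1 p2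
  set α := τ * freq ρ (absIdx j) with hαd
  set ω := freq ρ (absIdx j)
  have hτC : (τ : ℂ) ≠ 0 := by exact_mod_cast hτ.ne'
  have hωC : (ω : ℂ) ≠ 0 := by exact_mod_cast hω.ne'
  push_cast [-Complex.ofReal_sin, -Complex.ofReal_cos] at p1 p2
  have eα' : (α : ℂ) = τ * ω := by rw [hαd]; push_cast; rfl
  rw [eα'] at p1 p2
  set F := filteredSquare ρ τ φ (u n) j - filteredSquare ρ τ φ (x n) j - e n j with hF
  set F' := filteredSquare ρ τ φ (u (n + 1)) j - filteredSquare ρ τ φ (x (n + 1)) j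
    - e (n + 1) j with hF'
  -- `P` and `V` together are a rotation by `α` of the error pair plus kicks of size `O(τ)`; the
  -- rotation preserves `pairNorm`.
  have P : (ω : ℂ) * (u (n + 1) j - x (n + 1) j) =
      ((Real.cos α : ℂ) * (ω * (u n j - x n j)) + (Real.sin α : ℂ) * (v n j - w n j))
        + 1 / 2 * τ * φ α * (Real.sin α * F) := by
    rw [p1, p2, hF]
    field_simp
    ring
  have V : v (n + 1) j - w (n + 1) j =
      (-(Real.sin α : ℂ) * (ω * (u n j - x n j)) + (Real.cos α : ℂ) * (v n j - w n j))
        + 1 / 2 * τ * φ α * (Real.cos α * F + F') := by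
    rw [v1, v2, hF, hF']
    ring
  have hsn : ‖(Real.sin α : ℂ)‖ ≤ 1 := by
    rw [Complex.norm_real]; exact Real.abs_sin_le_one α
  have hcn : ‖(Real.cos α : ℂ)‖ ≤ 1 := by
    rw [Complex.norm_real]; exact Real.abs_cos_le_one α
  have hpre : ‖(1 / 2 * τ * φ α : ℂ)‖ ≤ 1 / 2 * τ * B := by
    rw [norm_mul, norm_mul, Complex.norm_real, Complex.norm_real, Real.norm_eq_abs,
      Real.norm_eq_abs, abs_of_pos hτ]
    have : ‖(1 / 2 : ℂ)‖ = 1 / 2 := by simp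
    rw [this]
    gcongr
  have n1 : ‖1 / 2 * τ * φ α * (Real.sin α * F)‖ ≤ 1 / 2 * τ * B * ‖F‖ := by
    rw [norm_mul]
    refine mul_le_mul hpre ?_ (norm_nonneg _) (by positivity)
    rw [norm_mul]; exact mul_le_of_le_one_left (norm_nonneg _) hsn
  have n2 : ‖1 / 2 * τ * φ α * (Real.cos α * F + F')‖ ≤ 1 / 2 * τ * B * (‖F‖ + ‖F'‖) := by
    rw [norm_mul]
    refine mul_le_mul hpre ((norm_add_le _ _).trans (add_le_add ?_ le_rfl)) (norm_nonneg _)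
      (by positivity)
    rw [norm_mul]; exact mul_le_of_le_one_left (norm_nonneg _) hcn
  have hrot := pairNorm_rotation α ((ω : ℂ) * (u n j - x n j)) (v n j - w n j)
  have q1 : 0 ≤ τ * B * ‖F‖ := by positivity
  have q2 : 0 ≤ τ * B * ‖F'‖ := by positivity
  constructor
  · show pairNorm ((ω : ℂ) * (u (n + 1) j - x (n + 1) j)) (v (n + 1) j - w (n + 1) j) ≤
      pairNorm ((ω : ℂ) * (u n j - x n j)) (v n j - w n j) + _
    rw [P, V]
    refine (pairNorm_add_le _ _ _ _).trans ?_
    rw [hrot]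
    linarith
  · show _ ≤ pairNorm ((ω : ℂ) * (u n j - x n j)) (v n j - w n j) + _
    rw [P]
    refine (norm_add_le _ _).trans (add_le_add ?_ (n1.trans (by linarith)))
    rw [← hrot]
    exact norm_fst_le_pairNorm _ _

set_option maxHeartbeats 1000000 in
/-- Stability: a solution of the perturbed scheme stays close to the numerical solution on the
unit time interval. -/
theorem exists_stability_bound {s : ℝ} (hs : 1 / 2 < s) (ρ B A : ℝ) (hA : 0 ≤ A) :
    ∃ L : ℝ, 1 ≤ L ∧ ∀ (K M : ℕ) [NeZero M] (τ ε ν γ : ℝ) (ψ φ : ℝ → ℝ),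
      NumSetup K M ρ τ ε ν γ B ψ φ →
      ∀ (u v x w e : ℕ → ZMod (2 * M) → ℂ) (δ : ℝ),
      IsPerturbedIntegrator ρ τ ψ φ u v (fun _ _ => 0) → IsPerturbedIntegrator ρ τ ψ φ x w e →
      x 0 = u 0 → w 0 = v 0 →
      (∀ n : ℕ, n * τ ≤ 1 → snorm s (fun j => ‖x n j‖) ≤ A) →
      (∀ n : ℕ, n * τ ≤ 1 → snorm s (fun j => ‖e n j‖) ≤ δ) → 0 ≤ δ → L * δ ≤ 1 →
      ∀ n : ℕ, n * τ ≤ 1 →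
        snorm s (modePair ρ (fun j => u n j - x n j) (fun j => v n j - w n j)) ≤ L * δ := by
  obtain ⟨Cs, hCs, hconv⟩ := exists_snorm_rconv_le hs
  set σ : ℝ := 1 / Real.sqrt ρ with hσ
  have hσ0 : 0 ≤ σ := by positivity
  set P : ℝ := B ^ 2 * Cs with hP
  have hP0 : 0 ≤ P := by positivity
  -- `L₁` and `L₂` are Lipschitz constants of the nonlinear error at the old and the new time level,
  -- and `c` bounds the new position error; all are valid while the error plus defect is at most
  -- `1`.
  set L₁ : ℝ := P * σ * (2 * A + σ) + 1 with hL₁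
  have hL₁0 : 0 ≤ L₁ := by positivity
  set c : ℝ := σ * (1 + |B| * L₁) with hc
  have hc0 : 0 ≤ c := by positivity
  set L₂ : ℝ := P * c * (2 * A + 2 * c) + 1 with hL₂
  have hL₂0 : 0 ≤ L₂ := by positivity
  set C₃ : ℝ := |B| * (L₁ + L₂) with hC₃
  have hC₃0 : 0 ≤ C₃ := by positivity
  refine ⟨Real.exp C₃, Real.one_le_exp hC₃0, ?_⟩
  intro K M _ τ ε ν γ ψ φ S u v x w e δ hu hx h0 h0' hxA heδ hδ hLδ
  have hB : |B| = B := abs_of_nonneg S.B_nonneg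
  have hB0 := S.B_nonneg
  have hτ := S.hτ
  have hρs := Real.sqrt_pos.2 S.hρ
  set Y : ℕ → ℝ := fun n =>
    snorm s (modePair ρ (fun j => u n j - x n j) (fun j => v n j - w n j)) with hY
  set R : ℕ → ℝ := fun n => snorm s (fun j => ‖u n j - x n j‖) with hR
  set F : ℕ → ZMod (2 * M) → ℝ := fun n j =>
    ‖filteredSquare ρ τ φ (u n) j - filteredSquare ρ τ φ (x n) j - e n j‖ with hF
  have hY0 : ∀ n, 0 ≤ Y n := fun n => snorm_nonneg _ _
  have hR0 : ∀ n, 0 ≤ R n := fun n => snorm_nonneg _ _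
  have hF0 : ∀ n j, 0 ≤ F n j := fun n j => norm_nonneg _
  have hfreq : ∀ (n : ℕ) (j : ZMod (2 * M)), ‖u n j - x n j‖ ≤
      σ * ‖(freq ρ (absIdx j) : ℂ) * (u n j - x n j)‖ := by
    intro n j
    rw [norm_mul, Complex.norm_real, Real.norm_eq_abs, abs_of_pos (freq_pos S.hρ _), ← mul_assoc]
    refine le_mul_of_one_le_left (norm_nonneg _) ?_
    rw [hσ, one_div, inv_mul_eq_div, le_div_iff₀ hρs, one_mul]
    exact sqrt_le_freq _
  have hRY : ∀ n, R n ≤ σ * Y n := by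
    intro n
    have : snorm s (fun j => σ * modePair ρ (fun j => u n j - x n j) (fun j => v n j - w n j) j)
        = σ * Y n := by rw [snorm_mul_left, abs_of_nonneg hσ0]
    rw [← this]
    exact snorm_mono' (fun j => norm_nonneg _) fun j => (hfreq n j).trans
      (mul_le_mul_of_nonneg_left (norm_fst_le_pairNorm _ _) hσ0)
  have hFn : ∀ n : ℕ, n * τ ≤ 1 → snorm s (F n) ≤ P * R n * (2 * A + R n) + δ := by
    intro n hn
    have hun : snorm s (fun j => ‖u n j‖) ≤ R n + A := by
      refine (snorm_mono' (fun j => norm_nonneg _) fun j => ?_).trans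
        ((snorm_add_le s (fun j => ‖u n j - x n j‖) (fun j => ‖x n j‖)).trans
          (add_le_add le_rfl (hxA n hn)))
      have := norm_add_le (u n j - x n j) (x n j)
      rwa [sub_add_cancel] at this
    have h1 : ∀ j, F n j ≤ B ^ 2 * (rconv (fun j => ‖u n j - x n j‖) (fun j => ‖u n j‖) j
        + rconv (fun j => ‖x n j‖) (fun j => ‖u n j - x n j‖) j) + ‖e n j‖ := fun j =>
      (norm_sub_le _ _).trans (add_le_add (norm_filteredSquare_sub_le S (u n) (x n) j) le_rfl)
    refine (snorm_mono' (hF0 n) h1).trans ((snorm_add_le _ _ _).trans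
      (add_le_add ?_ (heδ n hn)))
    rw [snorm_mul_left, abs_of_nonneg (by positivity)]
    have h2 := (snorm_add_le s _ _).trans (add_le_add
      (hconv M (fun j => ‖u n j - x n j‖) (fun j => ‖u n j‖))
      (hconv M (fun j => ‖x n j‖) (fun j => ‖u n j - x n j‖)))
    have hRn := hR0 n
    have hxn := hxA n hn
    have hx0 := snorm_nonneg s (fun j => ‖x n j‖)
    calc _ ≤ B ^ 2 * (Cs * R n * (R n + A) + Cs * A * R n) := by
          refine mul_le_mul_of_nonneg_left (h2.trans ?_) (by positivity)
          show Cs * R n * _ + Cs * _ * R n ≤ _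
          gcongr
      _ = P * R n * (2 * A + R n) := by rw [hP]; ring
  -- Carrying `δ` inside the estimated quantity makes the recursion purely geometric.
  have hmain : ∀ n : ℕ, n * τ ≤ 1 → Y n + δ ≤ (1 + τ * C₃) ^ n * δ := by
    intro n
    induction n with
    | zero =>
      intro _
      have : Y 0 = 0 := by
        simp [hY, h0, h0', modePair, pairNorm, snorm]
      rw [this]; simp
    | succ n ih =>
      intro hn
      push_cast at hn
      have hn' : (n : ℝ) * τ ≤ 1 := by nlinarith
      have hτ1 : τ ≤ 1 := by nlinarith [Nat.cast_nonneg (α := ℝ) n]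
      have hih := ih hn'
      -- Bootstrap: the induction hypothesis and `L * δ ≤ 1` keep the error at most `1`, so that the
      -- quadratic terms stay linearly bounded.
      have hexp : (1 + τ * C₃) ^ n * δ ≤ 1 := by
        refine le_trans (mul_le_mul_of_nonneg_right ?_ hδ) hLδ
        calc (1 + τ * C₃) ^ n ≤ (Real.exp (τ * C₃)) ^ n := by
              gcongr; rw [add_comm]; exact Real.add_one_le_exp _
          _ = Real.exp (n * (τ * C₃)) := (Real.exp_nat_mul _ n).symm
          _ ≤ Real.exp C₃ := by
              rw [Real.exp_le_exp, ← mul_assoc]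
              exact mul_le_of_le_one_left hC₃0 hn'
      have hYn := hY0 n
      set Z := Y n + δ with hZ
      have hZ1 : Z ≤ 1 := hih.trans hexp
      have hZ0 : 0 ≤ Z := by positivity
      have hYZ : Y n ≤ Z := by linarith
      have hδZ : δ ≤ Z := by linarith
      have hFZ : snorm s (F n) ≤ L₁ * Z := by
        have hRn : R n ≤ σ * Z := (hRY n).trans (by gcongr)
        have hRn1 : R n ≤ σ := hRn.trans (mul_le_of_le_one_right hσ0 hZ1)
        have := hR0 n
        calc snorm s (F n) ≤ P * R n * (2 * A + R n) + δ := hFn n hn'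
          _ ≤ P * (σ * Z) * (2 * A + σ) + Z := by gcongr
          _ = L₁ * Z := by rw [hL₁]; ring
      -- The velocity kick contains the nonlinearity at the new time, but the new position depends
      -- only on old data; bounding it first avoids an implicit inequality and any smallness of `τ`
      -- beyond `τ ≤ 1`.
      have hRs : R (n + 1) ≤ c * Z := by
        have h1 : ∀ j, ‖u (n + 1) j - x (n + 1) j‖ ≤ σ *
            (modePair ρ (fun j => u n j - x n j) (fun j => v n j - w n j) j + τ * B * F n j) :=
          fun j => (hfreq (n + 1) j).trans
            (mul_le_mul_of_nonneg_left (hu.modePair_step S hx n j).2 hσ0)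
        refine (snorm_mono' (fun j => norm_nonneg _) h1).trans ?_
        rw [snorm_mul_left, abs_of_nonneg hσ0, hc, mul_assoc]
        refine mul_le_mul_of_nonneg_left ((snorm_add_le _ _ _).trans ?_) hσ0
        rw [snorm_mul_left, abs_of_nonneg (by positivity), add_mul, one_mul, hB]
        refine add_le_add hYZ ?_
        have hFn0 := snorm_nonneg s (F n)
        calc τ * B * snorm s (F n) ≤ 1 * B * (L₁ * Z) := by gcongr
          _ = _ := by ring
      have hFZ' : snorm s (F (n + 1)) ≤ L₂ * Z := by
        have hRn1 : R (n + 1) ≤ 2 * c := hRs.trans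
          ((mul_le_of_le_one_right hc0 hZ1).trans (by linarith))
        have := hR0 (n + 1)
        calc snorm s (F (n + 1)) ≤ P * R (n + 1) * (2 * A + R (n + 1)) + δ :=
              hFn (n + 1) (by push_cast; exact hn)
          _ ≤ P * (c * Z) * (2 * A + 2 * c) + Z := by gcongr
          _ = L₂ * Z := by rw [hL₂]; ring
      have hYs : Y (n + 1) ≤ Y n + τ * B * (L₁ * Z + L₂ * Z) := by
        refine (snorm_mono' (fun j => pairNorm_nonneg _ _)
          fun j => (hu.modePair_step S hx n j).1).trans ((snorm_add_le _ _ _).trans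
            (add_le_add le_rfl ?_))
        rw [snorm_mul_left, abs_of_nonneg (by positivity)]
        refine mul_le_mul_of_nonneg_left ((snorm_add_le _ _ _).trans (add_le_add hFZ hFZ'))
          (by positivity)
      calc Y (n + 1) + δ ≤ (1 + τ * C₃) * Z := by rw [hC₃, hB]; linarith
        _ ≤ (1 + τ * C₃) * ((1 + τ * C₃) ^ n * δ) := by gcongr
        _ = _ := by rw [pow_succ]; ring
  intro n hn
  have h1 := hmain n hn
  have h2 : (1 + τ * C₃) ^ n ≤ Real.exp C₃ := by
    calc (1 + τ * C₃) ^ n ≤ (Real.exp (τ * C₃)) ^ n := by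
          gcongr; rw [add_comm]; exact Real.add_one_le_exp _
      _ = Real.exp (n * (τ * C₃)) := (Real.exp_nat_mul _ n).symm
      _ ≤ Real.exp C₃ := by
          rw [Real.exp_le_exp, ← mul_assoc]
          exact mul_le_of_le_one_left hC₃0 hn
  have h3 := mul_le_mul_of_nonneg_right h2 hδ
  show Y n ≤ _
  linarith

end Stability

/-! ### Modulated Fourier expansions with small defect -/

section Expansion
variable {K M : ℕ} {ρ τ ε ν γ B : ℝ} {ψ φ : ℝ → ℝ}

theorem phase_add_time (ρ : ℝ) {M : ℕ} (k : Fin (M + 1) → ℤ) (t t' : ℝ) :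
    phase ρ k (t + t') = phase ρ k t * phase ρ k t' := by
  unfold phase
  rw [← Complex.exp_add]
  congr 1; push_cast; ring

theorem norm_phase (ρ : ℝ) {M : ℕ} (k : Fin (M + 1) → ℤ) (t : ℝ) : ‖phase ρ k t‖ = 1 := by
  have : Complex.I * (dotFreq ρ k : ℂ) * (t : ℂ) = ((dotFreq ρ k * t : ℝ) : ℂ) * Complex.I := by
    push_cast; ring
  rw [phase, this, Complex.norm_exp_ofReal_mul_I]

theorem exp_mul_dotFreq (ρ τ : ℝ) {M : ℕ} (k : Fin (M + 1) → ℤ) :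
    Complex.exp (((τ * dotFreq ρ k : ℝ) : ℂ) * Complex.I) = phase ρ k τ := by
  unfold phase; congr 1; push_cast; ring

theorem exp_neg_mul_dotFreq (ρ τ : ℝ) {M : ℕ} (k : Fin (M + 1) → ℤ) :
    Complex.exp (-((τ * dotFreq ρ k : ℝ) : ℂ) * Complex.I) = phase ρ k (-τ) := by
  unfold phase; congr 1; push_cast; ring

theorem eval_modOp (ρ τ ε ν α t : ℝ) {M : ℕ} (k : Fin (M + 1) → ℤ) (p : ℂ[X]) :
    (modOp (τ * dotFreq ρ k) α (ε ^ (ν / 2) * τ) p).eval ((ε ^ (ν / 2) * t : ℝ) : ℂ)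
      = phase ρ k τ * slowEval ε ν p (t + τ) - 2 * (Real.cos α : ℂ) * slowEval ε ν p t
        + phase ρ k (-τ) * slowEval ε ν p (t - τ) := by
  rw [modOp_apply, exp_mul_dotFreq, exp_neg_mul_dotFreq]
  simp only [eval_add, eval_sub, eval_smul, taylor_eval, smul_eq_mul, slowEval]
  congr 4 <;> push_cast <;> ring

theorem NumSetup.norm_slow_le_one (S : NumSetup K M ρ τ ε ν γ B ψ φ) {t : ℝ} (h0 : 0 ≤ t)
    (h1 : t ≤ 1) : ‖((ε ^ (ν / 2) * t : ℝ) : ℂ)‖ ≤ 1 := by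
  rw [Complex.norm_real, Real.norm_eq_abs, abs_of_nonneg (mul_nonneg S.q_pos.le h0)]
  exact mul_le_one₀ S.q_le_one h0 h1

theorem NumSetup.norm_mfe_le (S : NumSetup K M ρ τ ε ν γ B ψ φ)
    (z : ZMod (2 * M) → (Fin (M + 1) → ℤ) → ℂ[X]) {t : ℝ} (h0 : 0 ≤ t) (h1 : t ≤ 1)
    (j : ZMod (2 * M)) : ‖mfe K ρ ε ν z t j‖ ≤ modSum K (modWeight K ε ν) z j := by
  refine (norm_sum_le _ _).trans (Finset.sum_le_sum fun k _ => ?_)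
  rw [norm_mul, norm_phase, mul_one]
  exact (norm_eval_le_pnorm _ (S.norm_slow_le_one h0 h1)).trans
    (le_mul_of_one_le_left (pnorm_nonneg _) (S.one_le_modWeight j k))

variable [NeZero M]

theorem eval_modNonlin (x : ℂ) (z : ZMod (2 * M) → (Fin (M + 1) → ℤ) → ℂ[X]) (j : ZMod (2 * M))
    (k : Fin (M + 1) → ℤ) :
    (modNonlin K ρ τ φ z j k).eval x =
      modConv K (fun j k => (φ (τ * freq ρ (absIdx j)) : ℂ) * (z j k).eval x)
        (fun j k => (φ (τ * freq ρ (absIdx j)) : ℂ) * (z j k).eval x) j k := by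
  have h := map_modConv (K := K) (Polynomial.evalRingHom x) (phiMul ρ τ φ z) (phiMul ρ τ φ z) j k
  simpa [phiMul, modNonlin] using h

/-- The defect of the modulation functions `z` that solve the system with nonlinearity
evaluated at `y`, as a function of slow time. -/
noncomputable def modDefect (K : ℕ) (ρ τ : ℝ) (φ : ℝ → ℝ) {M : ℕ} [NeZero M]
    (y z : ZMod (2 * M) → (Fin (M + 1) → ℤ) → ℂ[X]) (j : ZMod (2 * M)) (k : Fin (M + 1) → ℤ)
    (x : ℝ) : ℂ :=
  (modNonlin K ρ τ φ y j k).eval (x : ℂ) - (modNonlin K ρ τ φ z j k).eval (x : ℂ)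

variable {a b : ZMod (2 * M) → ℂ} {y z : ZMod (2 * M) → (Fin (M + 1) → ℤ) → ℂ[X]}

theorem IsModIterate.eval_eqn (h : IsModIterate K ρ τ ε ν ψ φ a b y z) (t : ℝ) (j : ZMod (2 * M))
    {k : Fin (M + 1) → ℤ} (hk : k ∈ modSet K j) :
    phase ρ k τ * slowEval ε ν (z j k) (t + τ)
      - 2 * (Real.cos (τ * freq ρ (absIdx j)) : ℂ) * slowEval ε ν (z j k) t
      + phase ρ k (-τ) * slowEval ε ν (z j k) (t - τ)
    = (τ : ℂ) ^ 2 * (ψ (τ * freq ρ (absIdx j)) : ℂ) *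
        ((modNonlin K ρ τ φ z j k).eval ((ε ^ (ν / 2) * t : ℝ) : ℂ)
          + modDefect K ρ τ φ y z j k (ε ^ (ν / 2) * t)) := by
  rw [← eval_modOp, h.eqn j k hk, eval_smul, smul_eq_mul, modDefect]
  push_cast; ring

theorem IsModIterate.satisfiesModSystem (hK : 3 ≤ K) (h : IsModIterate K ρ τ ε ν ψ φ a b y z) :
    SatisfiesModSystem K ρ τ ε ν ψ φ z (modDefect K ρ τ φ y z) := by
  intro j k hk t
  rw [h.eval_eqn t j hk, gradPotential_neg hK hk, eval_modNonlin]
  simp only [slowEval]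
  ring

/-- The defect of the modulated Fourier expansion in the trigonometric integrator. -/
noncomputable def mfeDefect (K : ℕ) (ρ τ ε ν : ℝ) (φ : ℝ → ℝ) {M : ℕ} [NeZero M]
    (y z : ZMod (2 * M) → (Fin (M + 1) → ℤ) → ℂ[X]) (t : ℝ) (j : ZMod (2 * M)) : ℂ :=
  ∑ k ∈ modFinset K j, modDefect K ρ τ φ y z j k (ε ^ (ν / 2) * t) * phase ρ k t
    - truncTerm K
        (fun j k => (φ (τ * freq ρ (absIdx j)) : ℂ) * slowEval ε ν (z j k) t * phase ρ k t)
        (fun j k => (φ (τ * freq ρ (absIdx j)) : ℂ) * slowEval ε ν (z j k) t * phase ρ k t) j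

/-- The nonlinearity of the expansion equals the modulation nonlinearity plus the frequencies thrown
away outside `𝒦_j`; the latter form the second part of the defect. -/
theorem filteredSquare_mfe (z : ZMod (2 * M) → (Fin (M + 1) → ℤ) → ℂ[X]) (t : ℝ)
    (j : ZMod (2 * M)) :
    filteredSquare ρ τ φ (mfe K ρ ε ν z t) j =
      ∑ k ∈ modFinset K j,
        (modNonlin K ρ τ φ z j k).eval ((ε ^ (ν / 2) * t : ℝ) : ℂ) * phase ρ k t
      + truncTerm K
        (fun j k => (φ (τ * freq ρ (absIdx j)) : ℂ) * slowEval ε ν (z j k) t * phase ρ k t)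
        (fun j k => (φ (τ * freq ρ (absIdx j)) : ℂ) * slowEval ε ν (z j k) t * phase ρ k t) j := by
  simp only [eval_modNonlin, ← modConv_mul_phase]
  rw [show (fun j k => (φ (τ * freq ρ (absIdx j)) : ℂ) *
      (z j k).eval ((ε ^ (ν / 2) * t : ℝ) : ℂ) * phase ρ k t) =
      fun j k => (φ (τ * freq ρ (absIdx j)) : ℂ) * slowEval ε ν (z j k) t * phase ρ k t from rfl,
    ← sum_mul_sum_eq_modConv_add_truncTerm]
  simp only [filteredSquare, discConv, diagMul, mfe, Finset.mul_sum, mul_assoc]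

theorem IsModIterate.mfe_recursion (h : IsModIterate K ρ τ ε ν ψ φ a b y z) (t : ℝ)
    (j : ZMod (2 * M)) :
    mfe K ρ ε ν z (t + τ) j - 2 * (Real.cos (τ * freq ρ (absIdx j)) : ℂ) * mfe K ρ ε ν z t j
      + mfe K ρ ε ν z (t - τ) j
    = (τ : ℂ) ^ 2 * ((ψ (τ * freq ρ (absIdx j)) : ℂ) *
        (filteredSquare ρ τ φ (mfe K ρ ε ν z t) j + mfeDefect K ρ τ ε ν φ y z t j)) := by
  rw [filteredSquare_mfe, mfeDefect, add_add_sub_cancel, ← Finset.sum_add_distrib]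
  simp only [mfe]
  rw [Finset.mul_sum, Finset.mul_sum, Finset.mul_sum, ← Finset.sum_sub_distrib,
    ← Finset.sum_add_distrib]
  refine Finset.sum_congr rfl fun k hk => ?_
  have h1 := h.eval_eqn t j (mem_modFinset.1 hk)
  rw [sub_eq_add_neg t τ, phase_add_time, phase_add_time, ← sub_eq_add_neg]
  linear_combination phase ρ k t * h1

theorem mfe_sub_mfe (S : NumSetup K M ρ τ ε ν γ B ψ φ)
    (z : ZMod (2 * M) → (Fin (M + 1) → ℤ) → ℂ[X]) (t : ℝ) (j : ZMod (2 * M)) :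
    2 * (τ : ℂ) * (Real.sinc (τ * freq ρ (absIdx j)) : ℂ) * mfeVel K ρ τ ε ν z t j
      = mfe K ρ ε ν z (t + τ) j - mfe K ρ ε ν z (t - τ) j := by
  have h0 : 2 * (τ : ℂ) * (Real.sinc (τ * freq ρ (absIdx j)) : ℂ) ≠ 0 := by
    refine mul_ne_zero (mul_ne_zero two_ne_zero (by exact_mod_cast S.hτ.ne')) ?_
    rw [Real.sinc_of_ne_zero (S.alpha_pos j).ne']
    exact_mod_cast div_ne_zero (S.sin_ne_zero j) (S.alpha_pos j).ne'
  rw [mfeVel, mul_inv_cancel_left₀ h0, mfe, mfe, ← Finset.sum_sub_distrib]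
  refine Finset.sum_congr rfl fun k _ => ?_
  rw [sub_eq_add_neg t τ, phase_add_time, phase_add_time]
  ring

theorem IsModIterate.mfe_zero (h : IsModIterate K ρ τ ε ν ψ φ a b y z) :
    mfe K ρ ε ν z 0 = a := by
  funext j
  rw [← h.init j]
  simp [mfe, slowEval, phase]

/-- The boundary condition imposed on the modulation functions was chosen as this identity
multiplied by `2τ sinc(τω_j)`. -/
theorem IsModIterate.mfeVel_zero (S : NumSetup K M ρ τ ε ν γ B ψ φ)
    (h : IsModIterate K ρ τ ε ν ψ φ a b y z) : mfeVel K ρ τ ε ν z 0 = b := by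
  funext j
  have h0 : 2 * (τ : ℂ) * (Real.sinc (τ * freq ρ (absIdx j)) : ℂ) ≠ 0 := by
    refine mul_ne_zero (mul_ne_zero two_ne_zero (by exact_mod_cast S.hτ.ne')) ?_
    rw [Real.sinc_of_ne_zero (S.alpha_pos j).ne']
    exact_mod_cast div_ne_zero (S.sin_ne_zero j) (S.alpha_pos j).ne'
  rw [mfeVel, inv_mul_eq_iff_eq_mul₀ h0, ← h.vel j]
  refine Finset.sum_congr rfl fun k _ => ?_
  rw [velTerm, exp_mul_dotFreq, exp_neg_mul_dotFreq]
  have e0 : phase ρ k 0 = 1 := by simp [phase]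
  rw [e0, slowEval, slowEval, zero_add, zero_sub]
  push_cast
  rw [mul_neg]
  ring

theorem IsModIterate.isPerturbedIntegrator (S : NumSetup K M ρ τ ε ν γ B ψ φ)
    (h : IsModIterate K ρ τ ε ν ψ φ a b y z) :
    IsPerturbedIntegrator ρ τ ψ φ (fun n : ℕ => mfe K ρ ε ν z (n * τ))
      (fun n : ℕ => mfeVel K ρ τ ε ν z (n * τ))
      (fun n : ℕ => mfeDefect K ρ τ ε ν φ y z (n * τ)) where
  start := fun j => by
    have h1 := h.mfe_recursion 0 j
    have h2 := mfe_sub_mfe S z 0 j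
    simp only [Nat.cast_one, one_mul, Nat.cast_zero, zero_mul]
    simp only [zero_add] at h1 h2
    linear_combination 1 / 2 * h1 - 1 / 2 * h2
  step := fun n j => by
    have h1 := h.mfe_recursion ((n + 1 : ℕ) * τ) j
    have e1 : ((n + 1 : ℕ) : ℝ) * τ + τ = ((n + 2 : ℕ) : ℝ) * τ := by push_cast; ring
    have e2 : ((n + 1 : ℕ) : ℝ) * τ - τ = (n : ℝ) * τ := by push_cast; ring
    rw [e1, e2] at h1
    exact h1
  velocity := fun n j => by
    have h1 := mfe_sub_mfe S z ((n + 1 : ℕ) * τ) j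
    have e1 : ((n + 1 : ℕ) : ℝ) * τ + τ = ((n + 2 : ℕ) : ℝ) * τ := by push_cast; ring
    have e2 : ((n + 1 : ℕ) : ℝ) * τ - τ = (n : ℝ) * τ := by push_cast; ring
    rw [e1, e2] at h1
    exact h1

/-- The defect is the difference of the nonlinearities at consecutive iterates, so it inherits their
unweighted distance. -/
theorem NumSetup.sum_norm_modDefect_le (S : NumSetup K M ρ τ ε ν γ B ψ φ)
    (y z : ZMod (2 * M) → (Fin (M + 1) → ℤ) → ℂ[X]) {t : ℝ} (h0 : 0 ≤ t) (h1 : t ≤ 1)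
    (j : ZMod (2 * M)) :
    ∑ k ∈ modFinset K j, ‖modDefect K ρ τ φ y z j k (ε ^ (ν / 2) * t)‖ ≤
      B ^ 2 * (rconv (modSum K (modWeight K ε ν) z)
          (modSum K (fun _ _ => 1) fun j k => z j k - y j k) j
        + rconv (modSum K (fun _ _ => 1) fun j k => z j k - y j k)
          (modSum K (modWeight K ε ν) y) j) := by
  refine le_trans (Finset.sum_le_sum fun k _ => ?_) (S.modSum_modNonlin_sub_le
    (V := fun _ _ => 1) (W' := fun _ _ => 1)
    (fun _ _ => zero_le_one) (fun j k => (S.modWeight_pos j k).le) (fun _ _ => zero_le_one)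
    (fun _ _ _ _ _ _ _ => by rw [mul_one]; exact S.one_le_modWeight _ _)
    (fun _ _ _ _ _ _ _ => by rw [one_mul]; exact S.one_le_modWeight _ _) z y j)
  rw [one_mul, modDefect, norm_sub_rev, ← eval_sub]
  exact norm_eval_le_pnorm _ (S.norm_slow_le_one h0 h1)

theorem NumSetup.norm_truncTerm_le (S : NumSetup K M ρ τ ε ν γ B ψ φ)
    (z : ZMod (2 * M) → (Fin (M + 1) → ℤ) → ℂ[X]) {t : ℝ} (h0 : 0 ≤ t) (h1 : t ≤ 1)
    (j : ZMod (2 * M)) :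
    ‖truncTerm K
        (fun j k => (φ (τ * freq ρ (absIdx j)) : ℂ) * slowEval ε ν (z j k) t * phase ρ k t)
        (fun j k => (φ (τ * freq ρ (absIdx j)) : ℂ) * slowEval ε ν (z j k) t * phase ρ k t) j‖ ≤
      ε ^ ((K : ℝ) - K * ν) * (B ^ 2 *
        rconv (modSum K (modWeight K ε ν) z) (modSum K (modWeight K ε ν) z) j) := by
  have hW : ∀ (j : ZMod (2 * M)) (k : Fin (M + 1) → ℤ), 0 ≤ modWeight K ε ν j k :=
    fun j k => (S.modWeight_pos j k).le
  have hc : 0 ≤ ε ^ ((K : ℝ) - K * ν) := Real.rpow_nonneg S.hε.le _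
  refine (_root_.norm_truncTerm_le (W := modWeight K ε ν) (P := phiMul ρ τ φ z) hc ?_ hW ?_ j).trans
    (mul_le_mul_of_nonneg_left ?_ hc)
  · intro j₁ j₂ k₁ _ k₂ _ hk
    rw [modWeight, modWeight, ← Real.rpow_add S.hε, ← Real.rpow_add S.hε]
    refine Real.one_le_rpow_of_pos_of_le_one_of_nonpos S.hε S.hε1 ?_
    have := le_sizeExp_add_of_notMem S.hK S.hν0 S.hν hk
    linarith
  · intro j k
    rw [norm_mul, norm_phase, mul_one, norm_mul, phiMul, pnorm_C_mul]
    exact mul_le_mul_of_nonneg_left (norm_eval_le_pnorm _ (S.norm_slow_le_one h0 h1))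
      (norm_nonneg _)
  · refine (rconv_mono (modSum_nonneg hW _) (modSum_nonneg hW _) (S.modSum_phiMul_le hW z)
      (S.modSum_phiMul_le hW z) j).trans (le_of_eq ?_)
    rw [rconv_mul_left, rconv_mul_right]; ring

/-- The modulated Fourier expansion together with its error bounds in the unweighted norm. -/
theorem exists_expansion (K : ℕ) (ρ ν γ B : ℝ) {s : ℝ} (hs : 1 / 2 < s) (hν : ν < 1 / 2) (D : ℝ) :
    ∃ A : ℝ, 0 ≤ A ∧ ∀ (M : ℕ) [NeZero M] (τ ε : ℝ) (ψ φ : ℝ → ℝ),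
      NumSetup K M ρ τ ε ν γ B ψ φ →
      ∀ a b : ZMod (2 * M) → ℂ, IsRealData a → IsRealData b →
      snorm s (fun j => diagWeight K ε j * (‖a j‖ + ‖b j‖)) ≤ D →
      ∃ y z : ZMod (2 * M) → (Fin (M + 1) → ℤ) → ℂ[X],
        IsModIterate K ρ τ ε ν ψ φ a b y z ∧
        ∀ t : ℝ, 0 ≤ t → t ≤ 1 →
          snorm s (fun j => ‖mfe K ρ ε ν z t j‖) ≤ A ∧
          snorm s (fun j => ∑ k ∈ modFinset K j,
            ‖modDefect K ρ τ φ y z j k (ε ^ (ν / 2) * t)‖) ≤ A * ε ^ ((K : ℝ) - K * ν) ∧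
          snorm s (fun j => ‖mfeDefect K ρ τ ε ν φ y z t j‖) ≤ A * ε ^ ((K : ℝ) - K * ν) := by
  -- Enough iterations for `(ε^{1/2-ν})^m ≤ ε^K`, which is below the truncation error `ε^{K-Kν}`.
  obtain ⟨m, hm⟩ := exists_nat_ge ((K : ℝ) / (1 / 2 - ν))
  rw [div_le_iff₀ (by linarith)] at hm
  obtain ⟨N, A, hA, H⟩ := exists_modIterate K ρ ν γ B hs D m
  obtain ⟨Cs, hCs, hconv⟩ := exists_snorm_rconv_le hs
  refine ⟨A + 3 * (B ^ 2 * Cs * A ^ 2), by positivity, ?_⟩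
  intro M _ τ ε ψ φ S a b ha hb hD
  obtain ⟨y, z, hyz, -, -, hyA, hzA, hδ⟩ := H M τ ε ψ φ S a b ha hb hD
  refine ⟨y, z, hyz, fun t h0 h1 => ?_⟩
  have hW : ∀ (j : ZMod (2 * M)) (k : Fin (M + 1) → ℤ), 0 ≤ modWeight K ε ν j k :=
    fun j k => (S.modWeight_pos j k).le
  set κ : ℝ := ε ^ ((K : ℝ) - K * ν) with hκ
  have hκ0 : 0 ≤ κ := Real.rpow_nonneg S.hε.le _
  have hβ : (ε ^ (1 / 2 - ν)) ^ m ≤ κ := by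
    rw [← Real.rpow_natCast, ← Real.rpow_mul S.hε.le]
    refine Real.rpow_le_rpow_of_exponent_ge S.hε S.hε1 ?_
    have : 0 ≤ (K : ℝ) * ν := mul_nonneg (Nat.cast_nonneg _) S.hν0
    linarith
  have hδ' : snorm s (modSum K (fun _ _ => 1) fun j k => z j k - y j k) ≤ A * κ :=
    hδ.trans (mul_le_mul_of_nonneg_left hβ hA)
  have p1 := snorm_nonneg s (modSum K (modWeight K ε ν) z)
  have p2 := snorm_nonneg s (modSum K (modWeight K ε ν) y)
  have p3 := snorm_nonneg s (modSum K (fun _ _ => 1) fun (j : ZMod (2 * M)) k => z j k - y j k)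
  have hd : snorm s (fun j => ∑ k ∈ modFinset K j,
      ‖modDefect K ρ τ φ y z j k (ε ^ (ν / 2) * t)‖) ≤ 2 * (B ^ 2 * Cs * A ^ 2) * κ := by
    refine (snorm_mono' (fun j => Finset.sum_nonneg fun _ _ => norm_nonneg _)
      (S.sum_norm_modDefect_le y z h0 h1)).trans ?_
    rw [snorm_mul_left, abs_of_nonneg (by positivity)]
    have h2 := (snorm_add_le s _ _).trans (add_le_add (hconv M
      (modSum K (modWeight K ε ν) z) (modSum K (fun _ _ => 1) fun j k => z j k - y j k))
      (hconv M (modSum K (fun _ _ => 1) fun j k => z j k - y j k)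
        (modSum K (modWeight K ε ν) y)))
    refine (mul_le_mul_of_nonneg_left h2 (by positivity)).trans ?_
    calc _ ≤ B ^ 2 * (Cs * A * (A * κ) + Cs * (A * κ) * A) := by gcongr
      _ = _ := by ring
  have ht : snorm s (fun j => κ * (B ^ 2 *
      rconv (modSum K (modWeight K ε ν) z) (modSum K (modWeight K ε ν) z) j))
      ≤ (B ^ 2 * Cs * A ^ 2) * κ := by
    rw [snorm_mul_left, abs_of_nonneg hκ0, snorm_mul_left, abs_of_nonneg (by positivity)]
    have h2 := hconv M (modSum K (modWeight K ε ν) z) (modSum K (modWeight K ε ν) z)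
    calc _ ≤ κ * (B ^ 2 * (Cs * A * A)) := by
          refine mul_le_mul_of_nonneg_left (mul_le_mul_of_nonneg_left (h2.trans ?_)
            (by positivity)) hκ0
          gcongr
      _ = _ := by ring
  have hP : 0 ≤ B ^ 2 * Cs * A ^ 2 := by positivity
  have hPκ := mul_nonneg hP hκ0
  have hAκ := mul_nonneg hA hκ0
  refine ⟨?_, hd.trans (by linarith), ?_⟩
  · refine (snorm_mono' (fun j => norm_nonneg _) (S.norm_mfe_le z h0 h1)).trans (hzA.trans ?_)
    linarith
  · refine (snorm_mono' (fun j => norm_nonneg _) (w := fun j =>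
      (∑ k ∈ modFinset K j, ‖modDefect K ρ τ φ y z j k (ε ^ (ν / 2) * t)‖) + κ * (B ^ 2 *
        rconv (modSum K (modWeight K ε ν) z) (modSum K (modWeight K ε ν) z) j)) fun j => ?_).trans
      ((snorm_add_le _ _ _).trans ((add_le_add hd ht).trans (by linarith)))
    refine (norm_sub_le _ _).trans (add_le_add ((norm_sum_le _ _).trans
      (Finset.sum_le_sum fun k _ => ?_)) (S.norm_truncTerm_le z h0 h1 j))
    rw [norm_mul, norm_phase, mul_one]

end Expansion

/-! ### Initial values and weighted norms -/

section Initial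
variable {M : ℕ}

theorem eq_absIdx_or_eq_neg (j : ZMod (2 * M)) :
    j = (absIdx j : ZMod (2 * M)) ∨ j = -(absIdx j : ZMod (2 * M)) := by
  have h := ZMod.coe_valMinAbs j
  rcases Int.natAbs_eq j.valMinAbs with h1 | h1
  · left
    rw [h1, Int.cast_natCast] at h
    exact h.symm
  · right
    rw [h1, Int.cast_neg, Int.cast_natCast] at h
    exact h.symm

theorem modeEnergy_absIdx {ρ : ℝ} {a b : ZMod (2 * M) → ℂ} (ha : IsRealData a)
    (hb : IsRealData b) (j : ZMod (2 * M)) :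
    modeEnergy ρ a b (absIdx j : ZMod (2 * M)) = modeEnergy ρ a b j := by
  rcases eq_absIdx_or_eq_neg j with h | h
  · rw [← h]
  · have h' : (absIdx j : ZMod (2 * M)) = -j := by rw [eq_comm, neg_eq_iff_eq_neg]; exact h
    rw [h']
    unfold modeEnergy
    rw [ha j, hb j, absIdx_neg, norm_mul, norm_mul, RCLike.norm_conj, RCLike.norm_conj]

variable [NeZero M]

/-- Each value of `|j|` is attained by at most the two indices `±l`. -/
theorem sum_comp_absIdx_le {f : ℕ → ℝ} (hf : ∀ l, 0 ≤ f l) :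
    ∑ j : ZMod (2 * M), f (absIdx j) ≤ 2 * ∑ l ∈ Finset.range (M + 1), f l := by
  classical
  rw [← Finset.sum_fiberwise_of_maps_to (s := Finset.univ) (t := Finset.range (M + 1))
    (g := fun j : ZMod (2 * M) => absIdx j)
    (fun j _ => Finset.mem_range.2 (Nat.lt_succ_of_le (absIdx_le j))), Finset.mul_sum]
  refine Finset.sum_le_sum fun l _ => ?_
  have h1 : ∑ j ∈ Finset.univ.filter (fun j : ZMod (2 * M) => absIdx j = l), f (absIdx j)
      = ((Finset.univ.filter (fun j : ZMod (2 * M) => absIdx j = l)).card : ℝ) * f l := by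
    rw [← nsmul_eq_mul, ← Finset.sum_const]
    exact Finset.sum_congr rfl fun j hj => by rw [(Finset.mem_filter.1 hj).2]
  rw [h1]
  refine mul_le_mul_of_nonneg_right ?_ (hf l)
  have h2 : (Finset.univ.filter (fun j : ZMod (2 * M) => absIdx j = l)) ⊆
      {(l : ZMod (2 * M)), -(l : ZMod (2 * M))} := by
    intro j hj
    have := (Finset.mem_filter.1 hj).2
    rcases eq_absIdx_or_eq_neg j with h | h <;> rw [this] at h <;> simp [← h]
  exact_mod_cast (Finset.card_le_card h2).trans Finset.card_le_two

theorem snorm_initial_le {K : ℕ} {ρ ε s C₀ : ℝ} (hρ : 0 < ρ) (hε : 0 < ε)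
    {a b : ZMod (2 * M) → ℂ} (ha : IsRealData a) (hb : IsRealData b)
    (hE : ∑ l ∈ Finset.range (M + 1), sobWeight s l * ε ^ (-(profile K l : ℝ)) *
      modeEnergy ρ a b (l : ZMod (2 * M)) ≤ C₀) :
    snorm s (fun j => diagWeight K ε j * (‖a j‖ + ‖b j‖)) ≤
      Real.sqrt (8 * (1 / ρ + 1) * C₀) := by
  have hE0 : ∀ j, 0 ≤ modeEnergy ρ a b j := fun j => by unfold modeEnergy; positivity
  refine Real.sqrt_le_sqrt ?_
  have h1 : ∀ j : ZMod (2 * M), sobWeight s (absIdx j) * (diagWeight K ε j * (‖a j‖ + ‖b j‖)) ^ 2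
      ≤ 4 * (1 / ρ + 1) * (sobWeight s (absIdx j) * ε ^ (-(profile K (absIdx j) : ℝ)) *
        modeEnergy ρ a b (absIdx j : ZMod (2 * M))) := by
    intro j
    have hw : diagWeight K ε j ^ 2 = ε ^ (-(profile K (absIdx j) : ℝ)) := by
      rw [diagWeight, ← Real.rpow_natCast, ← Real.rpow_mul hε.le]
      congr 1; push_cast; ring
    -- `ω_j² ≥ ρ` bounds the position by the energy with constant `2/ρ`, the velocity with constant
    -- `2`, and squaring the sum costs another `2`.
    have hab : (‖a j‖ + ‖b j‖) ^ 2 ≤ 4 * (1 / ρ + 1) * modeEnergy ρ a b j := by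
      have hfreq : freq ρ (absIdx j) ^ 2 = (absIdx j : ℝ) ^ 2 + ρ := Real.sq_sqrt (by positivity)
      have e1 : modeEnergy ρ a b j =
          1 / 2 * (((absIdx j : ℝ) ^ 2 + ρ) * ‖a j‖ ^ 2) + 1 / 2 * ‖b j‖ ^ 2 := by
        rw [modeEnergy, norm_mul, mul_pow, Complex.norm_real, Real.norm_eq_abs, sq_abs, hfreq]
      have e2 : ρ * ‖a j‖ ^ 2 + ‖b j‖ ^ 2 ≤ 2 * modeEnergy ρ a b j := by
        rw [e1]
        have : 0 ≤ (absIdx j : ℝ) ^ 2 * ‖a j‖ ^ 2 := by positivity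
        linarith
      have e3 : ‖a j‖ ^ 2 ≤ 1 / ρ * (2 * modeEnergy ρ a b j) := by
        rw [one_div, inv_mul_eq_div, le_div_iff₀ hρ]
        linarith [sq_nonneg ‖b j‖]
      have e4 : 0 ≤ ρ * ‖a j‖ ^ 2 := by positivity
      linarith [sq_nonneg (‖a j‖ - ‖b j‖)]
    rw [modeEnergy_absIdx ha hb, mul_pow, hw]
    have hp : 0 ≤ sobWeight s (absIdx j) * ε ^ (-(profile K (absIdx j) : ℝ)) :=
      mul_nonneg (sobWeight_pos _ _).le (Real.rpow_nonneg hε.le _)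
    have := mul_le_mul_of_nonneg_left hab hp
    linarith
  refine (Finset.sum_le_sum fun j _ => h1 j).trans ?_
  rw [← Finset.mul_sum]
  have h2 := sum_comp_absIdx_le (M := M) (f := fun l => sobWeight s l * ε ^ (-(profile K l : ℝ)) *
      modeEnergy ρ a b (l : ZMod (2 * M))) fun l =>
    mul_nonneg (mul_nonneg (sobWeight_pos _ _).le (Real.rpow_nonneg hε.le _)) (hE0 _)
  have h3 : 0 ≤ 4 * (1 / ρ + 1) := by positivity
  calc _ ≤ 4 * (1 / ρ + 1) * (2 * C₀) := mul_le_mul_of_nonneg_left (by linarith) h3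
    _ = _ := by ring

/-- Since `e(j) ≤ K`, the weights cost at most `ε^{-Kν}` uniformly in `j`. -/
theorem wnorm_le {K : ℕ} (hK : 3 ≤ K) {s ν ε : ℝ} (hν0 : 0 ≤ ν) (hε : 0 < ε) (hε1 : ε ≤ 1)
    (v : ZMod (2 * M) → ℂ) :
    wnorm K s ν ε v ≤ ε ^ (-(K * ν)) * snorm s (fun j => ‖v j‖) := by
  have h0 : 0 ≤ ε ^ (-(K * ν)) := Real.rpow_nonneg hε.le _
  rw [← abs_of_nonneg h0, ← snorm_mul_left]
  refine Real.sqrt_le_sqrt (Finset.sum_le_sum fun j _ => ?_)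
  rw [mul_pow, ← mul_assoc]
  refine mul_le_mul_of_nonneg_right (mul_le_mul_of_nonneg_left ?_ (sobWeight_pos _ _).le)
    (sq_nonneg _)
  rw [← Real.rpow_natCast, ← Real.rpow_mul hε.le]
  refine Real.rpow_le_rpow_of_exponent_ge hε hε1 ?_
  have h1 : (profile K (absIdx j) : ℝ) ≤ K := by exact_mod_cast profile_le hK _
  have h2 := mul_le_mul_of_nonneg_right h1 hν0
  push_cast
  linarith

end Initial

/-! ### Assembly: expansion, stability and change of norm -/

theorem theorem2 (K : ℕ) (hK : 3 ≤ K) (ν s ρ γ C₀ B : ℝ) (hν0 : 0 ≤ ν) (hν : ν < 1 / 2)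
    (hs : 1 / 2 < s) (hρ : 0 < ρ) (hγ0 : 0 < γ) (hγ1 : γ ≤ 1) :
    ∃ ε₀ : ℝ, 0 < ε₀ ∧ ∃ C : ℝ, 0 < C ∧
      ∀ (M : ℕ) [NeZero M], K ≤ M →
      ∀ τ : ℝ, 0 < τ → ∀ ε : ℝ, 0 < ε → ε ≤ ε₀ →
      NonResonant K M ρ τ ε ν γ →
      ∀ ψ φ : ℝ → ℝ, IsSymplecticFilter B ψ φ →
      ∀ u v : ℕ → ZMod (2 * M) → ℂ, IsTrigIntegrator ρ τ ψ φ u v →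
      IsRealData (u 0) → IsRealData (v 0) →
      ∑ l ∈ Finset.range (M + 1), sobWeight s l * ε ^ (-(profile K l : ℝ)) *
          modeEnergy ρ (u 0) (v 0) (l : ZMod (2 * M)) ≤ C₀ →
      ∃ (z : ZMod (2 * M) → (Fin (M + 1) → ℤ) → Polynomial ℂ)
        (d : ZMod (2 * M) → (Fin (M + 1) → ℤ) → ℝ → ℂ)
        (r r' : ℕ → ZMod (2 * M) → ℂ),
        (∀ (j : ZMod (2 * M)), ∀ k ∈ modSet K j,
          z (-j) (-k) = (z j k).map (starRingEnd ℂ)) ∧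
        (∀ n : ℕ, (n : ℝ) * τ ≤ 1 → ∀ j,
          u n j = mfe K ρ ε ν z ((n : ℝ) * τ) j + r n j ∧
          v n j = mfeVel K ρ τ ε ν z ((n : ℝ) * τ) j + r' n j) ∧
        (∀ n : ℕ, (n : ℝ) * τ ≤ 1 →
          wnorm K s ν ε (diagMul ρ (fun w => w) (r n)) + wnorm K s ν ε (r' n)
            ≤ C * ε ^ ((K : ℝ) * (1 - 2 * ν))) ∧
        SatisfiesModSystem K ρ τ ε ν ψ φ z d ∧
        (∀ t : ℝ, 0 ≤ t → t ≤ 1 →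
          wnorm K s ν ε
              (fun j => ((∑ k ∈ modFinset K j, ‖d j k (ε ^ (ν / 2) * t)‖ : ℝ) : ℂ))
            ≤ C * ε ^ ((K : ℝ) * (1 - 2 * ν))) := by
  set D : ℝ := Real.sqrt (8 * (1 / ρ + 1) * C₀)
  obtain ⟨A, hA, hexp⟩ := exists_expansion K ρ ν γ B hs hν D
  obtain ⟨L, hL, hstab⟩ := exists_stability_bound hs ρ B A hA
  have hL0 : 0 ≤ L := zero_le_one.trans hL
  have hLA : 0 ≤ L * A := mul_nonneg hL0 hA
  -- `ε₀` ensures both `ε ≤ 1` and `L A ε ≤ 1`, the latter for the bootstrap. In `C`, each of the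
  -- two remainders contributes `L A`, the defect contributes `A`, and `1` gives positivity.
  refine ⟨1 / (L * A + 1), by positivity, 2 * (L * A) + A + 1, by positivity, ?_⟩
  intro M _ _ τ hτ ε hε hε₀ hnr ψ φ hfil u v huv hu0 hv0 hE
  have hε1 : ε ≤ 1 := hε₀.trans ((div_le_one (by positivity)).2 (by linarith))
  have S : NumSetup K M ρ τ ε ν γ B ψ φ :=
    ⟨hK, hν0, hν, hρ, hγ0, hτ, hε, hε1, hnr, hfil⟩
  obtain ⟨y, z, hyz, hb⟩ := hexp M τ ε ψ φ S (u 0) (v 0) hu0 hv0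
    (snorm_initial_le hρ hε hu0 hv0 hE)
  set κ : ℝ := ε ^ ((K : ℝ) - K * ν) with hκ
  have hκ0 : 0 ≤ κ := Real.rpow_nonneg hε.le _
  -- `K(1 - ν) ≥ 3/2 > 1`, so smallness of `ε` itself makes the defect small enough.
  have hκε : κ ≤ ε := by
    have hK3 : (3 : ℝ) ≤ K := by exact_mod_cast hK
    have : (1 : ℝ) ≤ (K : ℝ) - K * ν := by nlinarith
    simpa using Real.rpow_le_rpow_of_exponent_ge hε hε1 this
  -- The defect order `K - Kν` minus the norm change `Kν` yields the stated exponent.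
  have hprod : ε ^ (-(K * ν)) * κ = ε ^ ((K : ℝ) * (1 - 2 * ν)) := by
    rw [hκ, ← Real.rpow_add hε]; congr 1; ring
  have hw0 : 0 ≤ ε ^ (-(K * ν)) := Real.rpow_nonneg hε.le _
  have hR0 : 0 ≤ ε ^ ((K : ℝ) * (1 - 2 * ν)) := Real.rpow_nonneg hε.le _
  have hsmall : L * (A * κ) ≤ 1 := by
    rw [le_div_iff₀ (by positivity)] at hε₀
    have := mul_le_mul_of_nonneg_left hκε hLA
    linarith
  have hnτ : ∀ n : ℕ, 0 ≤ (n : ℝ) * τ := fun n => by positivity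
  have hst := hstab K M τ ε ν γ ψ φ S u v _ _ _ (A * κ) huv.isPerturbedIntegrator
    (hyz.isPerturbedIntegrator S) (by simpa using hyz.mfe_zero) (by simpa using hyz.mfeVel_zero S)
    (fun n hn => (hb _ (hnτ n) hn).1) (fun n hn => (hb _ (hnτ n) hn).2.2)
    (mul_nonneg hA hκ0) hsmall
  refine ⟨z, modDefect K ρ τ φ y z, fun n j => u n j - mfe K ρ ε ν z (n * τ) j,
    fun n j => v n j - mfeVel K ρ τ ε ν z (n * τ) j, hyz.real, fun n _ j => ⟨by ring, by ring⟩,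
    fun n hn => ?_, hyz.satisfiesModSystem hK, fun t ht0 ht1 => ?_⟩
  · have hn' := hst n hn
    have h1 := (snorm_mono' (s := s) (fun j => norm_nonneg _)
      fun j => norm_fst_le_pairNorm ((freq ρ (absIdx j) : ℂ) * (u n j - mfe K ρ ε ν z (n * τ) j))
        (v n j - mfeVel K ρ τ ε ν z (n * τ) j)).trans hn'
    have h2 := (snorm_mono' (s := s) (fun j => norm_nonneg _)
      fun j => norm_snd_le_pairNorm ((freq ρ (absIdx j) : ℂ) * (u n j - mfe K ρ ε ν z (n * τ) j))
        (v n j - mfeVel K ρ τ ε ν z (n * τ) j)).trans hn'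
    have h3 := (wnorm_le hK (s := s) hν0 hε hε1 (diagMul ρ (fun w => w)
      (fun j => u n j - mfe K ρ ε ν z (n * τ) j))).trans (mul_le_mul_of_nonneg_left h1 hw0)
    have h4 := (wnorm_le hK (s := s) hν0 hε hε1
      (fun j => v n j - mfeVel K ρ τ ε ν z (n * τ) j)).trans (mul_le_mul_of_nonneg_left h2 hw0)
    have h5 : ε ^ (-(K * ν)) * (L * (A * κ)) = L * A * ε ^ ((K : ℝ) * (1 - 2 * ν)) := by
      rw [← hprod]; ring
    rw [h5] at h3 h4
    refine (add_le_add h3 h4).trans ?_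
    have := mul_nonneg hA hR0
    linarith
  · refine (wnorm_le hK hν0 hε hε1 _).trans ?_
    have h1 : (fun j => ‖((∑ k ∈ modFinset K j,
        ‖modDefect K ρ τ φ y z j k (ε ^ (ν / 2) * t)‖ : ℝ) : ℂ)‖)
        = fun j => ∑ k ∈ modFinset K j, ‖modDefect K ρ τ φ y z j k (ε ^ (ν / 2) * t)‖ := by
      funext j
      rw [Complex.norm_real, Real.norm_eq_abs,
        abs_of_nonneg (Finset.sum_nonneg fun _ _ => norm_nonneg _)]
    rw [h1]
    refine (mul_le_mul_of_nonneg_left (hb t ht0 ht1).2.1 hw0).trans ?_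
    have h5 : ε ^ (-(K * ν)) * (A * κ) = A * ε ^ ((K : ℝ) * (1 - 2 * ν)) := by
      rw [← hprod]; ring
    rw [h5]
    have := mul_nonneg hLA hR0
    linarith
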